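/- **Setting.** Let $\mathbb X$ be a non-empty compact metric space, $\tau:\mathbb X\to[0,\infty)$ continuous, $\mu$ a finite Borel measure on $\mathbb X$ and $T\in\mathbb R$. Let $\mathbb S=C(\mathbb X)$ with the sup norm and its Borel $\sigma$-algebra, and let $\mathbb M$ be the set of Gaussian measures on $\mathbb S$ (degenerate ones included) with the $\sigma$-algebra generated by the maps $\nu\mapsto\nu(A)$. For $\nu\in\mathbb M$ let $m_\nu,k_\nu$ be its mean and covariance functions and $s_\nu^2(x)=k_\nu(x,x)+\tau^2(x)$; write $\nu_n\to\nu$ if $m_{\nu_n}\to m_\nu$ and $k_{\nu_n}\to k_\nu$ uniformly. *Observations.* Let $\xi$ be a Gaussian random element of $\mathbb S$ on a probability space, with distribution $P_0^\xi$, and $(U_n)_{n\ge1}$ i.i.d. $N(0,1)$ variables independent of $\xi$. A sequential design is a sequence $(X_n)_{n\ge 1}$ of $\mathbb X$-valued random variables with $X_n$ $\mathcal F_{n-1}$-measurable, where $Z_n=\xi(X_n)+\tau(X_n)U_n$, $\mathcal F_n=\sigma(X_1,Z_1,\dots,X_n,Z_n)$; $\mathcal F_\infty=\bigvee_n\mathcal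 F_n$. $\mathrm{Cond}_{x,z}(\nu)$ is the Gaussian measure with mean $m_\nu+k_\nu(\cdot,x)\,(z-m_\nu(x))/s_\nu^2(x)$ and covariance $k_\nu-k_\nu(\cdot,x)k_\nu(x,\cdot)/s_\nu^2(x)$ (equal to $\nu$ if $s_\nu^2(x)=0$), and $P_{n+1}^\xi=\mathrm{Cond}_{X_{n+1},Z_{n+1}}(P_n^\xi)$ is the conditional distribution of $\xi$ given $\mathcal F_{n+1}$. *Functionals.* For measurable $H:\mathbb M\to[0,\infty)$ put $J_x(\nu)=\iint H(\mathrm{Cond}_{x,f(x)+u\tau(x)}(\nu))\,\nu(df)\,\phi(u)\,du$, with $\phi$ the standard normal density, and $G(\nu)=\sup_{x}(H(\nu)-J_x(\nu))$. For positive $\varepsilon=(\varepsilon_n)$, a sequential design is *$\varepsilon$-quasi-SUR* for $H$ if for some $n_0$, almost surely, $J_{X_{n+1}}(P_n^\xi)\le\inf_xJ_x(P_n^\xi)+\varepsilon_n$ for all $n\ge n_0$; it is *quasi-SUR* if this holds for some positive $\varepsilon_n\to0$. A measurable $H:\mathbb M\to\mathbb R$ has the *supermartingale property* if $(H(P_n^\xi))_n$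 is an $(\mathcal F_n)$-supermartingale for every $P_0^\xi\in\mathbb M$ and every sequential design. Let $\mathfrak P(\xi)$ be the set of all $\mathbb M$-valued random elements that are conditional distributions of $\xi$ given some sub-$\sigma$-algebra. A measurable $H:\mathbb M\to\mathbb R$ is *$\mathfrak P$-uniformly integrable* if, for every Gaussian random element $\xi$ of $\mathbb S$, $(H(\boldsymbol\nu))_{\boldsymbol\nu\in\mathfrak P(\xi)}$ is uniformly integrable, and *$\mathfrak P$-continuous* if, for every such $\xi$, $H(\boldsymbol\nu_n)\to H(\boldsymbol\nu_\infty)$ a.s. whenever $\boldsymbol\nu_n,\boldsymbol\nu_\infty\in\mathfrak P(\xi)$ and $\boldsymbol\nu_n\to\boldsymbol\nu_\infty$ a.s. *Regular losses.* A loss $L:\mathbb S\times\mathbb D\to[0,\infty)$ induces $H(\nu)=\inf_{d\in\mathbb D}\overline L_\nu(d)$, $\overline L_\nu(d)=\int L(f,d)\,\nu(df)$. It is *regular* if (i) $\mathbb D$ is a separable topological space; (ii) $L(\cdot,d)$ is measurable for all $d$; (iii) $\overline L_\nu$ is finite and continuous on $\mathbb D$ for all $\nu\in\mathbb M$; (iv)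 $H=H_0+H_1$ with $H_0(\nu)=\int L_0\,d\nu$ for some measurable $L_0:\mathbb S\to\mathbb R$ integrable under every $\nu\in\mathbb M$, and $H_1$ $\mathfrak P$-uniformly integrable and $\mathfrak P$-continuous; (v) $\{H=0\}=\{G=0\}$. **Theorem.** Let $\mathbb D\subset L^2(\mu)$ be the set of (classes of) measurable functions with values in $[0,1]$, $\Gamma(f)=\{x:f(x)\ge T\}$ and $L(f,d)=\lVert\mathbf 1_{\Gamma(f)}-d\rVert_{L^2(\mu)}^2$. Then $L$ is regular, and the functional it induces is $H(\nu)=\int p_\nu(1-p_\nu)\,d\mu$ with $p_\nu(x)=\nu\{f:f(x)\ge T\}$. Consequently: a) $H$ is measurable and has the supermartingale property, and there is a decomposition $H=H_0+H_1$ as in (iv) in which $H_1$ moreover has the supermartingale property; for every quasi-SUR design associated with $H$, there is an $\mathcal F_\infty$-measurable $\mathbb M$-valued version $P_\infty^\xi$ of the conditional distribution of $\xi$ given $\mathcal F_\infty$ such that $H(P_n^\xi)\to H(P_\infty^\xi)$ and $G(P_n^\xi)\to G(P_\infty^\xi)$ almost surely; b) for all $\xi$ and $(U_n)$ as above and every sequence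 $\varepsilon$ of positive reals, there is an $\varepsilon$-quasi-SUR sequential design associated with $H$ (the inequality can be made to hold at every sample point and for all $n\ge0$); c) for every quasi-SUR design associated with $H$, $H(P_n^\xi)\to0$ almost surely. -/

import Mathlib

open MeasureTheory ProbabilityTheory Filter Topology
open scoped ENNReal NNReal

universe u v w

set_option linter.unusedSectionVars false

namespace SUR

/-! ## Gaussian measures on `C(𝕏)` -/

section GaussianMeasures

variable {𝕏 : Type u} [MetricSpace 𝕏] [CompactSpace 𝕏]

/-- The Borel σ-algebra of the Banach space `C(𝕏)` of continuous functions (sup norm). -/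
instance instMeasurableSpaceC : MeasurableSpace C(𝕏, ℝ) := borel _

instance instBorelSpaceC : BorelSpace C(𝕏, ℝ) := ⟨rfl⟩

variable (𝕏) in
/-- The set of all Gaussian measures on `C(𝕏)` (degenerate ones included). As a subtype of
`Measure C(𝕏, ℝ)` it carries the σ-algebra generated by the evaluation maps `ν ↦ ν A`. -/
abbrev GaussianMeasure : Type u := {ν : Measure C(𝕏, ℝ) // IsGaussian ν}

instance instIsGaussianCoe (ν : GaussianMeasure 𝕏) : IsGaussian (ν : Measure C(𝕏, ℝ)) := ν.2

/-- Mean function `m_ν`. -/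
noncomputable def meanFun (ν : GaussianMeasure 𝕏) (x : 𝕏) : ℝ :=
  ∫ f, f x ∂(ν : Measure C(𝕏, ℝ))

/-- Covariance function `k_ν`. -/
noncomputable def covFun (ν : GaussianMeasure 𝕏) (x y : 𝕏) : ℝ :=
  cov[fun f : C(𝕏, ℝ) => f x, fun f : C(𝕏, ℝ) => f y; (ν : Measure C(𝕏, ℝ))]

/-- Convergence of Gaussian measures: uniform convergence of mean and covariance functions. -/
def GaussianTendsto (ν : ℕ → GaussianMeasure 𝕏) (ν' : GaussianMeasure 𝕏) : Prop :=
  TendstoUniformly (fun n => meanFun (ν n)) (meanFun ν') atTop ∧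
  TendstoUniformly (fun n (p : 𝕏 × 𝕏) => covFun (ν n) p.1 p.2)
    (fun p : 𝕏 × 𝕏 => covFun ν' p.1 p.2) atTop

lemma memLp_eval (ν : GaussianMeasure 𝕏) (x : 𝕏) :
    MemLp (fun f : C(𝕏, ℝ) => f x) 2 (ν : Measure C(𝕏, ℝ)) :=
  IsGaussian.memLp_dual (ν : Measure C(𝕏, ℝ)) (ContinuousMap.evalCLM ℝ x) 2 (by simp)

lemma continuous_covFun_left (ν : GaussianMeasure 𝕏) (x : 𝕏) :
    Continuous (fun y => covFun ν y x) := by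
  have hid : MemLp id 2 (ν : Measure C(𝕏, ℝ)) := IsGaussian.memLp_two_id
  have h2 : Integrable (fun f : C(𝕏, ℝ) => ‖f‖ * ‖f‖) (ν : Measure C(𝕏, ℝ)) :=
    hid.norm.integrable_mul hid.norm
  have h1 : Integrable (fun f : C(𝕏, ℝ) => ‖f‖) (ν : Measure C(𝕏, ℝ)) :=
    (hid.integrable (by norm_num)).norm
  have heq : (fun y => covFun ν y x) = fun y =>
      (∫ f : C(𝕏, ℝ), f y * f x ∂(ν : Measure C(𝕏, ℝ))) -
      (∫ f : C(𝕏, ℝ), f y ∂(ν : Measure C(𝕏, ℝ))) *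
        ∫ f : C(𝕏, ℝ), f x ∂(ν : Measure C(𝕏, ℝ)) := by
    funext y
    exact covariance_eq_sub (memLp_eval ν y) (memLp_eval ν x)
  rw [heq]
  refine Continuous.sub ?_ (Continuous.mul ?_ continuous_const)
  · refine continuous_of_dominated (F := fun y (f : C(𝕏, ℝ)) => f y * f x)
      (bound := fun f => ‖f‖ * ‖f‖) ?_ ?_ h2 ?_
    · intro y
      exact (memLp_eval ν y).1.mul (memLp_eval ν x).1
    · intro y
      refine Eventually.of_forall fun f => ?_
      rw [norm_mul]
      exact mul_le_mul (f.norm_coe_le_norm y) (f.norm_coe_le_norm x) (norm_nonneg _)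
        (norm_nonneg _)
    · exact Eventually.of_forall fun f => by fun_prop
  · refine continuous_of_dominated (F := fun y (f : C(𝕏, ℝ)) => f y)
      (bound := fun f => ‖f‖) ?_ ?_ h1 ?_
    · intro y
      exact (memLp_eval ν y).1
    · intro y
      exact Eventually.of_forall fun f => f.norm_coe_le_norm y
    · exact Eventually.of_forall fun f => by fun_prop

/-- The continuous function `k_ν(·, x)`. -/
noncomputable def covSection (ν : GaussianMeasure 𝕏) (x : 𝕏) : C(𝕏, ℝ) :=
  ⟨fun y => covFun ν y x, continuous_covFun_left ν x⟩

/-- `s_ν²(x) = k_ν(x, x) + τ²(x)`, the variance of a noisy observation at `x`. -/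
noncomputable def obsVar (τ : C(𝕏, ℝ≥0)) (ν : GaussianMeasure 𝕏) (x : 𝕏) : ℝ :=
  covFun ν x x + (τ x : ℝ) ^ 2

/-! ## Conditioning -/

/-- The affine map `(f, u) ↦ f - (f(x) + τ(x) u - z) / s_ν²(x) • k_ν(·, x)`. -/
noncomputable def condMap (τ : C(𝕏, ℝ≥0)) (x : 𝕏) (z : ℝ) (ν : GaussianMeasure 𝕏)
    (p : C(𝕏, ℝ) × ℝ) : C(𝕏, ℝ) :=
  p.1 - ((p.1 x + τ x * p.2 - z) / obsVar τ ν x) • covSection ν x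

/-- The linear part of `condMap`. -/
noncomputable def condLin (τ : C(𝕏, ℝ≥0)) (x : 𝕏) (ν : GaussianMeasure 𝕏) :
    C(𝕏, ℝ) × ℝ →L[ℝ] C(𝕏, ℝ) :=
  ContinuousLinearMap.fst ℝ _ _ -
    ((ContinuousMap.evalCLM ℝ x).comp (ContinuousLinearMap.fst ℝ C(𝕏, ℝ) ℝ) +
      (τ x : ℝ) • ContinuousLinearMap.snd ℝ C(𝕏, ℝ) ℝ).smulRight
        ((obsVar τ ν x)⁻¹ • covSection ν x)

lemma condMap_eq (τ : C(𝕏, ℝ≥0)) (x : 𝕏) (z : ℝ) (ν : GaussianMeasure 𝕏) :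
    condMap τ x z ν = (fun f => f + (z / obsVar τ ν x) • covSection ν x) ∘ condLin τ x ν := by
  funext p
  ext y
  simp [condMap, condLin]
  ring

lemma isGaussian_cond (τ : C(𝕏, ℝ≥0)) (x : 𝕏) (z : ℝ) (ν : GaussianMeasure 𝕏) :
    IsGaussian (((ν : Measure C(𝕏, ℝ)).prod (gaussianReal 0 1)).map (condMap τ x z ν)) := by
  rw [condMap_eq, ← Measure.map_map (by fun_prop) (by fun_prop)]
  infer_instance

/-- `Cond_{x,z}(ν)`: the conditional distribution of `ξ ∼ ν` given `ξ(x) + τ(x) U = z`, where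
`U ∼ N(0,1)` is independent of `ξ`. It is the Gaussian measure with mean function
`m_ν + k_ν(·,x) (z - m_ν(x)) / s_ν²(x)` and covariance function
`k_ν - k_ν(·,x) k_ν(x,·) / s_ν²(x)`, see `meanFun_cond` and `covFun_cond` below, where the
(pseudo-)inverse of `s_ν²(x)` is `0` if `s_ν²(x) = 0`. It is realised as the law of
`ξ - k_ν(·,x) (ξ(x) + τ(x) U - z) / s_ν²(x)`. -/
noncomputable def condLaw (τ : C(𝕏, ℝ≥0)) (x : 𝕏) (z : ℝ) (ν : GaussianMeasure 𝕏) :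
    GaussianMeasure 𝕏 :=
  ⟨((ν : Measure C(𝕏, ℝ)).prod (gaussianReal 0 1)).map (condMap τ x z ν),
    isGaussian_cond τ x z ν⟩

lemma measurable_condMap (τ : C(𝕏, ℝ≥0)) (x : 𝕏) (z : ℝ) (ν : GaussianMeasure 𝕏) :
    Measurable (condMap τ x z ν) := by
  rw [condMap_eq]
  exact (by fun_prop : Measurable fun f : C(𝕏, ℝ) =>
    f + (z / obsVar τ ν x) • covSection ν x).comp (by fun_prop)

lemma measurable_eval (x : 𝕏) : Measurable (fun f : C(𝕏, ℝ) => f x) :=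
  (ContinuousMap.evalCLM ℝ x).measurable

lemma covFun_comm (ν : GaussianMeasure 𝕏) (x y : 𝕏) : covFun ν x y = covFun ν y x :=
  covariance_comm _ _

lemma condMap_apply (τ : C(𝕏, ℝ≥0)) (x : 𝕏) (z : ℝ) (ν : GaussianMeasure 𝕏)
    (p : C(𝕏, ℝ) × ℝ) (y : 𝕏) :
    condMap τ x z ν p y =
      p.1 y - (p.1 x + τ x * p.2) * (covFun ν y x / obsVar τ ν x) +
        z * covFun ν y x / obsVar τ ν x := by
  simp [condMap, covSection]
  ring

lemma memLp_fst (ν : GaussianMeasure 𝕏) (y : 𝕏) :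
    MemLp (fun p : C(𝕏, ℝ) × ℝ => p.1 y) 2 ((ν : Measure C(𝕏, ℝ)).prod (gaussianReal 0 1)) :=
  (memLp_eval ν y).comp_fst _

lemma memLp_snd (ν : GaussianMeasure 𝕏) :
    MemLp (fun p : C(𝕏, ℝ) × ℝ => p.2) 2 ((ν : Measure C(𝕏, ℝ)).prod (gaussianReal 0 1)) :=
  (memLp_id_gaussianReal' (μ := 0) (v := 1) 2 (by simp)).comp_snd (ν : Measure C(𝕏, ℝ))

lemma meanFun_cond (τ : C(𝕏, ℝ≥0)) (x : 𝕏) (z : ℝ) (ν : GaussianMeasure 𝕏) (y : 𝕏) :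
    meanFun (condLaw τ x z ν) y =
      meanFun ν y + covFun ν y x * (z - meanFun ν x) / obsVar τ ν x := by
  have hA : ∀ w, Integrable (fun p : C(𝕏, ℝ) × ℝ => p.1 w)
      ((ν : Measure C(𝕏, ℝ)).prod (gaussianReal 0 1)) := fun w =>
    (memLp_fst ν w).integrable (by norm_num)
  have hB : Integrable (fun p : C(𝕏, ℝ) × ℝ => p.2)
      ((ν : Measure C(𝕏, ℝ)).prod (gaussianReal 0 1)) :=
    (memLp_snd ν).integrable (by norm_num)
  have hAm : ∀ w, ∫ p : C(𝕏, ℝ) × ℝ, p.1 w ∂((ν : Measure C(𝕏, ℝ)).prod (gaussianReal 0 1)) =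
      meanFun ν w := fun w => by
    rw [integral_fun_fst (fun f : C(𝕏, ℝ) => f w)]
    simp [meanFun]
  have hBm : ∫ p : C(𝕏, ℝ) × ℝ, p.2 ∂((ν : Measure C(𝕏, ℝ)).prod (gaussianReal 0 1)) = 0 := by
    rw [integral_fun_snd (fun u : ℝ => u)]
    simp
  have h1 : meanFun (condLaw τ x z ν) y = ∫ p, condMap τ x z ν p y
      ∂((ν : Measure C(𝕏, ℝ)).prod (gaussianReal 0 1)) :=
    integral_map (measurable_condMap τ x z ν).aemeasurable
      (measurable_eval y).aestronglyMeasurable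
  rw [h1]
  simp_rw [condMap_apply]
  have hAB := ((hA x).add (hB.const_mul (τ x : ℝ))).mul_const (covFun ν y x / obsVar τ ν x)
  simp only [Pi.add_apply] at hAB
  have hS := (hA y).sub hAB
  simp only [Pi.sub_def] at hS
  rw [integral_add hS (integrable_const _), integral_sub (hA y) hAB,
    integral_mul_const, integral_add (hA x) (hB.const_mul _), integral_const_mul, hAm, hAm, hBm]
  simp
  ring

lemma covFun_cond (τ : C(𝕏, ℝ≥0)) (x : 𝕏) (z : ℝ) (ν : GaussianMeasure 𝕏) (y y' : 𝕏) :
    covFun (condLaw τ x z ν) y y' =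
      covFun ν y y' - covFun ν y x * covFun ν x y' / obsVar τ ν x := by
  have hAA : ∀ v w, cov[fun p : C(𝕏, ℝ) × ℝ => p.1 v, fun p => p.1 w;
      (ν : Measure C(𝕏, ℝ)).prod (gaussianReal 0 1)] = covFun ν v w := fun v w => by
    have h := covariance_map_fun (μ := (ν : Measure C(𝕏, ℝ)).prod (gaussianReal 0 1))
      (X := fun f : C(𝕏, ℝ) => f v) (Y := fun f : C(𝕏, ℝ) => f w) (Z := Prod.fst)
      (measurable_eval v).aestronglyMeasurable (measurable_eval w).aestronglyMeasurable
      measurable_fst.aemeasurable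
    rw [← h, ← Measure.fst, Measure.fst_prod]
    rfl
  have hAB : ∀ v, cov[fun p : C(𝕏, ℝ) × ℝ => p.1 v, fun p => p.2;
      (ν : Measure C(𝕏, ℝ)).prod (gaussianReal 0 1)] = 0 := fun v =>
    covariance_fst_snd_prod (memLp_eval ν v) (memLp_id_gaussianReal' 2 (by simp))
  have hBA : ∀ v, cov[fun p : C(𝕏, ℝ) × ℝ => p.2, fun p => p.1 v;
      (ν : Measure C(𝕏, ℝ)).prod (gaussianReal 0 1)] = 0 := fun v => by
    rw [covariance_comm, hAB]
  have hBB : cov[fun p : C(𝕏, ℝ) × ℝ => p.2, fun p => p.2;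
      (ν : Measure C(𝕏, ℝ)).prod (gaussianReal 0 1)] = 1 := by
    have h := covariance_map_fun (μ := (ν : Measure C(𝕏, ℝ)).prod (gaussianReal 0 1))
      (X := fun u : ℝ => u) (Y := fun u : ℝ => u) (Z := Prod.snd)
      measurable_id.aestronglyMeasurable measurable_id.aestronglyMeasurable
      measurable_snd.aemeasurable
    rw [← h, ← Measure.snd, Measure.snd_prod, covariance_self (by fun_prop)]
    simp
  have h1 : covFun (condLaw τ x z ν) y y' = cov[fun p => condMap τ x z ν p y,
      fun p => condMap τ x z ν p y'; (ν : Measure C(𝕏, ℝ)).prod (gaussianReal 0 1)] :=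
    covariance_map_fun (measurable_eval y).aestronglyMeasurable
      (measurable_eval y').aestronglyMeasurable (measurable_condMap τ x z ν).aemeasurable
  have hO : MemLp (fun p : C(𝕏, ℝ) × ℝ => p.1 x + τ x * p.2) 2
      ((ν : Measure C(𝕏, ℝ)).prod (gaussianReal 0 1)) :=
    (memLp_fst ν x).add ((memLp_snd ν).const_mul (τ x : ℝ))
  have hOc : ∀ c : ℝ, MemLp (fun p : C(𝕏, ℝ) × ℝ => (p.1 x + τ x * p.2) * c) 2
      ((ν : Measure C(𝕏, ℝ)).prod (gaussianReal 0 1)) := fun c => hO.mul_const c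
  have hB := (memLp_snd ν).const_mul (τ x : ℝ)
  have hAO : ∀ v, cov[fun p : C(𝕏, ℝ) × ℝ => p.1 v, fun p => p.1 x + τ x * p.2;
      (ν : Measure C(𝕏, ℝ)).prod (gaussianReal 0 1)] = covFun ν v x := fun v => by
    have := covariance_add_right (memLp_fst ν v) (memLp_fst ν x) hB
    simp only [Pi.add_def] at this
    rw [this, covariance_const_mul_right, hAA, hAB]
    ring
  have hOA : ∀ v, cov[fun p : C(𝕏, ℝ) × ℝ => p.1 x + τ x * p.2, fun p => p.1 v;
      (ν : Measure C(𝕏, ℝ)).prod (gaussianReal 0 1)] = covFun ν x v := fun v => by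
    rw [covariance_comm, hAO, covFun_comm]
  have hOO : cov[fun p : C(𝕏, ℝ) × ℝ => p.1 x + τ x * p.2, fun p => p.1 x + τ x * p.2;
      (ν : Measure C(𝕏, ℝ)).prod (gaussianReal 0 1)] = obsVar τ ν x := by
    have h2 := covariance_add_left (memLp_fst ν x) hB hO
    have h3 := covariance_add_right (memLp_snd ν) (memLp_fst ν x) hB
    simp only [Pi.add_def] at h2 h3
    rw [h2, hAO, covariance_const_mul_left, h3, hBA, covariance_const_mul_right, hBB, obsVar]
    ring
  have hI : ∀ (v : 𝕏) (c : ℝ), Integrable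
      (fun p : C(𝕏, ℝ) × ℝ => p.1 v - (p.1 x + τ x * p.2) * c)
      ((ν : Measure C(𝕏, ℝ)).prod (gaussianReal 0 1)) := fun v c =>
    ((memLp_fst ν v).sub (hOc c)).integrable (by norm_num)
  rw [h1]
  simp_rw [condMap_apply]
  rw [covariance_add_const_left (hI _ _), covariance_add_const_right (hI _ _),
    covariance_fun_sub_fun_sub (memLp_fst ν y) (hOc _) (memLp_fst ν y') (hOc _)]
  simp_rw [covariance_mul_const_left, covariance_mul_const_right]
  rw [hAA, hAO, hOA, hOO, covFun_comm ν y' x]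
  by_cases h : obsVar τ ν x = 0
  · simp [h]
  · field_simp
    ring

/-- `Cond_{x₁,z₁,…,xₙ,zₙ}(ν)`, for the first `n` terms of the sequences `x` and `z`. -/
noncomputable def condSeq (τ : C(𝕏, ℝ≥0)) (ν : GaussianMeasure 𝕏) (x : ℕ → 𝕏) (z : ℕ → ℝ) :
    ℕ → GaussianMeasure 𝕏
  | 0 => ν
  | n + 1 => condLaw τ (x n) (z n) (condSeq τ ν x z n)

end GaussianMeasures

/-! ## The observation model and sequential designs

Indices are shifted by one: `X n`, `Z n`, `U n` stand for the `(n+1)`-st design point,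
observation and noise variable. -/

section Model

variable {𝕏 : Type u} [MetricSpace 𝕏] [CompactSpace 𝕏] {Ω : Type v}

/-- The observations `Z_n = ξ(X_n) + τ(X_n) U_n`. -/
def obs (τ : C(𝕏, ℝ≥0)) (ξ : Ω → C(𝕏, ℝ)) (U : ℕ → Ω → ℝ) (X : ℕ → Ω → 𝕏) (n : ℕ) (ω : Ω) : ℝ :=
  ξ ω (X n ω) + τ (X n ω) * U n ω

/-- The σ-algebra `ℱ_n` generated by the first `n` design points and observations. -/
@[reducible] def obsSigma [MeasurableSpace 𝕏] (τ : C(𝕏, ℝ≥0)) (ξ : Ω → C(𝕏, ℝ)) (U : ℕ → Ω → ℝ)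
    (X : ℕ → Ω → 𝕏) (n : ℕ) : MeasurableSpace Ω :=
  ⨆ i : Fin n, (MeasurableSpace.comap (X i) inferInstance ⊔
    MeasurableSpace.comap (obs τ ξ U X i) inferInstance)

/-- Sequential design: each design point is measurable with respect to the σ-algebra generated by
the previous design points and observations. -/
def IsSequentialDesign [MeasurableSpace 𝕏] (τ : C(𝕏, ℝ≥0)) (ξ : Ω → C(𝕏, ℝ)) (U : ℕ → Ω → ℝ)
    (X : ℕ → Ω → 𝕏) : Prop :=
  ∀ n, Measurable[obsSigma τ ξ U X n] (X n)

/-- `P_n^ξ`, the conditional distribution of `ξ ∼ ν₀` given the first `n` observations. -/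
noncomputable def postLaw (τ : C(𝕏, ℝ≥0)) (ν₀ : GaussianMeasure 𝕏) (ξ : Ω → C(𝕏, ℝ))
    (U : ℕ → Ω → ℝ) (X : ℕ → Ω → 𝕏) (n : ℕ) (ω : Ω) : GaussianMeasure 𝕏 :=
  condSeq τ ν₀ (fun i => X i ω) (fun i => obs τ ξ U X i ω) n

variable [MeasurableSpace Ω]

/-- `ξ` is a Gaussian random element of `C(𝕏)` with distribution `ν₀`, and `(U_n)` is an i.i.d.
`N(0,1)` sequence independent of `ξ`. -/
structure IsModel (P : Measure Ω) (ν₀ : GaussianMeasure 𝕏) (ξ : Ω → C(𝕏, ℝ))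
    (U : ℕ → Ω → ℝ) : Prop where
  measurable_xi : Measurable ξ
  map_xi : P.map ξ = (ν₀ : Measure C(𝕏, ℝ))
  measurable_noise : ∀ n, Measurable (U n)
  map_noise : ∀ n, P.map (U n) = gaussianReal 0 1
  iIndepFun_noise : iIndepFun U P
  indepFun_xi_noise : IndepFun ξ (fun ω n => U n ω) P

variable [MeasurableSpace 𝕏] [BorelSpace 𝕏]

lemma obsSigma_mono (τ : C(𝕏, ℝ≥0)) (ξ : Ω → C(𝕏, ℝ)) (U : ℕ → Ω → ℝ) (X : ℕ → Ω → 𝕏) :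
    Monotone (obsSigma τ ξ U X) := fun _ _ h =>
  iSup_le fun i => le_iSup (fun j : Fin _ => MeasurableSpace.comap (X j) inferInstance ⊔
    MeasurableSpace.comap (obs τ ξ U X j) inferInstance) (Fin.castLE h i)

lemma measurable_obs (τ : C(𝕏, ℝ≥0)) {ξ : Ω → C(𝕏, ℝ)} {U : ℕ → Ω → ℝ} {X : ℕ → Ω → 𝕏}
    (hξ : Measurable ξ) (hU : ∀ n, Measurable (U n)) {n : ℕ} (hX : Measurable (X n)) :
    Measurable (obs τ ξ U X n) := by
  have h1 : Measurable (fun ω => ξ ω (X n ω)) :=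
    (ContinuousEval.continuous_eval (F := C(𝕏, ℝ)) (X := 𝕏) (Y := ℝ)).measurable.comp
      (hξ.prodMk hX)
  have h2 : Measurable (fun ω => ((τ (X n ω) : ℝ≥0) : ℝ)) :=
    (τ.continuous.measurable.comp hX).coe_nnreal_real
  exact h1.add (h2.mul (hU n))

lemma obsSigma_le (τ : C(𝕏, ℝ≥0)) {ξ : Ω → C(𝕏, ℝ)} {U : ℕ → Ω → ℝ} {X : ℕ → Ω → 𝕏}
    (hξ : Measurable ξ) (hU : ∀ n, Measurable (U n)) (hX : IsSequentialDesign τ ξ U X) (n : ℕ) :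
    obsSigma τ ξ U X n ≤ ‹MeasurableSpace Ω› := by
  induction n using Nat.strong_induction_on with
  | _ n ih =>
    refine iSup_le fun i => ?_
    have hXi : Measurable (X i) := (hX i).mono (ih i i.2) le_rfl
    exact sup_le hXi.comap_le (measurable_obs τ hξ hU hXi).comap_le

/-- The filtration `(ℱ_n)`. -/
def obsFiltration (τ : C(𝕏, ℝ≥0)) {P : Measure Ω} {ν₀ : GaussianMeasure 𝕏} {ξ : Ω → C(𝕏, ℝ)}
    {U : ℕ → Ω → ℝ} {X : ℕ → Ω → 𝕏} (hM : IsModel P ν₀ ξ U)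
    (hX : IsSequentialDesign τ ξ U X) : Filtration ℕ ‹MeasurableSpace Ω› where
  seq := obsSigma τ ξ U X
  mono' := obsSigma_mono τ ξ U X
  le' := obsSigma_le τ hM.measurable_xi hM.measurable_noise hX

end Model

/-! ## Uncertainty functionals -/

section Functionals

variable {𝕏 : Type u} [MetricSpace 𝕏] [CompactSpace 𝕏]

/-- `ν = P(ξ ∈ · ∣ 𝓖)`: the random measure `ν` is a version of the conditional distribution of
`ξ` given the σ-algebra `𝓖`. -/
def IsCondDistrib {Ω : Type v} {mΩ : MeasurableSpace Ω} (P : Measure Ω) (ξ : Ω → C(𝕏, ℝ))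
    (𝓖 : MeasurableSpace Ω) (ν : Ω → GaussianMeasure 𝕏) : Prop :=
  ∀ A : Set C(𝕏, ℝ), MeasurableSet A →
    (fun ω => (ν ω : Measure C(𝕏, ℝ)).real A) =ᵐ[P] P⟦ξ ⁻¹' A | 𝓖⟧

/-- The set `𝔓(ξ)` of all Gaussian conditional distributions of `ξ`. -/
def gaussianCondDistribs {Ω : Type v} [mΩ : MeasurableSpace Ω] (P : Measure Ω)
    (ξ : Ω → C(𝕏, ℝ)) : Set (Ω → GaussianMeasure 𝕏) :=
  {ν | Measurable ν ∧ ∃ 𝓖 : MeasurableSpace Ω, 𝓖 ≤ mΩ ∧ IsCondDistrib P ξ 𝓖 ν}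

/-- A functional is `𝔓`-uniformly integrable if it is measurable and, for every Gaussian random
element `ξ` of `C(𝕏)`, the family of all `H(ν)`, `ν ∈ 𝔓(ξ)`, is uniformly integrable. -/
def IsPUniformlyIntegrable (H : GaussianMeasure 𝕏 → ℝ) : Prop :=
  Measurable H ∧
  ∀ (Ω : Type v) [MeasurableSpace Ω] (P : Measure Ω) [IsProbabilityMeasure P]
    (ξ : Ω → C(𝕏, ℝ)), Measurable ξ → HasGaussianLaw ξ P →
    UniformIntegrable (fun (ν : gaussianCondDistribs P ξ) ω => H (ν.1 ω)) 1 P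

/-- A functional is `𝔓`-continuous if it is measurable and, for every Gaussian random element
`ξ` of `C(𝕏)` and all `ν_n, ν_∞ ∈ 𝔓(ξ)` such that `ν_n → ν_∞` almost surely,
`H(ν_n) → H(ν_∞)` almost surely. -/
def IsPContinuous (H : GaussianMeasure 𝕏 → ℝ) : Prop :=
  Measurable H ∧
  ∀ (Ω : Type v) [MeasurableSpace Ω] (P : Measure Ω) [IsProbabilityMeasure P]
    (ξ : Ω → C(𝕏, ℝ)), Measurable ξ → HasGaussianLaw ξ P →
    ∀ (ν : ℕ → Ω → GaussianMeasure 𝕏) (ν' : Ω → GaussianMeasure 𝕏),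
      (∀ n, ν n ∈ gaussianCondDistribs P ξ) → ν' ∈ gaussianCondDistribs P ξ →
      (∀ᵐ ω ∂P, GaussianTendsto (fun n => ν n ω) (ν' ω)) →
      ∀ᵐ ω ∂P, Tendsto (fun n => H (ν n ω)) atTop (𝓝 (H (ν' ω)))

/-- The supermartingale property: `H` is measurable and `(H(P_n^ξ))_n` is an
`(ℱ_n)`-supermartingale for every Gaussian prior and every sequential design. -/
def HasSupermartingaleProperty [MeasurableSpace 𝕏] [BorelSpace 𝕏] (τ : C(𝕏, ℝ≥0))
    (H : GaussianMeasure 𝕏 → ℝ) : Prop :=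
  Measurable H ∧
  ∀ (Ω : Type v) [MeasurableSpace Ω] (P : Measure Ω) [IsProbabilityMeasure P]
    (ν₀ : GaussianMeasure 𝕏) (ξ : Ω → C(𝕏, ℝ)) (U : ℕ → Ω → ℝ) (hM : IsModel P ν₀ ξ U)
    (X : ℕ → Ω → 𝕏) (hX : IsSequentialDesign τ ξ U X),
    Supermartingale (fun n ω => H (postLaw τ ν₀ ξ U X n ω)) (obsFiltration τ hM hX) P

/-- `H = H₀ + H₁`, where `H₀(ν) = ∫ L₀ dν` and `L₀` is integrable with respect to every Gaussian
measure. -/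
def IsDecomposition (H : GaussianMeasure 𝕏 → ℝ≥0) (L₀ : C(𝕏, ℝ) → ℝ)
    (H₁ : GaussianMeasure 𝕏 → ℝ) : Prop :=
  Measurable L₀ ∧ (∀ ν : GaussianMeasure 𝕏, Integrable L₀ (ν : Measure C(𝕏, ℝ))) ∧
  ∀ ν : GaussianMeasure 𝕏, (H ν : ℝ) = ∫ f, L₀ f ∂(ν : Measure C(𝕏, ℝ)) + H₁ ν

/-- The expected residual uncertainty
`J_x(ν) = ∫∫ H(Cond_{x, f(x) + u τ(x)}(ν)) ν(df) φ(u) du`; the sampling criterion is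
`J_n(x) = J_x(P_n^ξ)`. -/
noncomputable def expectedUncertainty (τ : C(𝕏, ℝ≥0)) (H : GaussianMeasure 𝕏 → ℝ≥0) (x : 𝕏)
    (ν : GaussianMeasure 𝕏) : ℝ≥0∞ :=
  ∫⁻ p : C(𝕏, ℝ) × ℝ, (H (condLaw τ x (p.1 x + p.2 * τ x) ν) : ℝ≥0∞)
    ∂((ν : Measure C(𝕏, ℝ)).prod (gaussianReal 0 1))

/-- The maximal expected gain `G(ν) = sup_x (H(ν) - J_x(ν))`. -/
noncomputable def maxGain (τ : C(𝕏, ℝ≥0)) (H : GaussianMeasure 𝕏 → ℝ≥0)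
    (ν : GaussianMeasure 𝕏) : EReal :=
  ⨆ x : 𝕏, (((H ν : ℝ≥0∞) : EReal) - ((expectedUncertainty τ H x ν : ℝ≥0∞) : EReal))

/-- From time `n₀` on, at the sample point `ω`,
`J_n(X_{n+1}) ≤ inf J_n + ε_n` (recall that `X n` is the `(n+1)`-st design point). -/
def QuasiSURFrom {Ω : Type v} (τ : C(𝕏, ℝ≥0)) (H : GaussianMeasure 𝕏 → ℝ≥0)
    (ν₀ : GaussianMeasure 𝕏) (ξ : Ω → C(𝕏, ℝ)) (U : ℕ → Ω → ℝ) (X : ℕ → Ω → 𝕏) (ε : ℕ → ℝ)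
    (n₀ : ℕ) (ω : Ω) : Prop :=
  ∀ n, n₀ ≤ n →
    expectedUncertainty τ H (X n ω) (postLaw τ ν₀ ξ U X n ω) ≤
      (⨅ x : 𝕏, expectedUncertainty τ H x (postLaw τ ν₀ ξ U X n ω)) + ENNReal.ofReal (ε n)

/-- `(X_n)` is an `ε`-quasi-SUR sequential design associated with `H`. -/
def IsEpsQuasiSUR [MeasurableSpace 𝕏] {Ω : Type v} [MeasurableSpace Ω] (τ : C(𝕏, ℝ≥0))
    (H : GaussianMeasure 𝕏 → ℝ≥0) (P : Measure Ω) (ν₀ : GaussianMeasure 𝕏) (ξ : Ω → C(𝕏, ℝ))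
    (U : ℕ → Ω → ℝ) (X : ℕ → Ω → 𝕏) (ε : ℕ → ℝ) : Prop :=
  IsSequentialDesign τ ξ U X ∧ ∃ n₀, ∀ᵐ ω ∂P, QuasiSURFrom τ H ν₀ ξ U X ε n₀ ω

/-- `(X_n)` is a quasi-SUR sequential design associated with `H`. -/
def IsQuasiSUR [MeasurableSpace 𝕏] {Ω : Type v} [MeasurableSpace Ω] (τ : C(𝕏, ℝ≥0))
    (H : GaussianMeasure 𝕏 → ℝ≥0) (P : Measure Ω) (ν₀ : GaussianMeasure 𝕏) (ξ : Ω → C(𝕏, ℝ))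
    (U : ℕ → Ω → ℝ) (X : ℕ → Ω → 𝕏) : Prop :=
  ∃ ε : ℕ → ℝ, (∀ n, 0 < ε n) ∧ Tendsto ε atTop (𝓝 0) ∧ IsEpsQuasiSUR τ H P ν₀ ξ U X ε

/-! ## Loss functions -/

/-- The expected loss of the decision `d` under `ν`. -/
noncomputable def expectedLoss {D : Type w} (L : C(𝕏, ℝ) → D → ℝ≥0) (ν : GaussianMeasure 𝕏)
    (d : D) : ℝ≥0∞ :=
  ∫⁻ f, (L f d : ℝ≥0∞) ∂(ν : Measure C(𝕏, ℝ))

/-- The uncertainty functional `H(ν) = inf_d ∫ L(f, d) ν(df)` induced by a loss function (with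
finite expected losses). -/
noncomputable def lossFunctional {D : Type w} (L : C(𝕏, ℝ) → D → ℝ≥0)
    (ν : GaussianMeasure 𝕏) : ℝ≥0 :=
  (⨅ d : D, expectedLoss L ν d).toNNReal

/-- Regular non-negative loss functions. -/
structure IsRegularLoss [MeasurableSpace 𝕏] [BorelSpace 𝕏] (τ : C(𝕏, ℝ≥0)) {D : Type w}
    [TopologicalSpace D] (L : C(𝕏, ℝ) → D → ℝ≥0) : Prop where
  separable : TopologicalSpace.SeparableSpace D
  measurable_loss : ∀ d, Measurable (fun f => L f d)
  finite : ∀ ν d, expectedLoss L ν d ≠ ∞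
  continuous : ∀ ν, Continuous (expectedLoss L ν)
  decomposition : ∃ L₀ H₁, IsDecomposition (lossFunctional L) L₀ H₁ ∧
    IsPUniformlyIntegrable.{u, v} H₁ ∧ IsPContinuous.{u, v} H₁
  zeros : {ν | lossFunctional L ν = 0} = {ν | maxGain τ (lossFunctional L) ν = 0}

end Functionals

/-! ## The excursion set loss -/

section Excursion

variable {𝕏 : Type u} [MetricSpace 𝕏] [CompactSpace 𝕏] [MeasurableSpace 𝕏] [BorelSpace 𝕏]

/-- The set of soft classifiers: classes of measurable `[0, 1]`-valued functions, as a subset of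
`L²(μ)` with its topology. -/
abbrev SoftClassifier (μ : Measure 𝕏) : Type u :=
  {d : Lp ℝ 2 μ // ∀ᵐ x ∂μ, d x ∈ Set.Icc (0 : ℝ) 1}

/-- The excursion set `Γ(f) = {x | f x ≥ T}`. -/
def excursionSet (T : ℝ) (f : C(𝕏, ℝ)) : Set 𝕏 := {x | T ≤ f x}

lemma measurableSet_excursionSet (T : ℝ) (f : C(𝕏, ℝ)) : MeasurableSet (excursionSet T f) :=
  (isClosed_le continuous_const f.continuous).measurableSet

/-- The loss `‖1_{Γ(f)} - d‖²` in `L²(μ)`. -/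
noncomputable def excursionLoss (μ : Measure 𝕏) [IsFiniteMeasure μ] (T : ℝ) (f : C(𝕏, ℝ))
    (d : SoftClassifier μ) : ℝ≥0 :=
  ‖indicatorConstLp 2 (measurableSet_excursionSet T f) (measure_ne_top μ _) (1 : ℝ) - d.1‖₊ ^ 2

/-- The excursion probability `p_ν(x) = ν {f | f x ≥ T}`. -/
noncomputable def excursionProb (T : ℝ) (ν : GaussianMeasure 𝕏) (x : 𝕏) : ℝ :=
  (ν : Measure C(𝕏, ℝ)).real {f | T ≤ f x}

end Excursion

end SUR

open SUR

/-!
The excursion probability `p_ν(y)` is a function of the mean and the variance of `f y` alone, and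
`L²`-projection shows that `p_ν` itself minimises the expected loss, with minimum the integrated
Bernoulli variance `H(ν) = ∫ p_ν (1 - p_ν) dμ` (`lossFunctional_eq`). `H` is bounded by `μ(𝕏)`, so
the decomposition `H = 0 + H` serves in the definition of a regular loss.

*Gain of one observation.* Under `ν`, the noisy observation at `x` is a Gaussian variable
independent of the residual `condLin τ x ν`, which yields the disintegration of the joint law of
process and observation into the measures `condLaw` (`lintegral_condLaw`). Hence
`J_x(ν) = ∫ condExcVar τ T ν x y ∂μ(y)`, an average over a standard normal variable `w` of the
Bernoulli variance of `{m + c w + s W ≥ T}`, where `W` is an independent standard normal variable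
and `c` is proportional to `k_ν(y, x)` (`expectedUncertainty_eq`). By strict concavity of
`p (1 - p)` this is at most the Bernoulli variance under `ν`, strictly less if `k_ν(y, x) ≠ 0`.
So the expected gains `H(ν) - J_x(ν)` are nonnegative, and if they all vanish then `k_ν(y, x) = 0`
for `μ`-almost every `y` and all `x`, hence `k_ν(y, y) = 0` on the support of `μ` and `H(ν) = 0`
(`maxGain_eq_zero_iff`).

*Dynamics.* The posterior `P_n` is the conditional distribution of the process given the first `n`
observations (`IsModel.isDisintegration_postLaw`), and `J_{X_n}(P_n)` is the conditional expectation
of `H(P_{n+1})` (`IsModel.setLIntegral_succ_eq`), whence the supermartingale property. The expected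
gains of the successive observations have summable expectations, so they tend to `0` almost surely,
and a quasi-optimal design forces all the gains `H(P_n) - J_x(P_n)` to do so, uniformly in `x`
(`ae_tendsto_maxGain`).

*Limit.* The regular conditional distribution of the process given all the observations is almost
surely Gaussian, because by Lévy's upward theorem its characteristic function is, at each member of
a countable weak-* dense family of functionals, the limit of Gaussian ones
(`exists_isDisintegration_iSup`). Lévy's theorem at fixed points of `𝕏` and Fubini's theorem give
convergence of means, covariances and excursion probabilities `μ`-almost everywhere, hence
`H(P_n) → H(P_∞)`. Fatou's lemma turns the vanishing of the gains into the vanishing of the limiting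
covariances (`ae_covFun_eq_zero_of_tendsto_gain`), so `H(P_∞) = 0`, and then `G(P_∞) = 0` as well.
Uniform convergence of `P_n` to `P_∞` is not needed.

*Regularity.* Almost sure convergence of conditional distributions carries over to `H` since at each
point the limit almost surely does not charge the threshold, unless the prior is degenerate there
(`ae_tendsto_excVar_of_gaussianTendsto`). Designs exist because the criterion has the same infimum
over a dense sequence as over `𝕏`, although it may be discontinuous where `s_ν²(x) = 0`
(`iInf_expectedUncertainty_denseSeq`), so that near-minimisers can be selected measurably.
-/

/-! ### Tail probabilities of one-dimensional normal laws -/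

namespace SUR

section NormalTail

/-- `P(m + s W ≥ T)` for a standard normal variable `W`. The standard deviation `s` may be `0`. -/
noncomputable def normalTail (T m s : ℝ) : ℝ := (gaussianReal 0 1).real {w | T ≤ m + s * w}

/-- Expected Bernoulli variance `q (1 - q)` of `q = P(m + c ζ + s W ≥ T ∣ ζ)`, for independent
standard normal variables `ζ` and `W`. -/
noncomputable def meanTailVar (T m c s : ℝ) : ℝ :=
  ∫ ζ, normalTail T (m + c * ζ) s * (1 - normalTail T (m + c * ζ) s) ∂(gaussianReal 0 1)

lemma normalTail_nonneg (T m s : ℝ) : 0 ≤ normalTail T m s := measureReal_nonneg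

lemma normalTail_le_one (T m s : ℝ) : normalTail T m s ≤ 1 := measureReal_le_one

lemma measurableSet_tailSet (T m s : ℝ) : MeasurableSet {w : ℝ | T ≤ m + s * w} :=
  measurableSet_le (by fun_prop) (by fun_prop)

lemma normalTail_eq_integral (T m s : ℝ) :
    normalTail T m s = ∫ w, (Set.Ici T).indicator (fun _ => (1 : ℝ)) (m + s * w)
      ∂(gaussianReal 0 1) := by
  rw [normalTail, ← integral_indicator_one (measurableSet_tailSet T m s)]
  rfl

lemma measurable_normalTail (T : ℝ) : Measurable (fun p : ℝ × ℝ => normalTail T p.1 p.2) := by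
  have h : MeasurableSet {p : (ℝ × ℝ) × ℝ | T ≤ p.1.1 + p.1.2 * p.2} :=
    measurableSet_le (by fun_prop) (by fun_prop)
  exact (measurable_measure_prodMk_left (ν := gaussianReal 0 1) h).ennreal_toReal

lemma ae_affine_ne {T m s : ℝ} (h : s ≠ 0 ∨ m ≠ T) :
    ∀ᵐ w ∂(gaussianReal 0 1), m + s * w ≠ T := by
  have := nullSingletonClass_gaussianReal (μ := 0) (v := 1) one_ne_zero
  by_cases hs : s = 0
  · subst hs
    filter_upwards with w
    simpa using h
  · have : {w : ℝ | ¬ (m + s * w ≠ T)} ⊆ {(T - m) / s} := by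
      intro w hw
      simp only [ne_eq, not_not, Set.mem_ofPred_eq] at hw
      simp only [Set.mem_singleton_iff]
      field_simp
      linarith
    exact measure_mono_null this (measure_singleton _)

lemma tendsto_indicator_Ici {ι : Type*} {l : Filter ι} {T a : ℝ} {u : ι → ℝ} (ha : a ≠ T)
    (hu : Tendsto u l (𝓝 a)) :
    Tendsto (fun i => (Set.Ici T).indicator (fun _ => (1 : ℝ)) (u i)) l
      (𝓝 ((Set.Ici T).indicator (fun _ => (1 : ℝ)) a)) := by
  refine tendsto_const_nhds.congr' ?_
  rcases lt_or_gt_of_ne ha with h | h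
  · filter_upwards [hu.eventually_lt_const h] with i hi
    simp [h, hi]
  · filter_upwards [hu.eventually_const_lt h] with i hi
    simp [h.le, hi.le]

/-- Normal tail probabilities are continuous in the parameters, except at a point mass located
at the threshold. -/
lemma tendsto_normalTail {ι : Type*} {l : Filter ι} [l.IsCountablyGenerated] {T m s : ℝ}
    {m' s' : ι → ℝ} (h : s ≠ 0 ∨ m ≠ T) (hm : Tendsto m' l (𝓝 m)) (hs : Tendsto s' l (𝓝 s)) :
    Tendsto (fun i => normalTail T (m' i) (s' i)) l (𝓝 (normalTail T m s)) := by
  simp_rw [normalTail_eq_integral]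
  refine tendsto_integral_filter_of_dominated_convergence (fun _ => 1) ?_ ?_
    (integrable_const _) ?_
  · refine Eventually.of_forall fun i => Measurable.aestronglyMeasurable ?_
    exact (measurable_const.indicator measurableSet_Ici).comp (by fun_prop)
  · refine Eventually.of_forall fun i => Eventually.of_forall fun w => ?_
    rw [Set.indicator_apply]
    split_ifs <;> simp
  · filter_upwards [ae_affine_ne h] with w hw
    exact tendsto_indicator_Ici hw (hm.add (hs.mul_const w))

lemma bernoulli_var_nonneg {p : ℝ} (h0 : 0 ≤ p) (h1 : p ≤ 1) : 0 ≤ p * (1 - p) :=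
  mul_nonneg h0 (by linarith)

lemma bernoulli_var_le_one {p : ℝ} (h0 : 0 ≤ p) (h1 : p ≤ 1) : p * (1 - p) ≤ 1 := by
  nlinarith

lemma norm_bernoulli_var_le_one {p : ℝ} (h0 : 0 ≤ p) (h1 : p ≤ 1) : ‖p * (1 - p)‖ ≤ 1 := by
  rw [Real.norm_of_nonneg (bernoulli_var_nonneg h0 h1)]
  exact bernoulli_var_le_one h0 h1

lemma normalTail_zero_sd (T m : ℝ) : normalTail T m 0 * (1 - normalTail T m 0) = 0 := by
  by_cases h : T ≤ m <;> simp [normalTail, h]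

lemma tendsto_meanTailVar {ι : Type*} {l : Filter ι} [l.IsCountablyGenerated] {T m c s : ℝ}
    {m' c' s' : ι → ℝ} (h : c ≠ 0 ∨ s ≠ 0 ∨ m ≠ T) (hm : Tendsto m' l (𝓝 m))
    (hc : Tendsto c' l (𝓝 c)) (hs : Tendsto s' l (𝓝 s)) :
    Tendsto (fun i => meanTailVar T (m' i) (c' i) (s' i)) l (𝓝 (meanTailVar T m c s)) := by
  refine tendsto_integral_filter_of_dominated_convergence (fun _ => 1) ?_ ?_
    (integrable_const _) ?_
  · refine Eventually.of_forall fun i => Measurable.aestronglyMeasurable ?_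
    have := (measurable_normalTail T).comp
      (by fun_prop : Measurable fun ζ : ℝ => (m' i + c' i * ζ, s' i))
    exact this.mul (measurable_const.sub this)
  · exact Eventually.of_forall fun i => Eventually.of_forall fun w =>
      norm_bernoulli_var_le_one (normalTail_nonneg _ _ _) (normalTail_le_one _ _ _)
  · have : ∀ᵐ ζ ∂(gaussianReal 0 1), s ≠ 0 ∨ m + c * ζ ≠ T := by
      by_cases h' : s = 0
      · filter_upwards [ae_affine_ne (T := T) (m := m) (s := c) (by tauto)] with ζ hζ
        exact Or.inr hζ
      · exact Eventually.of_forall fun _ => Or.inl h'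
    filter_upwards [this] with ζ hζ
    have := tendsto_normalTail hζ (hm.add (hc.mul_const ζ)) hs
    exact this.mul (tendsto_const_nhds.sub this)

lemma measurable_meanTailVar (T : ℝ) :
    Measurable (fun p : ℝ × ℝ × ℝ => meanTailVar T p.1 p.2.1 p.2.2) := by
  have h : Measurable (fun p : (ℝ × ℝ × ℝ) × ℝ =>
      normalTail T (p.1.1 + p.1.2.1 * p.2) p.1.2.2) :=
    (measurable_normalTail T).comp (by fun_prop :
      Measurable fun p : (ℝ × ℝ × ℝ) × ℝ => (p.1.1 + p.1.2.1 * p.2, p.1.2.2))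
  exact ((h.mul (measurable_const.sub h)).stronglyMeasurable.integral_prod_right).measurable

/-- The law of `c ζ + s W` is `N(0, c² + s²)`; this is the tower property for the tail
probability. -/
lemma integral_normalTail (T m c s : ℝ) :
    ∫ ζ, normalTail T (m + c * ζ) s ∂(gaussianReal 0 1) =
      normalTail T m (Real.sqrt (c ^ 2 + s ^ 2)) := by
  have hmeas : MeasurableSet {r : ℝ | T ≤ m + r} := measurableSet_le (by fun_prop) (by fun_prop)
  have hA : MeasurableSet {p : ℝ × ℝ | T ≤ m + c * p.1 + s * p.2} :=
    measurableSet_le (by fun_prop) (by fun_prop)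
  have hlaw : ((gaussianReal 0 1).prod (gaussianReal 0 1)).map (fun p : ℝ × ℝ => c * p.1 + s * p.2)
      = (gaussianReal 0 1).map (fun w => Real.sqrt (c ^ 2 + s ^ 2) * w) := by
    have hind : IndepFun (fun p : ℝ × ℝ => c * p.1) (fun p : ℝ × ℝ => s * p.2)
        ((gaussianReal 0 1).prod (gaussianReal 0 1)) :=
      indepFun_prod (μ := gaussianReal 0 1) (ν := gaussianReal 0 1)
        (X := fun x : ℝ => c * x) (Y := fun x : ℝ => s * x) (by fun_prop) (by fun_prop)
    have h1 : ((gaussianReal 0 1).prod (gaussianReal 0 1)).map (fun p : ℝ × ℝ => c * p.1) =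
        gaussianReal 0 (.mk (c ^ 2) (sq_nonneg _)) := by
      have := Measure.map_map (μ := (gaussianReal 0 1).prod (gaussianReal 0 1)) (f := Prod.fst)
        (g := fun x : ℝ => c * x) (by fun_prop) (by fun_prop)
      simp only [Function.comp_def] at this
      rw [← this, ← Measure.fst, Measure.fst_prod, gaussianReal_map_const_mul]
      simp
    have h2 : ((gaussianReal 0 1).prod (gaussianReal 0 1)).map (fun p : ℝ × ℝ => s * p.2) =
        gaussianReal 0 (.mk (s ^ 2) (sq_nonneg _)) := by
      have := Measure.map_map (μ := (gaussianReal 0 1).prod (gaussianReal 0 1)) (f := Prod.snd)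
        (g := fun x : ℝ => s * x) (by fun_prop) (by fun_prop)
      simp only [Function.comp_def] at this
      rw [← this, ← Measure.snd, Measure.snd_prod, gaussianReal_map_const_mul]
      simp
    have := gaussianReal_add_gaussianReal_of_indepFun hind h1 h2
    rw [gaussianReal_map_const_mul]
    simp only [Pi.add_def] at this
    rw [this]
    congr 1
    · simp
    · ext
      simp [Real.sq_sqrt (add_nonneg (sq_nonneg c) (sq_nonneg s))]
  have h3 : ((gaussianReal 0 1).prod (gaussianReal 0 1)).real
      {p : ℝ × ℝ | T ≤ m + c * p.1 + s * p.2} = normalTail T m (Real.sqrt (c ^ 2 + s ^ 2)) := by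
    have e1 := congrArg (fun ρ : Measure ℝ => ρ.real {r : ℝ | T ≤ m + r}) hlaw
    rw [map_measureReal_apply (by fun_prop) hmeas, map_measureReal_apply (by fun_prop) hmeas] at e1
    simp only [Set.preimage_ofPred_eq, ← add_assoc] at e1
    exact e1
  rw [← h3, ← integral_indicator_one hA, integral_prod]
  · refine integral_congr_ae (Eventually.of_forall fun ζ => ?_)
    simp only [normalTail]
    rw [← integral_indicator_one (measurableSet_tailSet T _ s)]
    rfl
  · exact (integrable_const (1 : ℝ)).indicator hA

lemma integrable_normalTail_affine (T m c s : ℝ) :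
    Integrable (fun ζ => normalTail T (m + c * ζ) s) (gaussianReal 0 1) := by
  refine Integrable.of_bound ((measurable_normalTail T).comp
    (by fun_prop : Measurable fun ζ : ℝ => (m + c * ζ, s))).aestronglyMeasurable 1
    (Eventually.of_forall fun ζ => ?_)
  rw [Real.norm_of_nonneg (normalTail_nonneg _ _ _)]
  exact normalTail_le_one _ _ _

lemma integrable_sq_normalTail_sub (T m c s a : ℝ) :
    Integrable (fun ζ => (normalTail T (m + c * ζ) s - a) ^ 2) (gaussianReal 0 1) := by
  have hm : Measurable fun ζ => normalTail T (m + c * ζ) s := (measurable_normalTail T).comp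
    (by fun_prop : Measurable fun ζ : ℝ => (m + c * ζ, s))
  refine Integrable.of_bound ((hm.sub_const a).pow_const 2).aestronglyMeasurable ((1 + |a|) ^ 2)
    (Eventually.of_forall fun ζ => ?_)
  rw [norm_pow]
  gcongr
  refine (norm_sub_le _ _).trans ?_
  rw [Real.norm_of_nonneg (normalTail_nonneg _ _ _)]
  gcongr
  exacts [normalTail_le_one _ _ _, le_rfl]

/-- The expected decrease of the Bernoulli variance is the variance of the conditional
probability. -/
lemma var_sub_meanTailVar (T m c s : ℝ) :
    normalTail T m (Real.sqrt (c ^ 2 + s ^ 2)) * (1 - normalTail T m (Real.sqrt (c ^ 2 + s ^ 2))) -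
      meanTailVar T m c s =
    ∫ ζ, (normalTail T (m + c * ζ) s - normalTail T m (Real.sqrt (c ^ 2 + s ^ 2))) ^ 2
      ∂(gaussianReal 0 1) := by
  set q := normalTail T m (Real.sqrt (c ^ 2 + s ^ 2)) with hq
  have hi := integrable_normalTail_affine T m c s
  have h2 := integrable_sq_normalTail_sub T m c s q
  have e : ∀ ζ, normalTail T (m + c * ζ) s * (1 - normalTail T (m + c * ζ) s) =
      (1 - 2 * q) * normalTail T (m + c * ζ) s + q ^ 2 -
        (normalTail T (m + c * ζ) s - q) ^ 2 := fun ζ => by ring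
  have : meanTailVar T m c s = (1 - 2 * q) * q + q ^ 2 -
      ∫ ζ, (normalTail T (m + c * ζ) s - q) ^ 2 ∂(gaussianReal 0 1) := by
    rw [meanTailVar]
    simp_rw [e]
    have h3 : Integrable (fun ζ => (1 - 2 * q) * normalTail T (m + c * ζ) s + q ^ 2)
        (gaussianReal 0 1) := (hi.const_mul _).add (integrable_const _)
    rw [integral_sub h3 h2, integral_add (hi.const_mul _) (integrable_const _),
      integral_const_mul, integral_normalTail]
    simp [← hq]
  rw [this]
  ring

lemma meanTailVar_le (T m c s : ℝ) : meanTailVar T m c s ≤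
    normalTail T m (Real.sqrt (c ^ 2 + s ^ 2)) *
      (1 - normalTail T m (Real.sqrt (c ^ 2 + s ^ 2))) := by
  rw [← sub_nonneg, var_sub_meanTailVar]
  exact integral_nonneg fun _ => sq_nonneg _

lemma meanTailVar_nonneg (T m c s : ℝ) : 0 ≤ meanTailVar T m c s :=
  integral_nonneg fun _ => bernoulli_var_nonneg (normalTail_nonneg _ _ _) (normalTail_le_one _ _ _)

lemma tendsto_normalTail_atTop (T s : ℝ) : Tendsto (fun m => normalTail T m s) atTop (𝓝 1) := by
  simp_rw [normalTail_eq_integral]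
  suffices h : Tendsto (fun m => ∫ w, (Set.Ici T).indicator (fun _ => (1 : ℝ)) (m + s * w)
      ∂(gaussianReal 0 1)) atTop (𝓝 (∫ _w : ℝ, (1 : ℝ) ∂(gaussianReal 0 1))) by simpa using h
  refine tendsto_integral_filter_of_dominated_convergence (fun _ => 1) ?_ ?_
    (integrable_const _) ?_
  · refine Eventually.of_forall fun i => Measurable.aestronglyMeasurable ?_
    exact (measurable_const.indicator measurableSet_Ici).comp (by fun_prop)
  · refine Eventually.of_forall fun i => Eventually.of_forall fun w => ?_
    rw [Set.indicator_apply]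
    split_ifs <;> simp
  · refine Eventually.of_forall fun w => tendsto_const_nhds.congr' ?_
    filter_upwards [eventually_ge_atTop (T - s * w)] with m hm
    have : T ≤ m + s * w := by linarith
    simp [this]

lemma tendsto_normalTail_atBot (T s : ℝ) : Tendsto (fun m => normalTail T m s) atBot (𝓝 0) := by
  simp_rw [normalTail_eq_integral]
  suffices h : Tendsto (fun m => ∫ w, (Set.Ici T).indicator (fun _ => (1 : ℝ)) (m + s * w)
      ∂(gaussianReal 0 1)) atBot (𝓝 (∫ _w : ℝ, (0 : ℝ) ∂(gaussianReal 0 1))) by simpa using h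
  refine tendsto_integral_filter_of_dominated_convergence (fun _ => 1) ?_ ?_
    (integrable_const _) ?_
  · refine Eventually.of_forall fun i => Measurable.aestronglyMeasurable ?_
    exact (measurable_const.indicator measurableSet_Ici).comp (by fun_prop)
  · refine Eventually.of_forall fun i => Eventually.of_forall fun w => ?_
    rw [Set.indicator_apply]
    split_ifs <;> simp
  · refine Eventually.of_forall fun w => tendsto_const_nhds.congr' ?_
    filter_upwards [eventually_lt_atBot (T - s * w)] with m hm
    have : ¬ T ≤ m + s * w := by linarith
    simp [this]

/-- A set of full measure for the standard normal law is unbounded above and below. -/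
lemma frequently_of_ae_gaussianReal {p : ℝ → Prop} (h : ∀ᵐ ζ ∂(gaussianReal 0 1), p ζ) :
    (∃ᶠ ζ in atTop, p ζ) ∧ ∃ᶠ ζ in atBot, p ζ := by
  have hv : ∀ᵐ ζ, p ζ := (gaussianReal_absolutelyContinuous' 0 one_ne_zero).ae_le h
  have key : ∀ a b : ℝ, a < b → ∃ ζ ∈ Set.Ioo a b, p ζ := by
    intro a b hab
    by_contra! hcon
    have : volume (Set.Ioo a b) = 0 := measure_mono_null (fun ζ hζ => hcon ζ hζ) hv
    simp at this
    linarith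
  constructor
  · rw [frequently_atTop]
    intro a
    obtain ⟨ζ, hζ, h'⟩ := key a (a + 1) (by linarith)
    exact ⟨ζ, hζ.1.le, h'⟩
  · rw [frequently_atBot]
    intro a
    obtain ⟨ζ, hζ, h'⟩ := key (a - 1) a (by linarith)
    exact ⟨ζ, hζ.2.le, h'⟩

/-- A nonzero correlation makes the conditional probability non-constant: it tends to `0` and to
`1` at the two ends of the line, so its variance is positive. -/
lemma meanTailVar_lt {T m c s : ℝ} (hc : c ≠ 0) : meanTailVar T m c s <
    normalTail T m (Real.sqrt (c ^ 2 + s ^ 2)) *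
      (1 - normalTail T m (Real.sqrt (c ^ 2 + s ^ 2))) := by
  refine lt_of_le_of_ne (meanTailVar_le T m c s) fun heq => ?_
  have h0 := var_sub_meanTailVar T m c s
  rw [heq, sub_self, eq_comm, integral_eq_zero_iff_of_nonneg (fun _ => sq_nonneg _)
    (integrable_sq_normalTail_sub T m c s _)] at h0
  set q : ℝ := normalTail T m (Real.sqrt (c ^ 2 + s ^ 2))
  have h1 : ∀ᵐ ζ ∂(gaussianReal 0 1), normalTail T (m + c * ζ) s = q := by
    filter_upwards [h0] with ζ hζ
    simpa [sub_eq_zero] using hζ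
  obtain ⟨ht, hb⟩ := frequently_of_ae_gaussianReal h1
  have lim1 : ∀ (l : Filter ℝ) (a : ℝ), Tendsto (fun ζ => normalTail T (m + c * ζ) s) l (𝓝 a) →
      (∃ᶠ ζ in l, normalTail T (m + c * ζ) s = q) → q = a := by
    intro l a hl hf
    by_contra hne
    obtain ⟨ζ, h1, h2⟩ := (hf.and_eventually (hl.eventually_ne (Ne.symm hne))).exists
    exact h2 h1
  rcases lt_or_gt_of_ne hc with h | h
  · have a1 := lim1 atTop 0 ((tendsto_normalTail_atBot T s).comp
      (tendsto_atBot_add_const_left _ m (tendsto_id.const_mul_atTop_of_neg h))) ht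
    have a2 := lim1 atBot 1 ((tendsto_normalTail_atTop T s).comp
      (tendsto_atTop_add_const_left _ m (tendsto_id.const_mul_atBot_of_neg h))) hb
    linarith
  · have a1 := lim1 atTop 1 ((tendsto_normalTail_atTop T s).comp
      (tendsto_atTop_add_const_left _ m (tendsto_id.const_mul_atTop h))) ht
    have a2 := lim1 atBot 0 ((tendsto_normalTail_atBot T s).comp
      (tendsto_atBot_add_const_left _ m (tendsto_id.const_mul_atBot h))) hb
    linarith

end NormalTail

end SUR

/-! ### Marginals and the excursion loss -/

namespace SUR

section Marginals

variable {𝕏 : Type u} [MetricSpace 𝕏] [CompactSpace 𝕏]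

lemma covFun_self_nonneg (ν : GaussianMeasure 𝕏) (x : 𝕏) : 0 ≤ covFun ν x x := by
  rw [covFun, covariance_self (measurable_eval x).aemeasurable]
  exact variance_nonneg _ _

lemma gaussianReal_real_Ici (T m : ℝ) {v : ℝ} (hv : 0 ≤ v) :
    (gaussianReal m v.toNNReal).real (Set.Ici T) = normalTail T m (Real.sqrt v) := by
  have h : gaussianReal m v.toNNReal =
      (gaussianReal 0 1).map (fun w => m + Real.sqrt v * w) := by
    have h1 := gaussianReal_map_const_mul (μ := 0) (v := 1) (Real.sqrt v)
    have h2 := gaussianReal_map_const_add (μ := Real.sqrt v * 0)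
      (v := .mk ((Real.sqrt v) ^ 2) (sq_nonneg _) * 1) m
    rw [← h1, Measure.map_map (by fun_prop) (by fun_prop)] at h2
    simp only [Function.comp_def] at h2
    rw [h2]
    congr 1
    · simp
    · ext
      simp [Real.sq_sqrt hv, hv]
  rw [h, map_measureReal_apply (by fun_prop) measurableSet_Ici]
  rfl

lemma map_eval_eq_gaussianReal (ν : GaussianMeasure 𝕏) (x : 𝕏) :
    (ν : Measure C(𝕏, ℝ)).map (fun f => f x) =
      gaussianReal (meanFun ν x) (covFun ν x x).toNNReal := by
  have h := IsGaussian.map_eq_gaussianReal (μ := (ν : Measure C(𝕏, ℝ)))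
    (ContinuousMap.evalCLM ℝ x)
  rw [covFun, covariance_self (measurable_eval x).aemeasurable]
  exact h

lemma excursionProb_eq [MeasurableSpace 𝕏] [BorelSpace 𝕏] (T : ℝ) (ν : GaussianMeasure 𝕏)
    (x : 𝕏) :
    excursionProb T ν x = normalTail T (meanFun ν x) (Real.sqrt (covFun ν x x)) := by
  rw [← gaussianReal_real_Ici T _ (covFun_self_nonneg ν x), ← map_eval_eq_gaussianReal,
    map_measureReal_apply (measurable_eval x) measurableSet_Ici]
  rfl

variable (𝕏) in
/-- The tautological Markov kernel `ν ↦ ν`. -/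
noncomputable def gaussianKernel : Kernel (GaussianMeasure 𝕏) C(𝕏, ℝ) :=
  ⟨Subtype.val, measurable_subtype_coe⟩

lemma gaussianKernel_apply (ν : GaussianMeasure 𝕏) :
    gaussianKernel 𝕏 ν = (ν : Measure C(𝕏, ℝ)) := rfl

instance isMarkovKernel_gaussianKernel : IsMarkovKernel (gaussianKernel 𝕏) :=
  ⟨fun ν => by rw [gaussianKernel_apply]; infer_instance⟩

/-- Integrals against a Gaussian measure are measurable in the measure and in a parameter. -/
lemma stronglyMeasurable_integral_gaussian {α E : Type*} [MeasurableSpace α]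
    [NormedAddCommGroup E] [NormedSpace ℝ E] {g : α → GaussianMeasure 𝕏} (hg : Measurable g)
    {F : α → C(𝕏, ℝ) → E} (hF : StronglyMeasurable (Function.uncurry F)) :
    StronglyMeasurable (fun a => ∫ f, F a f ∂(g a : Measure C(𝕏, ℝ))) :=
  hF.integral_kernel_prod_right (κ := (gaussianKernel 𝕏).comap g hg)

lemma measurable_lintegral_gaussian {α : Type*} [MeasurableSpace α]
    {g : α → GaussianMeasure 𝕏} (hg : Measurable g)
    {F : α → C(𝕏, ℝ) → ℝ≥0∞} (hF : Measurable (Function.uncurry F)) :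
    Measurable (fun a => ∫⁻ f, F a f ∂(g a : Measure C(𝕏, ℝ))) :=
  hF.lintegral_kernel_prod_right (κ := (gaussianKernel 𝕏).comap g hg)

variable [MeasurableSpace 𝕏] [BorelSpace 𝕏]

lemma measurable_eval_prod : Measurable (fun p : C(𝕏, ℝ) × 𝕏 => p.1 p.2) :=
  (ContinuousEval.continuous_eval (F := C(𝕏, ℝ)) (X := 𝕏) (Y := ℝ)).measurable

/-- The indicator of the excursion event `f(x) ≥ T`. -/
noncomputable def excInd (T : ℝ) (f : C(𝕏, ℝ)) (x : 𝕏) : ℝ :=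
  (Set.Ici T).indicator (fun _ => (1 : ℝ)) (f x)

lemma measurable_excInd (T : ℝ) : Measurable (fun p : C(𝕏, ℝ) × 𝕏 => excInd T p.1 p.2) :=
  (measurable_const.indicator measurableSet_Ici).comp measurable_eval_prod

lemma excInd_sq (T : ℝ) (f : C(𝕏, ℝ)) (x : 𝕏) : excInd T f x ^ 2 = excInd T f x := by
  rw [excInd, Set.indicator_apply]
  split_ifs <;> simp

lemma excInd_mem (T : ℝ) (f : C(𝕏, ℝ)) (x : 𝕏) : excInd T f x ∈ Set.Icc (0 : ℝ) 1 := by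
  rw [excInd, Set.indicator_apply]
  split_ifs <;> simp

lemma integral_excInd (T : ℝ) (ν : GaussianMeasure 𝕏) (x : 𝕏) :
    ∫ f, excInd T f x ∂(ν : Measure C(𝕏, ℝ)) = excursionProb T ν x := by
  rw [excursionProb, ← integral_indicator_one
    (measurableSet_le measurable_const (measurable_eval x))]
  rfl

lemma integrable_excInd (T : ℝ) (ν : GaussianMeasure 𝕏) (x : 𝕏) :
    Integrable (fun f => excInd T f x) (ν : Measure C(𝕏, ℝ)) := by
  refine Integrable.of_bound ((measurable_excInd T).comp
    (measurable_id.prodMk measurable_const)).aestronglyMeasurable 1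
    (Eventually.of_forall fun f => ?_)
  have := excInd_mem T f x
  rw [Real.norm_of_nonneg this.1]
  exact this.2

lemma measurable_excursionProb (T : ℝ) :
    Measurable (fun p : GaussianMeasure 𝕏 × 𝕏 => excursionProb T p.1 p.2) := by
  simp_rw [← integral_excInd]
  refine (stronglyMeasurable_integral_gaussian measurable_fst ?_).measurable
  exact ((measurable_excInd T).comp
    (measurable_snd.prodMk (measurable_snd.comp measurable_fst))).stronglyMeasurable

lemma excursionProb_nonneg (T : ℝ) (ν : GaussianMeasure 𝕏) (x : 𝕏) : 0 ≤ excursionProb T ν x :=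
  measureReal_nonneg

lemma excursionProb_le_one (T : ℝ) (ν : GaussianMeasure 𝕏) (x : 𝕏) : excursionProb T ν x ≤ 1 :=
  measureReal_le_one

lemma measurable_excursionProb_right (T : ℝ) (ν : GaussianMeasure 𝕏) :
    Measurable (excursionProb T ν) :=
  (measurable_excursionProb T).comp (measurable_const.prodMk measurable_id)

/-- The Bernoulli variance `p_ν(x) (1 - p_ν(x))` of the excursion event at `x`. -/
noncomputable def excVar (T : ℝ) (ν : GaussianMeasure 𝕏) (x : 𝕏) : ℝ :=
  excursionProb T ν x * (1 - excursionProb T ν x)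

lemma excVar_nonneg (T : ℝ) (ν : GaussianMeasure 𝕏) (x : 𝕏) : 0 ≤ excVar T ν x :=
  bernoulli_var_nonneg (excursionProb_nonneg T ν x) (excursionProb_le_one T ν x)

lemma norm_excVar_le (T : ℝ) (ν : GaussianMeasure 𝕏) (x : 𝕏) : ‖excVar T ν x‖ ≤ 1 :=
  norm_bernoulli_var_le_one (excursionProb_nonneg T ν x) (excursionProb_le_one T ν x)

lemma measurable_excVar (T : ℝ) :
    Measurable (fun p : GaussianMeasure 𝕏 × 𝕏 => excVar T p.1 p.2) :=
  (measurable_excursionProb T).mul (measurable_const.sub (measurable_excursionProb T))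

lemma integrable_excVar (T : ℝ) (μ : Measure 𝕏) [IsFiniteMeasure μ] (ν : GaussianMeasure 𝕏) :
    Integrable (excVar T ν) μ :=
  Integrable.of_bound ((measurable_excVar T).comp
    (measurable_const.prodMk measurable_id)).aestronglyMeasurable 1
    (Eventually.of_forall fun x => norm_excVar_le T ν x)

end Marginals

section Loss

variable {𝕏 : Type u} [MetricSpace 𝕏] [CompactSpace 𝕏] [MeasurableSpace 𝕏] [BorelSpace 𝕏]
  (μ : Measure 𝕏) [IsFiniteMeasure μ] (T : ℝ)

lemma memLp_excursionProb (ν : GaussianMeasure 𝕏) : MemLp (excursionProb T ν) 2 μ :=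
  MemLp.of_bound (measurable_excursionProb_right T ν).aestronglyMeasurable 1
    (Eventually.of_forall fun x => by
      rw [Real.norm_of_nonneg (excursionProb_nonneg T ν x)]
      exact excursionProb_le_one T ν x)

/-- The decision `p_ν`, which is optimal for the excursion loss. -/
noncomputable def excursionClassifier (ν : GaussianMeasure 𝕏) : SoftClassifier μ :=
  ⟨(memLp_excursionProb μ T ν).toLp _, by
    filter_upwards [(memLp_excursionProb μ T ν).coeFn_toLp] with x hx
    rw [hx]
    exact ⟨excursionProb_nonneg T ν x, excursionProb_le_one T ν x⟩⟩

lemma coeFn_excursionClassifier (ν : GaussianMeasure 𝕏) :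
    (excursionClassifier μ T ν).1 =ᵐ[μ] excursionProb T ν :=
  (memLp_excursionProb μ T ν).coeFn_toLp

lemma norm_sq_Lp_eq_integral (g : Lp ℝ 2 μ) : ‖g‖ ^ 2 = ∫ x, g x ^ 2 ∂μ := by
  rw [← real_inner_self_eq_norm_sq, L2.inner_def]
  simp [pow_two]

lemma excursionLoss_eq (f : C(𝕏, ℝ)) (d : SoftClassifier μ) :
    (excursionLoss μ T f d : ℝ) = ∫ x, (excInd T f x - d.1 x) ^ 2 ∂μ := by
  rw [excursionLoss, NNReal.coe_pow, coe_nnnorm, norm_sq_Lp_eq_integral]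
  refine integral_congr_ae ?_
  filter_upwards [Lp.coeFn_sub (indicatorConstLp 2 (measurableSet_excursionSet T f)
    (measure_ne_top μ _) (1 : ℝ)) d.1, indicatorConstLp_coeFn (μ := μ) (p := 2)
    (hs := measurableSet_excursionSet T f) (hμs := measure_ne_top μ _) (c := (1 : ℝ))]
    with x h1 h2
  rw [h1, Pi.sub_apply, h2]
  rfl

lemma measurable_sq_excInd_sub (d : SoftClassifier μ) :
    Measurable (fun p : C(𝕏, ℝ) × 𝕏 => (excInd T p.1 p.2 - d.1 p.2) ^ 2) :=
  ((measurable_excInd T).sub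
    ((Lp.stronglyMeasurable d.1).measurable.comp measurable_snd)).pow_const 2

lemma measurable_excursionLoss (d : SoftClassifier μ) :
    Measurable (fun f => excursionLoss μ T f d) := by
  have h : Measurable (fun f => (excursionLoss μ T f d : ℝ)) := by
    simp_rw [excursionLoss_eq]
    exact ((measurable_sq_excInd_sub μ T d).stronglyMeasurable.integral_prod_right).measurable
  have := h.real_toNNReal
  simpa using this

/-- The bias-variance decomposition of the expected loss. -/
lemma expectedLoss_eq (ν : GaussianMeasure 𝕏) (d : SoftClassifier μ) :
    expectedLoss (excursionLoss μ T) ν d =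
      ENNReal.ofReal (‖(excursionClassifier μ T ν).1 - d.1‖ ^ 2 + ∫ x, excVar T ν x ∂μ) := by
  have hint : Integrable (Function.uncurry fun (f : C(𝕏, ℝ)) x => (excInd T f x - d.1 x) ^ 2)
      ((ν : Measure C(𝕏, ℝ)).prod μ) := by
    refine Integrable.of_bound (measurable_sq_excInd_sub μ T d).aestronglyMeasurable 1 ?_
    have h := Measure.quasiMeasurePreserving_snd (μ := (ν : Measure C(𝕏, ℝ))) (ν := μ) |>.ae d.2
    filter_upwards [h] with p hp
    have h1 := excInd_mem T p.1 p.2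
    rw [Function.uncurry, norm_pow, Real.norm_eq_abs]
    refine pow_le_one₀ (abs_nonneg _) (abs_le.2 ⟨?_, ?_⟩)
    · linarith [h1.1, hp.2]
    · linarith [h1.2, hp.1]
  have e1 : ∀ f, (excursionLoss μ T f d : ℝ≥0∞) =
      ENNReal.ofReal (∫ x, (excInd T f x - d.1 x) ^ 2 ∂μ) := fun f => by
    rw [← excursionLoss_eq, ENNReal.ofReal_coe_nnreal]
  rw [expectedLoss]
  simp_rw [e1]
  have hl := hint.integral_prod_left
  simp only [Function.uncurry] at hl
  rw [← ofReal_integral_eq_lintegral_ofReal hl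
    (Eventually.of_forall fun f => integral_nonneg fun x => sq_nonneg _),
    integral_integral_swap hint, norm_sq_Lp_eq_integral, ← integral_add]
  · congr 1
    refine integral_congr_ae ?_
    filter_upwards [Lp.coeFn_sub (excursionClassifier μ T ν).1 d.1,
      coeFn_excursionClassifier μ T ν] with x h1 h2
    rw [h1, Pi.sub_apply, h2]
    have e2 : ∀ f, (excInd T f x - d.1 x) ^ 2 =
        (1 - 2 * d.1 x) * excInd T f x + d.1 x ^ 2 := fun f => by
      linear_combination excInd_sq T f x
    simp_rw [e2]
    rw [integral_add ((integrable_excInd T ν x).const_mul _) (integrable_const _),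
      integral_const_mul, integral_excInd]
    simp [excVar]
    ring
  · have := L2.integrable_inner (𝕜 := ℝ) ((excursionClassifier μ T ν).1 - d.1)
      ((excursionClassifier μ T ν).1 - d.1)
    simpa [pow_two] using this
  · exact integrable_excVar T μ ν

lemma iInf_expectedLoss (ν : GaussianMeasure 𝕏) :
    ⨅ d, expectedLoss (excursionLoss μ T) ν d = ENNReal.ofReal (∫ x, excVar T ν x ∂μ) := by
  refine le_antisymm (iInf_le_of_le (excursionClassifier μ T ν) ?_) (le_iInf fun d => ?_)
  · simp [expectedLoss_eq]
  · rw [expectedLoss_eq]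
    exact ENNReal.ofReal_le_ofReal (le_add_of_nonneg_left (sq_nonneg _))

/-- The functional induced by the excursion loss: the integrated Bernoulli variance. -/
lemma lossFunctional_eq (ν : GaussianMeasure 𝕏) :
    (lossFunctional (excursionLoss μ T) ν : ℝ) = ∫ x, excVar T ν x ∂μ := by
  rw [lossFunctional, iInf_expectedLoss, ENNReal.coe_toNNReal_eq_toReal,
    ENNReal.toReal_ofReal (integral_nonneg fun x => excVar_nonneg T ν x)]

lemma continuous_expectedLoss (ν : GaussianMeasure 𝕏) :
    Continuous (expectedLoss (excursionLoss μ T) ν) := by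
  simp_rw [funext (expectedLoss_eq μ T ν)]
  exact ENNReal.continuous_ofReal.comp (by fun_prop)

lemma measurable_lossFunctional : Measurable (lossFunctional (excursionLoss μ T)) := by
  have h : Measurable (fun ν => (lossFunctional (excursionLoss μ T) ν : ℝ)) := by
    simp_rw [lossFunctional_eq]
    exact ((measurable_excVar T).stronglyMeasurable.integral_prod_right).measurable
  simpa using h.real_toNNReal

lemma lossFunctional_le (ν : GaussianMeasure 𝕏) :
    (lossFunctional (excursionLoss μ T) ν : ℝ) ≤ μ.real Set.univ := by
  rw [lossFunctional_eq]
  refine (integral_mono (integrable_excVar T μ ν) (integrable_const 1) fun x =>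
    (Real.le_norm_self _).trans (norm_excVar_le T ν x)).trans ?_
  simp

lemma separableSpace_softClassifier : TopologicalSpace.SeparableSpace (SoftClassifier μ) := by
  have : Fact ((2 : ℝ≥0∞) ≠ ∞) := ⟨by simp⟩
  have : SecondCountableTopology (Lp ℝ 2 μ) := inferInstance
  infer_instance

end Loss

end SUR

/-! ### Measurability of the conditioning operator -/

namespace SUR

section ConditioningMeasurability

variable {𝕏 : Type u} [MetricSpace 𝕏] [CompactSpace 𝕏]

lemma integrable_id_gaussian (ν : GaussianMeasure 𝕏) :
    Integrable (fun f : C(𝕏, ℝ) => f) (ν : Measure C(𝕏, ℝ)) :=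
  IsGaussian.integrable_id

lemma integrable_eval_smul (ν : GaussianMeasure 𝕏) (x : 𝕏) :
    Integrable (fun f : C(𝕏, ℝ) => f x • f) (ν : Measure C(𝕏, ℝ)) := by
  have hid : MemLp (fun f : C(𝕏, ℝ) => f) 2 (ν : Measure C(𝕏, ℝ)) := IsGaussian.memLp_two_id
  have h2 : Integrable (fun f : C(𝕏, ℝ) => ‖f‖ * ‖f‖) (ν : Measure C(𝕏, ℝ)) :=
    hid.norm.integrable_mul hid.norm
  refine h2.mono ((measurable_eval x).smul measurable_id).aestronglyMeasurable
    (Eventually.of_forall fun f => ?_)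
  rw [norm_smul, norm_mul, norm_norm]
  gcongr
  exact f.norm_coe_le_norm x

lemma covFun_eq (ν : GaussianMeasure 𝕏) (y x : 𝕏) :
    covFun ν y x = ∫ f : C(𝕏, ℝ), f y * f x ∂(ν : Measure C(𝕏, ℝ)) -
      meanFun ν y * meanFun ν x :=
  covariance_eq_sub (memLp_eval ν y) (memLp_eval ν x)

/-- Functionals applied to the Bochner integral that represents `k_ν(·, x)` are covariances. -/
lemma dual_covSection (ν : GaussianMeasure 𝕏) (x : 𝕏) (L : StrongDual ℝ C(𝕏, ℝ)) :
    L (∫ f : C(𝕏, ℝ), f x • f ∂(ν : Measure C(𝕏, ℝ)) -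
        meanFun ν x • ∫ f : C(𝕏, ℝ), f ∂(ν : Measure C(𝕏, ℝ))) =
      cov[fun f => L f, fun f => f x; (ν : Measure C(𝕏, ℝ))] := by
  rw [map_sub, map_smul, ← L.integral_comp_comm (integrable_eval_smul ν x),
    ← L.integral_comp_comm (integrable_id_gaussian ν),
    covariance_eq_sub (IsGaussian.memLp_dual _ L 2 (by simp)) (memLp_eval ν x)]
  simp only [map_smul, smul_eq_mul, meanFun, Pi.mul_apply]
  rw [mul_comm (∫ f : C(𝕏, ℝ), f x ∂_)]
  simp_rw [mul_comm]

/-- `k_ν(·, x)` as a Bochner integral in `C(𝕏)`, a form in which its dependence on `ν` and `x` is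
visibly measurable. -/
lemma covSection_eq (ν : GaussianMeasure 𝕏) (x : 𝕏) :
    covSection ν x = ∫ f : C(𝕏, ℝ), f x • f ∂(ν : Measure C(𝕏, ℝ)) -
        meanFun ν x • ∫ f : C(𝕏, ℝ), f ∂(ν : Measure C(𝕏, ℝ)) := by
  ext y
  exact (dual_covSection ν x (ContinuousMap.evalCLM ℝ y)).symm

lemma measurable_prod_lintegral_gaussian {α : Type*} [MeasurableSpace α]
    {g : α → GaussianMeasure 𝕏} (hg : Measurable g)
    {F : α → C(𝕏, ℝ) × ℝ → ℝ≥0∞} (hF : Measurable (Function.uncurry F)) :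
    Measurable (fun a => ∫⁻ p, F a p ∂((g a : Measure C(𝕏, ℝ)).prod (gaussianReal 0 1))) := by
  have h := hF.lintegral_kernel_prod_right
    (κ := ((gaussianKernel 𝕏).comap g hg) ×ₖ (Kernel.const α (gaussianReal 0 1)))
  simpa [Kernel.prod_apply, Kernel.comap_apply, gaussianKernel_apply] using h

/-- The Cauchy-Schwarz inequality, by the discriminant of `t ↦ Var (f y + t f x)`. -/
lemma covFun_sq_le (ν : GaussianMeasure 𝕏) (y x : 𝕏) :
    covFun ν y x ^ 2 ≤ covFun ν y y * covFun ν x x := by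
  have h : ∀ t : ℝ, 0 ≤ covFun ν x x * (t * t) + 2 * covFun ν y x * t + covFun ν y y := by
    intro t
    have h1 := variance_nonneg (fun f : C(𝕏, ℝ) => f y + t * f x) (ν : Measure C(𝕏, ℝ))
    have h2 := variance_add (memLp_eval ν y) ((memLp_eval ν x).const_mul t)
    simp only [Pi.add_def] at h2
    rw [h2, variance_const_mul, covariance_const_mul_right,
      ← covariance_self (measurable_eval y).aemeasurable,
      ← covariance_self (measurable_eval x).aemeasurable] at h1
    change 0 ≤ covFun ν y y + 2 * (t * covFun ν y x) + t ^ 2 * covFun ν x x at h1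
    linarith
  have := discrim_le_zero h
  rw [discrim] at this
  linarith

lemma obsVar_nonneg (τ : C(𝕏, ℝ≥0)) (ν : GaussianMeasure 𝕏) (x : 𝕏) : 0 ≤ obsVar τ ν x :=
  add_nonneg (covFun_self_nonneg ν x) (sq_nonneg _)

lemma covFun_self_eq_zero_of_obsVar {τ : C(𝕏, ℝ≥0)} {ν : GaussianMeasure 𝕏} {x : 𝕏}
    (h : obsVar τ ν x = 0) : covFun ν x x = 0 := by
  have h1 := covFun_self_nonneg ν x
  have h2 := sq_nonneg (τ x : ℝ)
  rw [obsVar] at h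
  linarith

lemma covFun_eq_zero_of_right {ν : GaussianMeasure 𝕏} {x : 𝕏} (h : covFun ν x x = 0) (y : 𝕏) :
    covFun ν y x = 0 := by
  have := covFun_sq_le ν y x
  rw [h, mul_zero] at this
  exact pow_eq_zero_iff (two_ne_zero) |>.1 (le_antisymm this (sq_nonneg _))

variable [MeasurableSpace 𝕏] [BorelSpace 𝕏]

lemma measurable_meanFun :
    Measurable (fun p : GaussianMeasure 𝕏 × 𝕏 => meanFun p.1 p.2) := by
  refine (stronglyMeasurable_integral_gaussian measurable_fst ?_).measurable
  exact (measurable_eval_prod.comp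
    (measurable_snd.prodMk (measurable_snd.comp measurable_fst))).stronglyMeasurable

lemma measurable_covFun :
    Measurable (fun p : GaussianMeasure 𝕏 × 𝕏 × 𝕏 => covFun p.1 p.2.1 p.2.2) := by
  simp_rw [covFun_eq]
  refine Measurable.sub ?_ (Measurable.mul (measurable_meanFun.comp (by fun_prop :
      Measurable fun p : GaussianMeasure 𝕏 × 𝕏 × 𝕏 => (p.1, p.2.1)))
    (measurable_meanFun.comp (by fun_prop :
      Measurable fun p : GaussianMeasure 𝕏 × 𝕏 × 𝕏 => (p.1, p.2.2))))
  refine (stronglyMeasurable_integral_gaussian measurable_fst ?_).measurable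
  exact ((measurable_eval_prod.comp (by fun_prop :
      Measurable fun q : (GaussianMeasure 𝕏 × 𝕏 × 𝕏) × C(𝕏, ℝ) => (q.2, q.1.2.1))).mul
    (measurable_eval_prod.comp (by fun_prop :
      Measurable fun q : (GaussianMeasure 𝕏 × 𝕏 × 𝕏) × C(𝕏, ℝ) =>
        (q.2, q.1.2.2)))).stronglyMeasurable

lemma measurable_covSection :
    Measurable (fun p : GaussianMeasure 𝕏 × 𝕏 => covSection p.1 p.2) := by
  simp_rw [covSection_eq]
  refine Measurable.sub ?_ (Measurable.smul measurable_meanFun ?_)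
  · refine (stronglyMeasurable_integral_gaussian measurable_fst ?_).measurable
    exact ((measurable_eval_prod.comp (by fun_prop :
      Measurable fun q : (GaussianMeasure 𝕏 × 𝕏) × C(𝕏, ℝ) => (q.2, q.1.2))).smul
        measurable_snd).stronglyMeasurable
  · exact (stronglyMeasurable_integral_gaussian measurable_fst
      measurable_snd.stronglyMeasurable).measurable

lemma measurable_obsVar (τ : C(𝕏, ℝ≥0)) :
    Measurable (fun p : GaussianMeasure 𝕏 × 𝕏 => obsVar τ p.1 p.2) :=
  (measurable_covFun.comp (by fun_prop :
      Measurable fun p : GaussianMeasure 𝕏 × 𝕏 => (p.1, p.2, p.2))).add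
    (((τ.continuous.measurable.comp measurable_snd).coe_nnreal_real).pow_const 2)

lemma measurable_condMap_uncurry (τ : C(𝕏, ℝ≥0)) :
    Measurable (fun q : (GaussianMeasure 𝕏 × 𝕏 × ℝ) × (C(𝕏, ℝ) × ℝ) =>
      condMap τ q.1.2.1 q.1.2.2 q.1.1 q.2) := by
  have hp : Measurable fun q : (GaussianMeasure 𝕏 × 𝕏 × ℝ) × (C(𝕏, ℝ) × ℝ) =>
    (q.1.1, q.1.2.1) := by fun_prop
  have he := measurable_eval_prod.comp (by fun_prop :
      Measurable fun q : (GaussianMeasure 𝕏 × 𝕏 × ℝ) × (C(𝕏, ℝ) × ℝ) => (q.2.1, q.1.2.1))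
  have ht : Measurable fun q : (GaussianMeasure 𝕏 × 𝕏 × ℝ) × (C(𝕏, ℝ) × ℝ) =>
      (τ q.1.2.1 : ℝ) :=
    (τ.continuous.measurable.comp (by fun_prop : Measurable
      fun q : (GaussianMeasure 𝕏 × 𝕏 × ℝ) × (C(𝕏, ℝ) × ℝ) => q.1.2.1)).coe_nnreal_real
  unfold condMap
  exact (by fun_prop : Measurable fun q : (GaussianMeasure 𝕏 × 𝕏 × ℝ) × (C(𝕏, ℝ) × ℝ) =>
    q.2.1).sub ((((he.add (ht.mul (by fun_prop))).sub (by fun_prop)).div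
      ((measurable_obsVar τ).comp hp)).smul (measurable_covSection.comp hp))

/-- The map `(ν, x, z) ↦ Cond_{x,z}(ν)` is measurable. -/
lemma measurable_condLaw (τ : C(𝕏, ℝ≥0)) :
    Measurable (fun p : GaussianMeasure 𝕏 × 𝕏 × ℝ => condLaw τ p.2.1 p.2.2 p.1) := by
  refine Measurable.subtype_mk (Measure.measurable_of_measurable_coe _ fun A hA => ?_)
  have h := measurable_prod_lintegral_gaussian (𝕏 := 𝕏)
    (g := fun p : GaussianMeasure 𝕏 × 𝕏 × ℝ => p.1) measurable_fst
    (F := fun p q => A.indicator 1 (condMap τ p.2.1 p.2.2 p.1 q))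
    ((measurable_const.indicator hA).comp (measurable_condMap_uncurry τ))
  convert h using 2 with p
  rw [Measure.map_apply (measurable_condMap _ _ _ _) hA, ← lintegral_indicator_one
    (measurable_condMap τ p.2.1 p.2.2 p.1 hA)]
  rfl

end ConditioningMeasurability

/-! ### Conditioning disintegrates the law of the observation and the process -/

section Disintegration

variable {𝕏 : Type u} [MetricSpace 𝕏] [CompactSpace 𝕏]

/-- The noisy observation `(f, u) ↦ f(x) + τ(x) u` as a continuous linear map. -/
noncomputable def obsLin (τ : C(𝕏, ℝ≥0)) (x : 𝕏) : C(𝕏, ℝ) × ℝ →L[ℝ] ℝ :=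
  (ContinuousMap.evalCLM ℝ x).comp (ContinuousLinearMap.fst ℝ C(𝕏, ℝ) ℝ) +
    (τ x : ℝ) • ContinuousLinearMap.snd ℝ C(𝕏, ℝ) ℝ

lemma obsLin_apply (τ : C(𝕏, ℝ≥0)) (x : 𝕏) (p : C(𝕏, ℝ) × ℝ) :
    obsLin τ x p = p.1 x + τ x * p.2 := by
  simp [obsLin]

lemma condLin_apply (τ : C(𝕏, ℝ≥0)) (x : 𝕏) (ν : GaussianMeasure 𝕏) (p : C(𝕏, ℝ) × ℝ) :
    condLin τ x ν p = p.1 - (obsLin τ x p / obsVar τ ν x) • covSection ν x := by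
  simp [condLin, obsLin, smul_smul, div_eq_mul_inv]

lemma memLp_obsLin (τ : C(𝕏, ℝ≥0)) (x : 𝕏) (ν : GaussianMeasure 𝕏) :
    MemLp (fun p => obsLin τ x p) 2 ((ν : Measure C(𝕏, ℝ)).prod (gaussianReal 0 1)) :=
  IsGaussian.memLp_dual _ (obsLin τ x) 2 (by simp)

lemma covariance_dual_obsLin (τ : C(𝕏, ℝ≥0)) (x : 𝕏) (ν : GaussianMeasure 𝕏)
    (L : StrongDual ℝ C(𝕏, ℝ)) :
    cov[fun p : C(𝕏, ℝ) × ℝ => L p.1, fun p => obsLin τ x p;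
      (ν : Measure C(𝕏, ℝ)).prod (gaussianReal 0 1)] = L (covSection ν x) := by
  have hL : MemLp (fun f => L f) 2 (ν : Measure C(𝕏, ℝ)) := IsGaussian.memLp_dual _ L 2 (by simp)
  have hLp : MemLp (fun p : C(𝕏, ℝ) × ℝ => L p.1) 2
    ((ν : Measure C(𝕏, ℝ)).prod (gaussianReal 0 1)) := hL.comp_fst _
  have h1 := covariance_map_fun (μ := (ν : Measure C(𝕏, ℝ)).prod (gaussianReal 0 1))
      (X := fun f : C(𝕏, ℝ) => L f) (Y := fun f : C(𝕏, ℝ) => f x) (Z := Prod.fst)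
      L.measurable.aestronglyMeasurable (measurable_eval x).aestronglyMeasurable
      measurable_fst.aemeasurable
  rw [← Measure.fst, Measure.fst_prod] at h1
  have h2 : cov[fun p : C(𝕏, ℝ) × ℝ => L p.1, fun p => p.2;
      (ν : Measure C(𝕏, ℝ)).prod (gaussianReal 0 1)] = 0 :=
    covariance_fst_snd_prod hL (memLp_id_gaussianReal' 2 (by simp))
  have h3 := covariance_add_right hLp (memLp_fst ν x) ((memLp_snd ν).const_mul (τ x : ℝ))
  simp only [Pi.add_def] at h3
  simp_rw [obsLin_apply]
  rw [h3, covariance_const_mul_right, h2, ← h1, covSection_eq, dual_covSection]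
  simp

lemma covariance_obsLin_self (τ : C(𝕏, ℝ≥0)) (x : 𝕏) (ν : GaussianMeasure 𝕏) :
    cov[fun p => obsLin τ x p, fun p => obsLin τ x p;
      (ν : Measure C(𝕏, ℝ)).prod (gaussianReal 0 1)] = obsVar τ ν x := by
  have hAO : cov[fun p : C(𝕏, ℝ) × ℝ => p.1 x, fun p => obsLin τ x p;
      (ν : Measure C(𝕏, ℝ)).prod (gaussianReal 0 1)] = covFun ν x x :=
    covariance_dual_obsLin τ x ν (ContinuousMap.evalCLM ℝ x)
  have hBA : cov[fun p : C(𝕏, ℝ) × ℝ => p.2, fun p => p.1 x;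
      (ν : Measure C(𝕏, ℝ)).prod (gaussianReal 0 1)] = 0 := by
    rw [covariance_comm]
    exact covariance_fst_snd_prod (memLp_eval ν x) (memLp_id_gaussianReal' 2 (by simp))
  have hBB : cov[fun p : C(𝕏, ℝ) × ℝ => p.2, fun p => p.2;
      (ν : Measure C(𝕏, ℝ)).prod (gaussianReal 0 1)] = 1 := by
    have h := covariance_map_fun (μ := (ν : Measure C(𝕏, ℝ)).prod (gaussianReal 0 1))
      (X := fun u : ℝ => u) (Y := fun u : ℝ => u) (Z := Prod.snd)
      measurable_id.aestronglyMeasurable measurable_id.aestronglyMeasurable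
      measurable_snd.aemeasurable
    rw [← h, ← Measure.snd, Measure.snd_prod, covariance_self (by fun_prop)]
    simp
  have hB := (memLp_snd ν).const_mul (τ x : ℝ)
  have h2 := covariance_add_left (memLp_fst ν x) hB (memLp_obsLin τ x ν)
  have h3 := covariance_add_right (memLp_snd ν) (memLp_fst ν x) hB
  simp only [Pi.add_def, ← obsLin_apply] at h2 h3
  rw [h2, hAO, covariance_const_mul_left, h3, hBA, covariance_const_mul_right, hBB, obsVar]
  ring

/-- The residual `f - k_ν(·, x) Z / s_ν²(x)` is independent of the observation `Z`: they are
jointly Gaussian and uncorrelated. -/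
lemma indepFun_condLin_obsLin (τ : C(𝕏, ℝ≥0)) (x : 𝕏) (ν : GaussianMeasure 𝕏) :
    IndepFun (condLin τ x ν) (obsLin τ x) ((ν : Measure C(𝕏, ℝ)).prod (gaussianReal 0 1)) := by
  have hG : HasGaussianLaw (fun p => (condLin τ x ν p, obsLin τ x p))
      ((ν : Measure C(𝕏, ℝ)).prod (gaussianReal 0 1)) :=
    (IsGaussian.hasGaussianLaw_id
      (μ := (ν : Measure C(𝕏, ℝ)).prod (gaussianReal 0 1))).map
      ((condLin τ x ν).prod (obsLin τ x))
  refine hG.indepFun_of_covariance_strongDual fun L₁ L₂ => ?_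
  have hL : MemLp (fun p : C(𝕏, ℝ) × ℝ => L₁ p.1) 2
      ((ν : Measure C(𝕏, ℝ)).prod (gaussianReal 0 1)) :=
    (IsGaussian.memLp_dual (ν : Measure C(𝕏, ℝ)) L₁ 2 (by simp)).comp_fst _
  have e1 : L₁ ∘ condLin τ x ν = fun p => L₁ p.1 -
      (L₁ (covSection ν x) / obsVar τ ν x) * obsLin τ x p := by
    funext p
    simp only [Function.comp_apply, condLin_apply, map_sub, map_smul, smul_eq_mul]
    ring
  have e2 : L₂ ∘ obsLin τ x = fun p => L₂ 1 * obsLin τ x p := by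
    funext p
    have := L₂.map_smul (obsLin τ x p) 1
    simp only [smul_eq_mul, mul_one] at this
    rw [Function.comp_apply, this, mul_comm]
  rw [e1, e2, covariance_const_mul_right,
    covariance_fun_sub_left hL ((memLp_obsLin τ x ν).const_mul _) (memLp_obsLin τ x ν),
    covariance_const_mul_left, covariance_dual_obsLin, covariance_obsLin_self]
  by_cases h : obsVar τ ν x = 0
  · have : covSection ν x = 0 := by
      ext y
      exact covFun_eq_zero_of_right (covFun_self_eq_zero_of_obsVar h) y
    simp [this]
  · field_simp
    ring

/-- The family `z ↦ Cond_{x,z}(ν)` disintegrates the joint law of `(Z, f)`. -/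
lemma lintegral_condLaw (τ : C(𝕏, ℝ≥0)) (x : 𝕏) (ν : GaussianMeasure 𝕏)
    {F : ℝ × C(𝕏, ℝ) → ℝ≥0∞} (hF : Measurable F) :
    ∫⁻ p, F (obsLin τ x p, p.1) ∂((ν : Measure C(𝕏, ℝ)).prod (gaussianReal 0 1)) =
      ∫⁻ p, ∫⁻ f, F (obsLin τ x p, f) ∂(condLaw τ x (obsLin τ x p) ν : Measure C(𝕏, ℝ))
        ∂((ν : Measure C(𝕏, ℝ)).prod (gaussianReal 0 1)) := by
  set Q := (ν : Measure C(𝕏, ℝ)).prod (gaussianReal 0 1) with hQ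
  have hind := indepFun_condLin_obsLin τ x ν
  rw [indepFun_iff_map_prod_eq_prod_map_map (by fun_prop) (by fun_prop), ← hQ] at hind
  set s := obsVar τ ν x
  set k := covSection ν x
  have hG : Measurable fun q : C(𝕏, ℝ) × ℝ => F (q.2, q.1 + (q.2 / s) • k) :=
    hF.comp (by fun_prop)
  have e1 : ∀ p, F (obsLin τ x p, p.1) =
      (fun q : C(𝕏, ℝ) × ℝ => F (q.2, q.1 + (q.2 / s) • k)) (condLin τ x ν p, obsLin τ x p) :=
    fun p => by simp [condLin_apply, s, k]
  have e2 : ∀ z, ∫⁻ f, F (z, f) ∂(condLaw τ x z ν : Measure C(𝕏, ℝ)) =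
      ∫⁻ r, F (z, r + (z / s) • k) ∂(Q.map (condLin τ x ν)) := fun z => by
    have hFz : Measurable fun f => F (z, f) := hF.comp (by fun_prop)
    have hFz' : Measurable fun r => F (z, r + (z / s) • k) := hF.comp (by fun_prop)
    rw [condLaw, lintegral_map hFz (measurable_condMap _ _ _ _),
      lintegral_map hFz' (by fun_prop), condMap_eq]
    rfl
  have hP : IsProbabilityMeasure (Q.map (condLin τ x ν)) :=
    Measure.isProbabilityMeasure_map (by fun_prop)
  have hP' : IsProbabilityMeasure (Q.map (obsLin τ x)) :=
    Measure.isProbabilityMeasure_map (by fun_prop)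
  simp_rw [e2]
  simp_rw [e1]
  rw [← lintegral_map (μ := Q) hG (g := fun p => (condLin τ x ν p, obsLin τ x p)) (by fun_prop),
    hind, lintegral_prod_symm' _ hG,
    lintegral_map hG.lintegral_prod_left' (by fun_prop)]

-- Unfolding `obsLin` makes unification with compositions expensive.
attribute [irreducible] obsLin

end Disintegration

end SUR

/-! ### The sampling criterion -/

namespace SUR

section Criterion

variable {𝕏 : Type u} [MetricSpace 𝕏] [CompactSpace 𝕏]

/-- Regression coefficient of `f(y)` on the standardised observation at `x`. If
`s_ν²(x) = 0`, the observation is constant and the quotient is `0`, as it should be. -/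
noncomputable def condSlope (τ : C(𝕏, ℝ≥0)) (ν : GaussianMeasure 𝕏) (x y : 𝕏) : ℝ :=
  covFun ν y x / Real.sqrt (obsVar τ ν x)

/-- Standard deviation of `f(y)` given the observation at `x`, again with the correct value
if `s_ν²(x) = 0`. -/
noncomputable def condSd (τ : C(𝕏, ℝ≥0)) (ν : GaussianMeasure 𝕏) (x y : 𝕏) : ℝ :=
  Real.sqrt (covFun ν y y - covFun ν y x ^ 2 / obsVar τ ν x)

lemma condSlope_sq (τ : C(𝕏, ℝ≥0)) (ν : GaussianMeasure 𝕏) (x y : 𝕏) :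
    condSlope τ ν x y ^ 2 = covFun ν y x ^ 2 / obsVar τ ν x := by
  rw [condSlope, div_pow, Real.sq_sqrt (obsVar_nonneg τ ν x)]

lemma condSlope_sq_add_condSd_sq (τ : C(𝕏, ℝ≥0)) (ν : GaussianMeasure 𝕏) (x y : 𝕏) :
    condSlope τ ν x y ^ 2 + condSd τ ν x y ^ 2 = covFun ν y y := by
  have h : covFun ν y x ^ 2 / obsVar τ ν x ≤ covFun ν y y := by
    refine div_le_of_le_mul₀ (obsVar_nonneg τ ν x) (covFun_self_nonneg ν y) ?_
    refine (covFun_sq_le ν y x).trans (mul_le_mul_of_nonneg_left ?_ (covFun_self_nonneg ν y))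
    exact le_add_of_nonneg_right (sq_nonneg _)
  rw [condSlope_sq, condSd, Real.sq_sqrt (by linarith)]
  ring

lemma condSlope_ne_zero {τ : C(𝕏, ℝ≥0)} {ν : GaussianMeasure 𝕏} {x y : 𝕏}
    (h : covFun ν y x ≠ 0) : condSlope τ ν x y ≠ 0 := by
  refine div_ne_zero h fun h0 => h ?_
  have h1 := (Real.sqrt_eq_zero (obsVar_nonneg τ ν x)).1 h0
  exact covFun_eq_zero_of_right (covFun_self_eq_zero_of_obsVar h1) y

lemma map_obsLin (τ : C(𝕏, ℝ≥0)) (ν : GaussianMeasure 𝕏) (x : 𝕏) :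
    ((ν : Measure C(𝕏, ℝ)).prod (gaussianReal 0 1)).map (obsLin τ x) =
      (gaussianReal 0 1).map (fun ζ => meanFun ν x + Real.sqrt (obsVar τ ν x) * ζ) := by
  have h := IsGaussian.map_eq_gaussianReal
    (μ := (ν : Measure C(𝕏, ℝ)).prod (gaussianReal 0 1)) (obsLin τ x)
  have hm : ∫ p, obsLin τ x p ∂((ν : Measure C(𝕏, ℝ)).prod (gaussianReal 0 1)) =
      meanFun ν x := by
    simp_rw [obsLin_apply]
    rw [integral_add ((memLp_fst ν x).integrable (by norm_num))
      (((memLp_snd ν).integrable (by norm_num)).const_mul _), integral_const_mul,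
      integral_fun_fst (fun f : C(𝕏, ℝ) => f x), integral_fun_snd (fun u : ℝ => u)]
    simp [meanFun]
  rw [hm, ← covariance_self (by fun_prop), covariance_obsLin_self] at h
  have h1 := gaussianReal_map_const_mul (μ := 0) (v := 1) (Real.sqrt (obsVar τ ν x))
  have h2 := gaussianReal_map_const_add (μ := Real.sqrt (obsVar τ ν x) * 0)
    (v := .mk ((Real.sqrt (obsVar τ ν x)) ^ 2) (sq_nonneg _) * 1) (meanFun ν x)
  rw [← h1, Measure.map_map (by fun_prop) (by fun_prop)] at h2
  simp only [Function.comp_def] at h2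
  rw [h2, h]
  congr 1
  · simp
  · ext
    simp [Real.sq_sqrt (obsVar_nonneg τ ν x), obsVar_nonneg τ ν x]

variable [MeasurableSpace 𝕏] [BorelSpace 𝕏]

lemma excVar_eq (T : ℝ) (ν : GaussianMeasure 𝕏) (y : 𝕏) : excVar T ν y =
    normalTail T (meanFun ν y) (Real.sqrt (covFun ν y y)) *
      (1 - normalTail T (meanFun ν y) (Real.sqrt (covFun ν y y))) := by
  rw [excVar, excursionProb_eq]

lemma excVar_eq_zero {T : ℝ} {ν : GaussianMeasure 𝕏} {y : 𝕏} (h : covFun ν y y = 0) :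
    excVar T ν y = 0 := by
  rw [excVar_eq, h, Real.sqrt_zero, normalTail_zero_sd]

/-- Expected Bernoulli variance of the excursion event at `y` after an observation at `x`. -/
noncomputable def condExcVar (τ : C(𝕏, ℝ≥0)) (T : ℝ) (ν : GaussianMeasure 𝕏) (x y : 𝕏) : ℝ :=
  meanTailVar T (meanFun ν y) (condSlope τ ν x y) (condSd τ ν x y)

lemma condExcVar_le (τ : C(𝕏, ℝ≥0)) (T : ℝ) (ν : GaussianMeasure 𝕏) (x y : 𝕏) :
    condExcVar τ T ν x y ≤ excVar T ν y := by
  rw [excVar_eq, ← condSlope_sq_add_condSd_sq τ ν x y]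
  exact meanTailVar_le _ _ _ _

lemma condExcVar_lt {τ : C(𝕏, ℝ≥0)} (T : ℝ) {ν : GaussianMeasure 𝕏} {x y : 𝕏}
    (h : covFun ν y x ≠ 0) : condExcVar τ T ν x y < excVar T ν y := by
  rw [excVar_eq, ← condSlope_sq_add_condSd_sq τ ν x y]
  exact meanTailVar_lt (condSlope_ne_zero h)

lemma condExcVar_nonneg (τ : C(𝕏, ℝ≥0)) (T : ℝ) (ν : GaussianMeasure 𝕏) (x y : 𝕏) :
    0 ≤ condExcVar τ T ν x y := meanTailVar_nonneg _ _ _ _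

lemma condExcVar_of_covFun_eq_zero {τ : C(𝕏, ℝ≥0)} {T : ℝ} {ν : GaussianMeasure 𝕏} {x y : 𝕏}
    (h : covFun ν y x = 0) : condExcVar τ T ν x y = excVar T ν y := by
  rw [excVar_eq, condExcVar, condSlope, condSd, h, meanTailVar]
  simp

lemma integral_excVar_condLaw (τ : C(𝕏, ℝ≥0)) (T : ℝ) (ν : GaussianMeasure 𝕏) (x y : 𝕏) :
    ∫ p, excVar T (condLaw τ x (obsLin τ x p) ν) y
      ∂((ν : Measure C(𝕏, ℝ)).prod (gaussianReal 0 1)) = condExcVar τ T ν x y := by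
  have hm : Measurable fun z => excVar T (condLaw τ x z ν) y :=
    (measurable_excVar T).comp (((measurable_condLaw τ).comp
      (by fun_prop : Measurable fun z : ℝ => (ν, x, z))).prodMk measurable_const)
  rw [← integral_map (μ := (ν : Measure C(𝕏, ℝ)).prod (gaussianReal 0 1))
    (φ := obsLin τ x) (f := fun z => excVar T (condLaw τ x z ν) y) (by fun_prop)
    hm.aestronglyMeasurable, map_obsLin, integral_map (by fun_prop) hm.aestronglyMeasurable]
  refine integral_congr_ae (Eventually.of_forall fun ζ => ?_)
  have e1 : meanFun (condLaw τ x (meanFun ν x + Real.sqrt (obsVar τ ν x) * ζ) ν) y =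
      meanFun ν y + condSlope τ ν x y * ζ := by
    rw [meanFun_cond, condSlope]
    by_cases h : obsVar τ ν x = 0
    · simp [h]
    · have h1 : Real.sqrt (obsVar τ ν x) ≠ 0 := by
        rwa [ne_eq, Real.sqrt_eq_zero (obsVar_nonneg τ ν x)]
      have h2 := Real.sq_sqrt (obsVar_nonneg τ ν x)
      set s := Real.sqrt (obsVar τ ν x)
      rw [← h2]
      field_simp
      ring
  have e2 : Real.sqrt (covFun (condLaw τ x (meanFun ν x + Real.sqrt (obsVar τ ν x) * ζ) ν) y y) =
      condSd τ ν x y := by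
    rw [covFun_cond, condSd, covFun_comm ν x y, pow_two]
  simp only [excVar_eq, e1, e2]

lemma measurable_condExcVar (τ : C(𝕏, ℝ≥0)) (T : ℝ) :
    Measurable (fun q : (GaussianMeasure 𝕏 × 𝕏) × 𝕏 => condExcVar τ T q.1.1 q.1.2 q.2) := by
  have h1 := measurable_covFun.comp (by fun_prop :
    Measurable fun q : (GaussianMeasure 𝕏 × 𝕏) × 𝕏 => (q.1.1, q.2, q.1.2))
  have h2 := measurable_covFun.comp (by fun_prop :
    Measurable fun q : (GaussianMeasure 𝕏 × 𝕏) × 𝕏 => (q.1.1, q.2, q.2))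
  have h3 := (measurable_obsVar τ).comp (measurable_fst :
    Measurable fun q : (GaussianMeasure 𝕏 × 𝕏) × 𝕏 => q.1)
  have h4 := measurable_meanFun.comp (by fun_prop :
    Measurable fun q : (GaussianMeasure 𝕏 × 𝕏) × 𝕏 => (q.1.1, q.2))
  exact (measurable_meanTailVar T).comp (h4.prodMk ((h1.div h3.sqrt).prodMk
    (h2.sub ((h1.pow_const 2).div h3)).sqrt))

variable (μ : Measure 𝕏) [IsFiniteMeasure μ]

lemma integrable_condExcVar (τ : C(𝕏, ℝ≥0)) (T : ℝ) (ν : GaussianMeasure 𝕏) (x : 𝕏) :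
    Integrable (condExcVar τ T ν x) μ := by
  refine (integrable_excVar T μ ν).mono ((measurable_condExcVar τ T).comp
    (by fun_prop : Measurable fun y => ((ν, x), y))).aestronglyMeasurable
    (Eventually.of_forall fun y => ?_)
  rw [Real.norm_of_nonneg (condExcVar_nonneg τ T ν x y), Real.norm_of_nonneg (excVar_nonneg T ν y)]
  exact condExcVar_le τ T ν x y

/-- The expected residual uncertainty as an integral over `𝕏`. -/
lemma expectedUncertainty_eq (τ : C(𝕏, ℝ≥0)) (T : ℝ) (ν : GaussianMeasure 𝕏) (x : 𝕏) :
    expectedUncertainty τ (lossFunctional (excursionLoss μ T)) x ν =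
      ENNReal.ofReal (∫ y, condExcVar τ T ν x y ∂μ) := by
  have hmeas : Measurable (fun q : (C(𝕏, ℝ) × ℝ) × 𝕏 =>
      excVar T (condLaw τ x (obsLin τ x q.1) ν) q.2) :=
    (measurable_excVar T).comp (((measurable_condLaw τ).comp (by fun_prop :
      Measurable fun q : (C(𝕏, ℝ) × ℝ) × 𝕏 => (ν, x, obsLin τ x q.1))).prodMk measurable_snd)
  have hint : Integrable (Function.uncurry fun (p : C(𝕏, ℝ) × ℝ) y =>
      excVar T (condLaw τ x (obsLin τ x p) ν) y)
      (((ν : Measure C(𝕏, ℝ)).prod (gaussianReal 0 1)).prod μ) :=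
    Integrable.of_bound hmeas.aestronglyMeasurable 1
      (Eventually.of_forall fun q => norm_excVar_le _ _ _)
  have e : ∀ p : C(𝕏, ℝ) × ℝ,
      ((lossFunctional (excursionLoss μ T) (condLaw τ x (p.1 x + p.2 * τ x) ν) : ℝ≥0) : ℝ≥0∞) =
      ENNReal.ofReal (∫ y, excVar T (condLaw τ x (obsLin τ x p) ν) y ∂μ) := fun p => by
    rw [← lossFunctional_eq, ENNReal.ofReal_coe_nnreal, obsLin_apply, mul_comm p.2]
  have hl := hint.integral_prod_left
  simp only [Function.uncurry] at hl
  rw [expectedUncertainty]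
  simp_rw [e]
  rw [← ofReal_integral_eq_lintegral_ofReal hl
    (Eventually.of_forall fun p => integral_nonneg fun y => excVar_nonneg _ _ _),
    integral_integral_swap hint]
  simp_rw [integral_excVar_condLaw]

lemma measurable_expectedUncertainty (τ : C(𝕏, ℝ≥0)) (T : ℝ) :
    Measurable (fun p : GaussianMeasure 𝕏 × 𝕏 =>
      expectedUncertainty τ (lossFunctional (excursionLoss μ T)) p.2 p.1) := by
  simp_rw [expectedUncertainty_eq]
  exact ((measurable_condExcVar τ T).stronglyMeasurable.integral_prod_right
    ).measurable.ennreal_ofReal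

/-- The expected gain `H(ν) - J_x(ν)` of an observation at `x`. -/
noncomputable def gain (τ : C(𝕏, ℝ≥0)) (T : ℝ) (ν : GaussianMeasure 𝕏) (x : 𝕏) : ℝ :=
  ∫ y, (excVar T ν y - condExcVar τ T ν x y) ∂μ

lemma gain_nonneg (τ : C(𝕏, ℝ≥0)) (T : ℝ) (ν : GaussianMeasure 𝕏) (x : 𝕏) :
    0 ≤ gain μ τ T ν x :=
  integral_nonneg fun y => sub_nonneg.2 (condExcVar_le τ T ν x y)

lemma integral_condExcVar (τ : C(𝕏, ℝ≥0)) (T : ℝ) (ν : GaussianMeasure 𝕏) (x : 𝕏) :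
    ∫ y, condExcVar τ T ν x y ∂μ =
      lossFunctional (excursionLoss μ T) ν - gain μ τ T ν x := by
  rw [gain, integral_sub (integrable_excVar T μ ν) (integrable_condExcVar μ τ T ν x),
    lossFunctional_eq]
  ring

lemma expectedUncertainty_le (τ : C(𝕏, ℝ≥0)) (T : ℝ) (ν : GaussianMeasure 𝕏) (x : 𝕏) :
    expectedUncertainty τ (lossFunctional (excursionLoss μ T)) x ν ≤
      lossFunctional (excursionLoss μ T) ν := by
  rw [expectedUncertainty_eq, integral_condExcVar]
  refine ENNReal.ofReal_le_of_le_toReal ?_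
  simpa using gain_nonneg μ τ T ν x

lemma expectedUncertainty_ne_top (τ : C(𝕏, ℝ≥0)) (T : ℝ) (ν : GaussianMeasure 𝕏) (x : 𝕏) :
    expectedUncertainty τ (lossFunctional (excursionLoss μ T)) x ν ≠ ∞ := by
  rw [expectedUncertainty_eq]
  exact ENNReal.ofReal_ne_top

lemma maxGain_eq (τ : C(𝕏, ℝ≥0)) (T : ℝ) (ν : GaussianMeasure 𝕏) :
    maxGain τ (lossFunctional (excursionLoss μ T)) ν =
      ⨆ x, ((gain μ τ T ν x : ℝ) : EReal) := by
  rw [maxGain]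
  refine iSup_congr fun x => ?_
  have h0 : 0 ≤ ∫ y, condExcVar τ T ν x y ∂μ := integral_nonneg fun y => condExcVar_nonneg _ _ _ _ _
  rw [expectedUncertainty_eq, EReal.coe_ennreal_ofReal, max_eq_left h0, integral_condExcVar]
  have : (((lossFunctional (excursionLoss μ T) ν : ℝ≥0∞)) : EReal) =
      ((lossFunctional (excursionLoss μ T) ν : ℝ) : EReal) := rfl
  rw [this, ← EReal.coe_sub, sub_sub_cancel]

lemma maxGain_nonneg [Nonempty 𝕏] (τ : C(𝕏, ℝ≥0)) (T : ℝ) (ν : GaussianMeasure 𝕏) :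
    0 ≤ maxGain τ (lossFunctional (excursionLoss μ T)) ν := by
  rw [maxGain_eq]
  obtain ⟨x⟩ := ‹Nonempty 𝕏›
  exact le_iSup_of_le x (EReal.coe_nonneg.2 (gain_nonneg μ τ T ν x))

lemma gain_le (τ : C(𝕏, ℝ≥0)) (T : ℝ) (ν : GaussianMeasure 𝕏) (x : 𝕏) :
    gain μ τ T ν x ≤ lossFunctional (excursionLoss μ T) ν := by
  have h0 : 0 ≤ ∫ y, condExcVar τ T ν x y ∂μ := integral_nonneg fun y => condExcVar_nonneg _ _ _ _ _
  rw [integral_condExcVar] at h0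
  linarith

/-- An observation at `x` which brings no expected gain is uncorrelated with `f y` for `μ`-almost
every `y`, since a nonzero correlation makes the Bernoulli variance at `y` decrease strictly. -/
lemma ae_covFun_eq_zero_of_gain_eq_zero {τ : C(𝕏, ℝ≥0)} {T : ℝ} {ν : GaussianMeasure 𝕏} {x : 𝕏}
    (h : gain μ τ T ν x = 0) : ∀ᵐ y ∂μ, covFun ν y x = 0 := by
  rw [gain, integral_eq_zero_iff_of_nonneg (fun y => sub_nonneg.2 (condExcVar_le τ T ν x y))
    ((integrable_excVar T μ ν).sub (integrable_condExcVar μ τ T ν x))] at h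
  filter_upwards [h] with y hy
  by_contra hne
  have := condExcVar_lt (τ := τ) T hne
  simp only [Pi.zero_apply] at hy
  linarith

lemma lossFunctional_eq_zero_of_ae_covFun {T : ℝ} {ν : GaussianMeasure 𝕏} {ι : Type*}
    {e : ι → 𝕏} (he : DenseRange e) (h : ∀ i, ∀ᵐ y ∂μ, covFun ν y (e i) = 0) :
    lossFunctional (excursionLoss μ T) ν = 0 := by
  have h1 : ∀ i, μ.support ⊆ {y | covFun ν y (e i) = 0} := fun i =>
    Measure.support_subset_of_isClosed
      (isClosed_eq (continuous_covFun_left ν (e i)) continuous_const) (h i)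
  have h2 : ∀ y ∈ μ.support, covFun ν y y = 0 := fun y hy => by
    have hc : Continuous fun x => covFun ν y x := by
      simp_rw [covFun_comm ν y]
      exact continuous_covFun_left ν y
    have := he.equalizer hc continuous_const (funext fun i => h1 i hy)
    exact congrFun this y
  have h3 : (lossFunctional (excursionLoss μ T) ν : ℝ) = 0 := by
    rw [lossFunctional_eq]
    refine integral_eq_zero_of_ae ?_
    filter_upwards [Measure.support_mem_ae (μ := μ)] with y hy
    exact excVar_eq_zero (h2 y hy)
  exact_mod_cast h3

/-- The functional vanishes exactly where the maximal expected gain does. -/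
lemma maxGain_eq_zero_iff [Nonempty 𝕏] (τ : C(𝕏, ℝ≥0)) (T : ℝ) (ν : GaussianMeasure 𝕏) :
    maxGain τ (lossFunctional (excursionLoss μ T)) ν = 0 ↔
      lossFunctional (excursionLoss μ T) ν = 0 := by
  constructor
  · intro h
    refine lossFunctional_eq_zero_of_ae_covFun μ (e := id) denseRange_id fun x => ?_
    refine ae_covFun_eq_zero_of_gain_eq_zero μ (τ := τ) (T := T)
      (le_antisymm ?_ (gain_nonneg μ τ T ν x))
    rw [maxGain_eq] at h
    exact EReal.coe_nonpos.1 ((le_iSup (fun x => ((gain μ τ T ν x : ℝ) : EReal)) x).trans h.le)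
  · intro h
    refine le_antisymm ?_ (maxGain_nonneg μ τ T ν)
    rw [maxGain_eq]
    refine iSup_le fun x => EReal.coe_nonpos.2 ?_
    have := gain_le μ τ T ν x
    simpa [h] using this

/-- If the expected gains of an observation at `x` tend to `0` along a sequence whose mean and
covariance functions converge pointwise, then the limiting covariance with `x` vanishes. -/
lemma ae_covFun_eq_zero_of_tendsto_gain {τ : C(𝕏, ℝ≥0)} {T : ℝ} {ν : ℕ → GaussianMeasure 𝕏}
    {ν' : GaussianMeasure 𝕏} {x : 𝕏}
    (hg : Tendsto (fun n => gain μ τ T (ν n) x) atTop (𝓝 0))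
    (hm : ∀ᵐ y ∂μ, Tendsto (fun n => meanFun (ν n) y) atTop (𝓝 (meanFun ν' y)))
    (hk : ∀ᵐ y ∂μ, Tendsto (fun n => covFun (ν n) y y) atTop (𝓝 (covFun ν' y y)))
    (hkx : ∀ᵐ y ∂μ, Tendsto (fun n => covFun (ν n) y x) atTop (𝓝 (covFun ν' y x)))
    (hxx : Tendsto (fun n => covFun (ν n) x x) atTop (𝓝 (covFun ν' x x))) :
    ∀ᵐ y ∂μ, covFun ν' y x = 0 := by
  have hi : ∀ n, Integrable (fun y => excVar T (ν n) y - condExcVar τ T (ν n) x y) μ := fun n =>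
    (integrable_excVar T μ (ν n)).sub (integrable_condExcVar μ τ T (ν n) x)
  have hmeas : ∀ n, Measurable fun y =>
      ENNReal.ofReal (excVar T (ν n) y - condExcVar τ T (ν n) x y) := fun n =>
    (((measurable_excVar T).comp (measurable_const.prodMk measurable_id)).sub
      ((measurable_condExcVar τ T).comp
        (by fun_prop : Measurable fun y => ((ν n, x), y)))).ennreal_ofReal
  have e : ∀ n, ∫⁻ y, ENNReal.ofReal (excVar T (ν n) y - condExcVar τ T (ν n) x y) ∂μ =
      ENNReal.ofReal (gain μ τ T (ν n) x) := fun n =>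
    (ofReal_integral_eq_lintegral_ofReal (hi n)
      (Eventually.of_forall fun y => sub_nonneg.2 (condExcVar_le τ T (ν n) x y))).symm
  have hlim : Tendsto (fun n => ENNReal.ofReal (gain μ τ T (ν n) x)) atTop (𝓝 0) := by
    simpa [Function.comp_def] using (ENNReal.continuous_ofReal.tendsto 0).comp hg
  have hF := lintegral_liminf_le (μ := μ) (u := atTop) hmeas
  simp_rw [e] at hF
  rw [hlim.liminf_eq, nonpos_iff_eq_zero, lintegral_eq_zero_iff (.liminf hmeas)] at hF
  have hv : Tendsto (fun n => obsVar τ (ν n) x) atTop (𝓝 (obsVar τ ν' x)) :=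
    hxx.add tendsto_const_nhds
  filter_upwards [hF, hm, hk, hkx] with y h0 hm hk hkx
  by_contra hne
  have hyy : covFun ν' y y ≠ 0 := fun h => hne (by
    rw [covFun_comm]; exact covFun_eq_zero_of_right h x)
  have hs : Real.sqrt (covFun ν' y y) ≠ 0 := by
    rwa [ne_eq, Real.sqrt_eq_zero (covFun_self_nonneg ν' y)]
  have hvne : obsVar τ ν' x ≠ 0 := fun h =>
    hne (covFun_eq_zero_of_right (covFun_self_eq_zero_of_obsVar h) y)
  have hvs : Real.sqrt (obsVar τ ν' x) ≠ 0 := by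
    rwa [ne_eq, Real.sqrt_eq_zero (obsVar_nonneg τ ν' x)]
  have t1 : Tendsto (fun n => excVar T (ν n) y) atTop (𝓝 (excVar T ν' y)) := by
    simp_rw [excVar_eq]
    have := tendsto_normalTail (T := T) (Or.inl hs) hm hk.sqrt
    exact this.mul (tendsto_const_nhds.sub this)
  have t2 : Tendsto (fun n => condExcVar τ T (ν n) x y) atTop (𝓝 (condExcVar τ T ν' x y)) :=
    tendsto_meanTailVar (Or.inl (condSlope_ne_zero hne)) hm (hkx.div hv.sqrt hvs)
      ((hk.sub ((hkx.pow 2).div hv hvne)).sqrt)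
  have t3 := (ENNReal.continuous_ofReal.tendsto _).comp (t1.sub t2)
  have t4 := t3.liminf_eq
  simp only [Function.comp_def] at t4
  rw [t4] at h0
  have := condExcVar_lt (τ := τ) T hne
  simp only [Pi.zero_apply, ENNReal.ofReal_eq_zero] at h0
  linarith

lemma continuous_covFun_self (ν : GaussianMeasure 𝕏) : Continuous fun x => covFun ν x x := by
  have hid : MemLp id 2 (ν : Measure C(𝕏, ℝ)) := IsGaussian.memLp_two_id
  have h2 : Integrable (fun f : C(𝕏, ℝ) => ‖f‖ * ‖f‖) (ν : Measure C(𝕏, ℝ)) :=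
    hid.norm.integrable_mul hid.norm
  have hm : Continuous (meanFun ν) :=
    continuous_of_dominated (F := fun y (f : C(𝕏, ℝ)) => f y) (bound := fun f => ‖f‖)
      (fun y => (memLp_eval ν y).1) (fun y => Eventually.of_forall fun f => f.norm_coe_le_norm y)
      (hid.integrable (by norm_num)).norm (Eventually.of_forall fun f => by fun_prop)
  simp_rw [covFun_eq]
  refine Continuous.sub ?_ (hm.mul hm)
  refine continuous_of_dominated (F := fun y (f : C(𝕏, ℝ)) => f y * f y)
      (bound := fun f => ‖f‖ * ‖f‖) (fun y => (memLp_eval ν y).1.mul (memLp_eval ν y).1)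
      (fun y => Eventually.of_forall fun f => ?_) h2 (Eventually.of_forall fun f => by fun_prop)
  rw [norm_mul]
  exact mul_le_mul (f.norm_coe_le_norm y) (f.norm_coe_le_norm y) (norm_nonneg _) (norm_nonneg _)

lemma continuous_obsVar (τ : C(𝕏, ℝ≥0)) (ν : GaussianMeasure 𝕏) :
    Continuous fun x => obsVar τ ν x :=
  (continuous_covFun_self ν).add ((NNReal.continuous_coe.comp τ.continuous).pow 2)

/-- The sampling criterion is continuous at the points where the observation is not degenerate. -/
lemma continuousAt_expectedUncertainty {τ : C(𝕏, ℝ≥0)} (T : ℝ) {ν : GaussianMeasure 𝕏} {x : 𝕏}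
    (hx : obsVar τ ν x ≠ 0) :
    ContinuousAt (fun x => expectedUncertainty τ (lossFunctional (excursionLoss μ T)) x ν) x := by
  simp_rw [expectedUncertainty_eq]
  refine ENNReal.continuous_ofReal.continuousAt.comp ?_
  refine tendsto_integral_filter_of_dominated_convergence (fun _ => 1)
    (Eventually.of_forall fun x' => (integrable_condExcVar μ τ T ν x').1)
    (Eventually.of_forall fun x' => Eventually.of_forall fun y => ?_) (integrable_const _)
    (Eventually.of_forall fun y => ?_)
  · rw [Real.norm_of_nonneg (condExcVar_nonneg τ T ν x' y)]
    exact (condExcVar_le τ T ν x' y).trans ((Real.le_norm_self _).trans (norm_excVar_le T ν y))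
  · by_cases hyy : covFun ν y y = 0
    · have : ∀ x', condExcVar τ T ν x' y = excVar T ν y := fun x' =>
        condExcVar_of_covFun_eq_zero (by rw [covFun_comm]; exact covFun_eq_zero_of_right hyy x')
      simp_rw [this]
      exact tendsto_const_nhds
    · have hc : Tendsto (fun x' => covFun ν y x') (𝓝 x) (𝓝 (covFun ν y x)) := by
        simp_rw [covFun_comm ν y]
        exact (continuous_covFun_left ν y).tendsto x
      have hv := (continuous_obsVar τ ν).tendsto x
      refine tendsto_meanTailVar ?_ tendsto_const_nhds (hc.div hv.sqrt ?_)
        ((tendsto_const_nhds.sub ((hc.pow 2).div hv hx)).sqrt)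
      · by_contra! hcon
        refine hyy ?_
        rw [← condSlope_sq_add_condSd_sq τ ν x y]
        have h1 : condSlope τ ν x y = 0 := hcon.1
        have h2 : condSd τ ν x y = 0 := hcon.2.1
        simp [h1, h2]
      · rwa [ne_eq, Real.sqrt_eq_zero (obsVar_nonneg τ ν x)]

/-- The infimum of the sampling criterion can be taken over a dense sequence. Where the
observation is degenerate the criterion takes its largest value `H(ν)`; elsewhere it is
continuous. -/
lemma iInf_expectedUncertainty_denseSeq [Nonempty 𝕏] (τ : C(𝕏, ℝ≥0)) (T : ℝ)
    (ν : GaussianMeasure 𝕏) :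
    ⨅ k, expectedUncertainty τ (lossFunctional (excursionLoss μ T))
        (TopologicalSpace.denseSeq 𝕏 k) ν =
      ⨅ x, expectedUncertainty τ (lossFunctional (excursionLoss μ T)) x ν := by
  refine le_antisymm (le_iInf fun x => ?_) (le_iInf fun k => iInf_le _ _)
  by_cases hx : obsVar τ ν x = 0
  · refine (iInf_le _ 0).trans ((expectedUncertainty_le μ τ T ν _).trans (le_of_eq ?_))
    rw [expectedUncertainty_eq]
    have : ∀ y, condExcVar τ T ν x y = excVar T ν y := fun y =>
      condExcVar_of_covFun_eq_zero (covFun_eq_zero_of_right (covFun_self_eq_zero_of_obsVar hx) y)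
    simp_rw [this]
    rw [← lossFunctional_eq, ENNReal.ofReal_coe_nnreal]
  · by_contra! hlt
    have hnhds := (continuousAt_expectedUncertainty μ T hx).eventually_lt_const hlt
    obtain ⟨k, hk⟩ := (TopologicalSpace.denseRange_denseSeq 𝕏).mem_nhds hnhds
    exact absurd (iInf_le (fun k => expectedUncertainty τ (lossFunctional (excursionLoss μ T))
      (TopologicalSpace.denseSeq 𝕏 k) ν) k) (not_le.2 hk)

end Criterion

end SUR

/-! ### Conditional distributions as disintegrations -/

namespace SUR

section Disintegrations

variable {𝕏 : Type u} [MetricSpace 𝕏] [CompactSpace 𝕏] {Ω : Type v} {𝓖 : MeasurableSpace Ω}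
  [mΩ : MeasurableSpace Ω]

/-- `ν` is a `𝓖`-measurable version of the conditional distribution of `ξ` given `𝓖`, expressed
through the measures of the events `A ∩ {ξ ∈ B}`, `A ∈ 𝓖`. -/
structure IsDisintegration (P : Measure Ω) (ξ : Ω → C(𝕏, ℝ)) (𝓖 : MeasurableSpace Ω)
    (ν : Ω → GaussianMeasure 𝕏) : Prop where
  measurable : Measurable[𝓖] ν
  setLIntegral_eq : ∀ A, MeasurableSet[𝓖] A → ∀ B, MeasurableSet B →
    ∫⁻ ω in A, (ν ω : Measure C(𝕏, ℝ)) B ∂P = P (A ∩ ξ ⁻¹' B)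

variable {P : Measure Ω} [IsProbabilityMeasure P] {ξ : Ω → C(𝕏, ℝ)}
  {ν : Ω → GaussianMeasure 𝕏}

lemma IsDisintegration.comp_restrict (h : IsDisintegration P ξ 𝓖 ν) (h𝓖 : 𝓖 ≤ mΩ)
    (hξ : Measurable ξ) {A : Set Ω} (hA : MeasurableSet[𝓖] A) :
    ((gaussianKernel 𝕏).comap ν (h.measurable.mono h𝓖 le_rfl)) ∘ₘ (P.restrict A) =
      (P.restrict A).map ξ := by
  ext B hB
  rw [Measure.bind_apply hB (Kernel.aemeasurable _), Measure.map_apply hξ hB,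
    Measure.restrict_apply (hξ hB), Set.inter_comm]
  exact h.setLIntegral_eq A hA B hB

/-- Integrals against the conditional distribution are conditional expectations. -/
lemma IsDisintegration.integral_ae_eq_condExp {E : Type*} [NormedAddCommGroup E]
    [NormedSpace ℝ E] [CompleteSpace E] (h : IsDisintegration P ξ 𝓖 ν)
    (h𝓖 : 𝓖 ≤ mΩ) (hξ : Measurable ξ) {g : C(𝕏, ℝ) → E} (hg : StronglyMeasurable g)
    (hgi : Integrable (fun ω => g (ξ ω)) P) :
    (fun ω => ∫ f, g f ∂(ν ω : Measure C(𝕏, ℝ))) =ᵐ[P] P[fun ω => g (ξ ω) | 𝓖] := by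
  have hint : ∀ A, MeasurableSet[𝓖] A → Integrable g
      (((gaussianKernel 𝕏).comap ν (h.measurable.mono h𝓖 le_rfl)) ∘ₘ (P.restrict A)) := by
    intro A hA
    rw [h.comp_restrict h𝓖 hξ hA, integrable_map_measure hg.aestronglyMeasurable hξ.aemeasurable]
    exact hgi.integrableOn
  refine ae_eq_condExp_of_forall_setIntegral_eq h𝓖 hgi (fun A hA _ => ?_) (fun A hA _ => ?_) ?_
  · have := hint A hA
    rw [Measure.comp_eq_comp_const_apply] at this
    have h2 := this.integral_comp
    rw [IntegrableOn]
    simpa [Kernel.const_apply, Kernel.comap_apply, gaussianKernel_apply] using h2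
  · have h1 := hint A hA
    have h2 : ∫ f, g f ∂(((gaussianKernel 𝕏).comap ν (h.measurable.mono h𝓖 le_rfl)) ∘ₘ
        (P.restrict A)) = ∫ ω in A, g (ξ ω) ∂P := by
      rw [h.comp_restrict h𝓖 hξ hA, integral_map hξ.aemeasurable hg.aestronglyMeasurable]
    rw [← h2]
    rw [Measure.comp_eq_comp_const_apply] at h1 ⊢
    rw [Kernel.integral_comp h1]
    simp [Kernel.const_apply, Kernel.comap_apply, gaussianKernel_apply]
  · refine StronglyMeasurable.aestronglyMeasurable ?_
    exact @stronglyMeasurable_integral_gaussian 𝕏 _ _ Ω E 𝓖 _ _ ν h.measurable (fun _ f => g f)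
      (hg.comp_measurable (@measurable_snd Ω _ 𝓖 _))

lemma IsDisintegration.isCondDistrib (h : IsDisintegration P ξ 𝓖 ν) (h𝓖 : 𝓖 ≤ mΩ)
    (hξ : Measurable ξ) : IsCondDistrib P ξ 𝓖 ν := by
  intro B hB
  have h1 := h.integral_ae_eq_condExp h𝓖 hξ (g := B.indicator fun _ => (1 : ℝ))
    (stronglyMeasurable_const.indicator hB)
    ((integrable_const (1 : ℝ)).indicator (hξ hB))
  have h2 : ∀ ω, ∫ f, B.indicator (fun _ => (1 : ℝ)) f ∂(ν ω : Measure C(𝕏, ℝ)) =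
      (ν ω : Measure C(𝕏, ℝ)).real B := fun ω => integral_indicator_one hB
  simp_rw [h2] at h1
  exact h1

/-- The conditional distribution also integrates functions of `ξ` and of a `𝓖`-measurable
parameter. -/
lemma IsDisintegration.lintegral_eq {α : Type*} [MeasurableSpace α]
    (h : IsDisintegration P ξ 𝓖 ν) (h𝓖 : 𝓖 ≤ mΩ) (hξ : Measurable ξ) {W : Ω → α}
    (hW : Measurable[𝓖] W) {Φ : α × C(𝕏, ℝ) → ℝ≥0∞} (hΦ : Measurable Φ) :
    ∫⁻ ω, Φ (W ω, ξ ω) ∂P = ∫⁻ ω, ∫⁻ f, Φ (W ω, f) ∂(ν ω : Measure C(𝕏, ℝ)) ∂P := by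
  have hν : Measurable ν := h.measurable.mono h𝓖 le_rfl
  have hWm : Measurable W := hW.mono h𝓖 le_rfl
  have hWν : Measurable[𝓖] fun ω => (W ω, ν ω) := hW.prodMk h.measurable
  have hWνm : Measurable fun ω => (W ω, ν ω) := hWm.prodMk hν
  have hprob : IsProbabilityMeasure (P.map fun ω => (W ω, ν ω)) :=
    Measure.isProbabilityMeasure_map hWνm.aemeasurable
  have hmeas : P.map (fun ω => ((W ω, ν ω), ξ ω)) =
      (P.map fun ω => (W ω, ν ω)) ⊗ₘ ((gaussianKernel 𝕏).comap
        (Prod.snd : α × GaussianMeasure 𝕏 → GaussianMeasure 𝕏) measurable_snd) := by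
    have hprob' : IsProbabilityMeasure (P.map (fun ω => ((W ω, ν ω), ξ ω))) :=
      Measure.isProbabilityMeasure_map (hWνm.prodMk hξ).aemeasurable
    refine Measure.ext_prod fun {A B} hA hB => ?_
    rw [Measure.map_apply (hWνm.prodMk hξ) (hA.prod hB), Measure.compProd_apply_prod hA hB,
      setLIntegral_map hA (Kernel.measurable_coe _ hB) hWνm]
    exact (h.setLIntegral_eq _ (hWν hA) B hB).symm
  have hΦ' : Measurable fun q : (α × GaussianMeasure 𝕏) × C(𝕏, ℝ) => Φ (q.1.1, q.2) :=
    hΦ.comp (by fun_prop)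
  calc ∫⁻ ω, Φ (W ω, ξ ω) ∂P
      = ∫⁻ q, Φ (q.1.1, q.2) ∂(P.map (fun ω => ((W ω, ν ω), ξ ω))) := by
        rw [lintegral_map hΦ' (hWνm.prodMk hξ)]
    _ = _ := by
        rw [hmeas, Measure.lintegral_compProd hΦ',
          lintegral_map (hΦ'.lintegral_kernel_prod_right') hWνm]
        rfl

end Disintegrations

/-! ### Posterior distributions along a sequential design -/

section Posterior

variable {𝕏 : Type u} [MetricSpace 𝕏] [CompactSpace 𝕏] [MeasurableSpace 𝕏] [BorelSpace 𝕏]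
  {Ω : Type v} {τ : C(𝕏, ℝ≥0)} {ξ : Ω → C(𝕏, ℝ)} {U : ℕ → Ω → ℝ} {X : ℕ → Ω → 𝕏}

lemma measurable_design_obsSigma {i n : ℕ} (h : i < n) :
    Measurable[obsSigma τ ξ U X n] (X i) :=
  measurable_iff_comap_le.2 (le_sup_left.trans
    (le_iSup (fun j : Fin n => MeasurableSpace.comap (X j) inferInstance ⊔
      MeasurableSpace.comap (obs τ ξ U X j) inferInstance) ⟨i, h⟩))

lemma measurable_obs_obsSigma {i n : ℕ} (h : i < n) :
    Measurable[obsSigma τ ξ U X n] (obs τ ξ U X i) :=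
  measurable_iff_comap_le.2 (le_sup_right.trans
    (le_iSup (fun j : Fin n => MeasurableSpace.comap (X j) inferInstance ⊔
      MeasurableSpace.comap (obs τ ξ U X j) inferInstance) ⟨i, h⟩))

lemma postLaw_succ (ν₀ : GaussianMeasure 𝕏) (n : ℕ) (ω : Ω) :
    postLaw τ ν₀ ξ U X (n + 1) ω =
      condLaw τ (X n ω) (obs τ ξ U X n ω) (postLaw τ ν₀ ξ U X n ω) := rfl

lemma measurable_condLaw_comp {α : Type*} {m : MeasurableSpace α} {ν : α → GaussianMeasure 𝕏}
    {x : α → 𝕏} {z : α → ℝ} (hν : Measurable ν) (hx : Measurable x) (hz : Measurable z) :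
    Measurable fun a => condLaw τ (x a) (z a) (ν a) := by
  have h := Measurable.comp (measurable_condLaw τ) (hν.prodMk (hx.prodMk hz))
  exact h

lemma measurable_postLaw (ν₀ : GaussianMeasure 𝕏) (n : ℕ) :
    Measurable[obsSigma τ ξ U X n] (postLaw τ ν₀ ξ U X n) := by
  induction n with
  | zero => exact @measurable_const _ _ _ (obsSigma τ ξ U X 0) ν₀
  | succ n ih =>
    have h1 : Measurable[obsSigma τ ξ U X (n + 1)] (postLaw τ ν₀ ξ U X n) :=
      ih.mono (@obsSigma_mono 𝕏 _ _ Ω ⊤ _ _ τ ξ U X _ _ n.le_succ) le_rfl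
    have h2 : postLaw τ ν₀ ξ U X (n + 1) = fun ω =>
      condLaw τ (X n ω) (obs τ ξ U X n ω) (postLaw τ ν₀ ξ U X n ω) := rfl
    rw [h2]
    exact measurable_condLaw_comp h1 (measurable_design_obsSigma n.lt_succ_self)
      (measurable_obs_obsSigma n.lt_succ_self)

/-- The first `n` observations are functions of the process and of the first `n` noise
variables. -/
lemma obsSigma_le_comap (hX : IsSequentialDesign τ ξ U X) (n : ℕ) :
    obsSigma τ ξ U X n ≤
      MeasurableSpace.comap (fun ω => (ξ ω, fun i : Finset.range n => U i ω)) inferInstance := by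
  induction n using Nat.strong_induction_on with
  | _ n ih =>
    have hself : Measurable[MeasurableSpace.comap
        (fun ω => (ξ ω, fun i : Finset.range n => U i ω)) inferInstance]
        (fun ω => (ξ ω, fun i : Finset.range n => U i ω)) := comap_measurable _
    refine iSup_le fun i => ?_
    have hUi : Measurable[MeasurableSpace.comap
        (fun ω => (ξ ω, fun i : Finset.range n => U i ω)) inferInstance] (U i) :=
      (measurable_pi_apply (⟨i, Finset.mem_range.2 i.2⟩ : Finset.range n)).comp
        (measurable_snd.comp hself)
    have hle : MeasurableSpace.comap (fun ω => (ξ ω, fun j : Finset.range i => U j ω))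
        inferInstance ≤ MeasurableSpace.comap
          (fun ω => (ξ ω, fun i : Finset.range n => U i ω)) inferInstance := by
      rw [← measurable_iff_comap_le]
      have hφ : Measurable fun q : C(𝕏, ℝ) × (Finset.range n → ℝ) =>
          (q.1, fun j : Finset.range i =>
            q.2 ⟨j, Finset.mem_range.2 ((Finset.mem_range.1 j.2).trans i.2)⟩) := by fun_prop
      exact hφ.comp hself
    have hXi := (hX i).mono ((ih i i.2).trans hle) le_rfl
    refine sup_le hXi.comap_le (measurable_iff_comap_le.1 ?_)
    exact @measurable_obs 𝕏 _ _ Ω (MeasurableSpace.comap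
      (fun ω => (ξ ω, fun i : Finset.range n => U i ω)) inferInstance) _ _ τ ξ (fun _ => U i) X
      (measurable_fst.comp hself) (fun _ => hUi) i hXi

variable [mΩ : MeasurableSpace Ω] {P : Measure Ω} [IsProbabilityMeasure P]
  {ν₀ : GaussianMeasure 𝕏}

/-- The noise of the next observation is independent of the process and of the past noise. -/
lemma IsModel.indepFun_past (hM : IsModel P ν₀ ξ U) (n : ℕ) :
    IndepFun (fun ω => (ξ ω, fun i : Finset.range n => U i ω)) (U n) P := by
  set Y : Ω → (Finset.range n → ℝ) := fun ω i => U i ω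
  have hY : Measurable Y := measurable_pi_lambda _ fun i => hM.measurable_noise i
  have hU := hM.measurable_noise n
  have hξ := hM.measurable_xi
  have hYU : IndepFun Y (U n) P := by
    have h := hM.iIndepFun_noise.indepFun_finset (Finset.range n) {n} (by simp)
      hM.measurable_noise
    exact h.comp (φ := id) (ψ := fun a : ({n} : Finset ℕ) → ℝ => a ⟨n, by simp⟩) measurable_id
      (measurable_pi_apply _)
  have hξYU : IndepFun ξ (fun ω => (Y ω, U n ω)) P :=
    hM.indepFun_xi_noise.comp (φ := id)
      (ψ := fun a : ℕ → ℝ => ((fun i : Finset.range n => a i), a n)) measurable_id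
      (by fun_prop)
  have hξY : IndepFun ξ Y P := hξYU.comp (φ := id) (ψ := Prod.fst) measurable_id measurable_fst
  rw [indepFun_iff_map_prod_eq_prod_map_map hY.aemeasurable hU.aemeasurable] at hYU
  rw [indepFun_iff_map_prod_eq_prod_map_map hξ.aemeasurable hY.aemeasurable] at hξY
  rw [indepFun_iff_map_prod_eq_prod_map_map hξ.aemeasurable (hY.prodMk hU).aemeasurable] at hξYU
  rw [indepFun_iff_map_prod_eq_prod_map_map (hξ.prodMk hY).aemeasurable hU.aemeasurable, hξY]
  apply MeasurableEquiv.prodAssoc.map_measurableEquiv_injective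
  have hsf : SFinite (P.map (U n)) := inferInstance
  rw [Measure.prodAssoc_prod, ← hYU, ← hξYU,
    Measure.map_map MeasurableEquiv.prodAssoc.measurable ((hξ.prodMk hY).prodMk hU)]
  rfl

lemma IsModel.lintegral_noise (hM : IsModel P ν₀ ξ U) (n : ℕ) {β : Type*} [MeasurableSpace β]
    {V : Ω → β} (hV : Measurable[MeasurableSpace.comap
      (fun ω => (ξ ω, fun i : Finset.range n => U i ω)) inferInstance] V)
    {Ψ : β × ℝ → ℝ≥0∞} (hΨ : Measurable Ψ) :
    ∫⁻ ω, Ψ (V ω, U n ω) ∂P = ∫⁻ ω, ∫⁻ u, Ψ (V ω, u) ∂(gaussianReal 0 1) ∂P := by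
  have hpast : Measurable (fun ω => (ξ ω, fun i : Finset.range n => U i ω)) :=
    hM.measurable_xi.prodMk (measurable_pi_lambda _ fun i => hM.measurable_noise i)
  have hVm : Measurable V := hV.mono hpast.comap_le le_rfl
  have hU := hM.measurable_noise n
  have hind : IndepFun V (U n) P := by
    have h := hM.indepFun_past n
    rw [IndepFun_iff_Indep] at h ⊢
    exact indep_of_indep_of_le_left h hV.comap_le
  rw [indepFun_iff_map_prod_eq_prod_map_map hVm.aemeasurable hU.aemeasurable,
    hM.map_noise] at hind
  rw [← lintegral_map (g := fun ω => (V ω, U n ω)) hΨ (hVm.prodMk hU), hind,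
    lintegral_prod _ hΨ.aemeasurable, lintegral_map hΨ.lintegral_prod_right' hVm]

/-- Given the past, the process and the next noise variable are distributed according to the
product of the posterior and the standard normal distribution. -/
lemma IsModel.lintegral_posterior_noise (hM : IsModel P ν₀ ξ U)
    (hX : IsSequentialDesign τ ξ U X) {n : ℕ}
    (hn : IsDisintegration P ξ (obsSigma τ ξ U X n) (postLaw τ ν₀ ξ U X n))
    {α : Type*} [MeasurableSpace α] {W : Ω → α} (hW : Measurable[obsSigma τ ξ U X n] W)
    {Ψ : α × C(𝕏, ℝ) × ℝ → ℝ≥0∞} (hΨ : Measurable Ψ) :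
    ∫⁻ ω, Ψ (W ω, ξ ω, U n ω) ∂P =
      ∫⁻ ω, ∫⁻ p, Ψ (W ω, p) ∂((postLaw τ ν₀ ξ U X n ω : Measure C(𝕏, ℝ)).prod
        (gaussianReal 0 1)) ∂P := by
  have hF := obsSigma_le τ hM.measurable_xi hM.measurable_noise hX n
  have h1 := hM.lintegral_noise n (V := fun ω => (W ω, ξ ω))
    ((hW.mono (obsSigma_le_comap hX n) le_rfl).prodMk
      (measurable_fst.comp (comap_measurable _)))
    (Ψ := fun q : (α × C(𝕏, ℝ)) × ℝ => Ψ (q.1.1, q.1.2, q.2)) (hΨ.comp (by fun_prop))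
  have hΨ' : Measurable fun q : (α × C(𝕏, ℝ)) × ℝ => Ψ (q.1.1, q.1.2, q.2) :=
    hΨ.comp (by fun_prop)
  rw [h1, hn.lintegral_eq hF hM.measurable_xi hW
    (Φ := fun q => ∫⁻ u, Ψ (q.1, q.2, u) ∂(gaussianReal 0 1)) hΨ'.lintegral_prod_right']
  refine lintegral_congr fun ω => ?_
  have hΨω : Measurable fun p : C(𝕏, ℝ) × ℝ => Ψ (W ω, p) := hΨ.comp (by fun_prop)
  rw [lintegral_prod _ hΨω.aemeasurable]

lemma obs_eq_obsLin (n : ℕ) (ω : Ω) : obs τ ξ U X n ω = obsLin τ (X n ω) (ξ ω, U n ω) := by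
  rw [obsLin_apply]
  rfl

lemma measurable_obsLin_uncurry (τ : C(𝕏, ℝ≥0)) :
    Measurable fun q : 𝕏 × C(𝕏, ℝ) × ℝ => obsLin τ q.1 q.2 := by
  simp_rw [obsLin_apply]
  exact (measurable_eval_prod.comp (by fun_prop :
    Measurable fun q : 𝕏 × C(𝕏, ℝ) × ℝ => (q.2.1, q.1))).add
    ((τ.continuous.measurable.comp measurable_fst).coe_nnreal_real.mul (by fun_prop))

/-- One step of the Bayesian update, in the presence of a parameter `W` known beforehand. -/
lemma IsModel.lintegral_postLaw_succ (hM : IsModel P ν₀ ξ U)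
    (hX : IsSequentialDesign τ ξ U X) {n : ℕ}
    (hn : IsDisintegration P ξ (obsSigma τ ξ U X n) (postLaw τ ν₀ ξ U X n))
    {α : Type*} [MeasurableSpace α] {W : Ω → α} (hW : Measurable[obsSigma τ ξ U X n] W)
    {Φ : (α × ℝ) × C(𝕏, ℝ) → ℝ≥0∞} (hΦ : Measurable Φ) :
    ∫⁻ ω, Φ ((W ω, obs τ ξ U X n ω), ξ ω) ∂P =
      ∫⁻ ω, ∫⁻ f, Φ ((W ω, obs τ ξ U X n ω), f)
        ∂(postLaw τ ν₀ ξ U X (n + 1) ω : Measure C(𝕏, ℝ)) ∂P := by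
  have hpost := measurable_postLaw (τ := τ) (ξ := ξ) (U := U) (X := X) ν₀ n
  have hob : Measurable fun q : (α × 𝕏) × C(𝕏, ℝ) × ℝ => obsLin τ q.1.2 q.2 :=
    (measurable_obsLin_uncurry τ).comp
      (by fun_prop : Measurable fun q : (α × 𝕏) × C(𝕏, ℝ) × ℝ => (q.1.2, q.2))
  have hob' : Measurable fun q : (α × 𝕏 × GaussianMeasure 𝕏) × C(𝕏, ℝ) × ℝ =>
      obsLin τ q.1.2.1 q.2 :=
    (measurable_obsLin_uncurry τ).comp (by fun_prop : Measurable
      fun q : (α × 𝕏 × GaussianMeasure 𝕏) × C(𝕏, ℝ) × ℝ => (q.1.2.1, q.2))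
  have hΨ1 : Measurable fun q : (α × 𝕏) × C(𝕏, ℝ) × ℝ =>
      Φ ((q.1.1, obsLin τ q.1.2 q.2), q.2.1) :=
    hΦ.comp ((((measurable_fst.comp measurable_fst).prodMk hob)).prodMk
      (measurable_fst.comp measurable_snd))
  have hcond : Measurable fun q : (α × 𝕏 × GaussianMeasure 𝕏) × C(𝕏, ℝ) × ℝ =>
      condLaw τ q.1.2.1 (obsLin τ q.1.2.1 q.2) q.1.2.2 :=
    measurable_condLaw_comp (τ := τ)
      (ν := fun q : (α × 𝕏 × GaussianMeasure 𝕏) × C(𝕏, ℝ) × ℝ => q.1.2.2)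
      (x := fun q : (α × 𝕏 × GaussianMeasure 𝕏) × C(𝕏, ℝ) × ℝ => q.1.2.1)
      (z := fun q : (α × 𝕏 × GaussianMeasure 𝕏) × C(𝕏, ℝ) × ℝ => obsLin τ q.1.2.1 q.2)
      (by fun_prop) (by fun_prop) hob'
  have hΨ2 : Measurable fun q : (α × 𝕏 × GaussianMeasure 𝕏) × C(𝕏, ℝ) × ℝ =>
      ∫⁻ f, Φ ((q.1.1, obsLin τ q.1.2.1 q.2), f)
        ∂(condLaw τ q.1.2.1 (obsLin τ q.1.2.1 q.2) q.1.2.2 : Measure C(𝕏, ℝ)) := by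
    refine measurable_lintegral_gaussian hcond
      (F := fun q f => Φ ((q.1.1, obsLin τ q.1.2.1 q.2), f)) ?_
    exact hΦ.comp (((by fun_prop : Measurable fun r :
      ((α × 𝕏 × GaussianMeasure 𝕏) × C(𝕏, ℝ) × ℝ) × C(𝕏, ℝ) => r.1.1.1).prodMk
      (hob'.comp measurable_fst)).prodMk measurable_snd)
  have e1 := hM.lintegral_posterior_noise hX hn (W := fun ω => (W ω, X n ω))
    (hW.prodMk (hX n)) hΨ1
  have e2 := hM.lintegral_posterior_noise hX hn
    (W := fun ω => (W ω, X n ω, postLaw τ ν₀ ξ U X n ω)) (hW.prodMk ((hX n).prodMk hpost)) hΨ2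
  simp only [← obs_eq_obsLin, ← postLaw_succ] at e1 e2
  rw [e1, e2]
  refine lintegral_congr fun ω => ?_
  exact lintegral_condLaw τ (X n ω) (postLaw τ ν₀ ξ U X n ω)
    (F := fun q => Φ ((W ω, q.1), q.2)) (hΦ.comp (by fun_prop))

lemma obsSigma_succ_le (hX : IsSequentialDesign τ ξ U X) (n : ℕ) :
    obsSigma τ ξ U X (n + 1) ≤ obsSigma τ ξ U X n ⊔
      MeasurableSpace.comap (obs τ ξ U X n) inferInstance := by
  refine iSup_le fun i => ?_
  rcases Nat.lt_succ_iff_lt_or_eq.1 i.2 with h | h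
  · exact (sup_le (measurable_design_obsSigma h).comap_le
      (measurable_obs_obsSigma h).comap_le).trans le_sup_left
  · rw [h]
    exact sup_le_sup_right (hX n).comap_le _

lemma IsModel.setLIntegral_postLaw_succ (hM : IsModel P ν₀ ξ U)
    (hX : IsSequentialDesign τ ξ U X) {n : ℕ}
    (hn : IsDisintegration P ξ (obsSigma τ ξ U X n) (postLaw τ ν₀ ξ U X n))
    {α : Type*} [MeasurableSpace α] {W : Ω → α} (hW : Measurable[obsSigma τ ξ U X n] W)
    {S : Set (α × ℝ)} (hS : MeasurableSet S) {B : Set C(𝕏, ℝ)} (hB : MeasurableSet B) :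
    ∫⁻ ω in (fun ω => (W ω, obs τ ξ U X n ω)) ⁻¹' S,
        (postLaw τ ν₀ ξ U X (n + 1) ω : Measure C(𝕏, ℝ)) B ∂P =
      P ((fun ω => (W ω, obs τ ξ U X n ω)) ⁻¹' S ∩ ξ ⁻¹' B) := by
  have hF := obsSigma_le τ hM.measurable_xi hM.measurable_noise hX n
  have hWm : Measurable W := hW.mono hF le_rfl
  have hob : Measurable (obs τ ξ U X n) :=
    measurable_obs τ hM.measurable_xi hM.measurable_noise ((hX n).mono hF le_rfl)
  have hSm : MeasurableSet ((fun ω => (W ω, obs τ ξ U X n ω)) ⁻¹' S) := (hWm.prodMk hob) hS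
  have key := hM.lintegral_postLaw_succ hX hn hW
    (Φ := fun q => S.indicator 1 q.1 * B.indicator 1 q.2)
    (((measurable_one.indicator hS).comp measurable_fst).mul
      ((measurable_one.indicator hB).comp measurable_snd))
  rw [← lintegral_indicator hSm, ← lintegral_indicator_one (hSm.inter (hM.measurable_xi hB))]
  refine Eq.trans (lintegral_congr fun ω => ?_) (key.symm.trans (lintegral_congr fun ω => ?_))
  · change _ = ∫⁻ f, S.indicator 1 (W ω, obs τ ξ U X n ω) * B.indicator 1 f
      ∂(postLaw τ ν₀ ξ U X (n + 1) ω : Measure C(𝕏, ℝ))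
    rw [lintegral_const_mul _ (measurable_one.indicator hB), lintegral_indicator_one hB]
    by_cases h : (W ω, obs τ ξ U X n ω) ∈ S <;> simp [h]
  · rw [Set.inter_indicator_one]
    rfl

/-- The posterior distribution is the conditional distribution given the observations. -/
lemma IsModel.isDisintegration_postLaw (hM : IsModel P ν₀ ξ U)
    (hX : IsSequentialDesign τ ξ U X) (n : ℕ) :
    IsDisintegration P ξ (obsSigma τ ξ U X n) (postLaw τ ν₀ ξ U X n) := by
  induction n with
  | zero =>
    refine ⟨measurable_const, fun A hA B hB => ?_⟩
    have h0 : obsSigma τ ξ U X 0 = ⊥ := iSup_of_empty _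
    rw [h0, MeasurableSpace.measurableSet_bot_iff] at hA
    rcases hA with rfl | rfl
    · simp
    · have h1 : ∀ ω, postLaw τ ν₀ ξ U X 0 ω = ν₀ := fun _ => rfl
      simp [h1, ← hM.map_xi, Measure.map_apply hM.measurable_xi hB]
  | succ n ih =>
    refine ⟨measurable_postLaw ν₀ (n + 1), fun A hA B hB => ?_⟩
    have hF := obsSigma_le τ hM.measurable_xi hM.measurable_noise hX (n + 1)
    have hA' := obsSigma_succ_le hX n A hA
    have hpair := MeasurableSpace.comap_prodMk (mβ := obsSigma τ ξ U X n)
      (mγ := (inferInstance : MeasurableSpace ℝ)) (fun ω : Ω => ω) (obs τ ξ U X n)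
    rw [show MeasurableSpace.comap (fun ω : Ω => ω) (obsSigma τ ξ U X n) = obsSigma τ ξ U X n from
      MeasurableSpace.comap_id] at hpair
    rw [← hpair] at hA'
    obtain ⟨S, hS, rfl⟩ := hA'
    exact @IsModel.setLIntegral_postLaw_succ 𝕏 _ _ _ _ Ω τ ξ U X mΩ P _ ν₀ hM hX n ih Ω
      (obsSigma τ ξ U X n) (fun ω => ω) measurable_id S hS B hB

end Posterior

end SUR

/-! ### The sampling criterion as a one-step prediction -/

namespace SUR

section OneStep

variable {𝕏 : Type u} [MetricSpace 𝕏] [CompactSpace 𝕏] [MeasurableSpace 𝕏] [BorelSpace 𝕏]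
  {Ω : Type v} {τ : C(𝕏, ℝ≥0)} {ξ : Ω → C(𝕏, ℝ)} {U : ℕ → Ω → ℝ} {X : ℕ → Ω → 𝕏}
  [mΩ : MeasurableSpace Ω] {P : Measure Ω} [IsProbabilityMeasure P] {ν₀ : GaussianMeasure 𝕏}

/-- The conditional expectation of `H(P_{n+1})` given the first `n` observations is
`J_{X_n}(P_n)`. -/
lemma IsModel.setLIntegral_succ_eq (hM : IsModel P ν₀ ξ U) (hX : IsSequentialDesign τ ξ U X)
    {H : GaussianMeasure 𝕏 → ℝ≥0} (hH : Measurable H) (n : ℕ) {A : Set Ω}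
    (hA : MeasurableSet[obsSigma τ ξ U X n] A) :
    ∫⁻ ω in A, (H (postLaw τ ν₀ ξ U X (n + 1) ω) : ℝ≥0∞) ∂P =
      ∫⁻ ω in A, expectedUncertainty τ H (X n ω) (postLaw τ ν₀ ξ U X n ω) ∂P := by
  have hF := obsSigma_le τ hM.measurable_xi hM.measurable_noise hX n
  have hob : Measurable fun q : (ℝ≥0∞ × 𝕏 × GaussianMeasure 𝕏) × C(𝕏, ℝ) × ℝ =>
      obsLin τ q.1.2.1 q.2 :=
    (measurable_obsLin_uncurry τ).comp (by fun_prop : Measurable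
      fun q : (ℝ≥0∞ × 𝕏 × GaussianMeasure 𝕏) × C(𝕏, ℝ) × ℝ => (q.1.2.1, q.2))
  have hcond : Measurable fun q : (ℝ≥0∞ × 𝕏 × GaussianMeasure 𝕏) × C(𝕏, ℝ) × ℝ =>
      condLaw τ q.1.2.1 (obsLin τ q.1.2.1 q.2) q.1.2.2 :=
    measurable_condLaw_comp (τ := τ)
      (ν := fun q : (ℝ≥0∞ × 𝕏 × GaussianMeasure 𝕏) × C(𝕏, ℝ) × ℝ => q.1.2.2)
      (x := fun q : (ℝ≥0∞ × 𝕏 × GaussianMeasure 𝕏) × C(𝕏, ℝ) × ℝ => q.1.2.1)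
      (z := fun q : (ℝ≥0∞ × 𝕏 × GaussianMeasure 𝕏) × C(𝕏, ℝ) × ℝ => obsLin τ q.1.2.1 q.2)
      (by fun_prop) (by fun_prop) hob
  have hΨ : Measurable fun q : (ℝ≥0∞ × 𝕏 × GaussianMeasure 𝕏) × C(𝕏, ℝ) × ℝ =>
      q.1.1 * (H (condLaw τ q.1.2.1 (obsLin τ q.1.2.1 q.2) q.1.2.2) : ℝ≥0∞) :=
    (by fun_prop : Measurable fun q : (ℝ≥0∞ × 𝕏 × GaussianMeasure 𝕏) × C(𝕏, ℝ) × ℝ => q.1.1).mul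
      (hH.comp hcond).coe_nnreal_ennreal
  have hone : Measurable[obsSigma τ ξ U X n] (A.indicator (1 : Ω → ℝ≥0∞)) :=
    Measurable.indicator measurable_const hA
  have key := hM.lintegral_posterior_noise hX (hM.isDisintegration_postLaw hX n)
    (W := fun ω => (A.indicator (1 : Ω → ℝ≥0∞) ω, X n ω, postLaw τ ν₀ ξ U X n ω))
    (hone.prodMk ((hX n).prodMk (measurable_postLaw ν₀ n))) hΨ
  simp only [← obs_eq_obsLin, ← postLaw_succ] at key
  rw [← lintegral_indicator (hF _ hA), ← lintegral_indicator (hF _ hA)]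
  refine Eq.trans (lintegral_congr fun ω => ?_) (key.trans (lintegral_congr fun ω => ?_))
  · by_cases h : ω ∈ A <;> simp [h]
  · by_cases h : ω ∈ A
    · simp only [h, Set.indicator_of_mem, Pi.one_apply, one_mul, expectedUncertainty]
      refine lintegral_congr fun p => ?_
      rw [obsLin_apply, mul_comm p.2]
    · simp [h]

/-- A bounded functional which does not increase on average under conditioning has the
supermartingale property. -/
lemma hasSupermartingaleProperty_of_expectedUncertainty_le {H : GaussianMeasure 𝕏 → ℝ≥0}
    (hH : Measurable H) {c : ℝ} (hc : ∀ ν, (H ν : ℝ) ≤ c)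
    (hJ : ∀ x ν, expectedUncertainty τ H x ν ≤ H ν) :
    HasSupermartingaleProperty.{u, v} τ (fun ν => (H ν : ℝ)) := by
  refine ⟨hH.coe_nnreal_real, ?_⟩
  intro Ω _ P _ ν₀ ξ U hM X hX
  have hF := obsSigma_le τ hM.measurable_xi hM.measurable_noise hX
  have hm : ∀ n, Measurable[obsSigma τ ξ U X n]
      fun ω => (H (postLaw τ ν₀ ξ U X n ω) : ℝ) := fun n =>
    hH.coe_nnreal_real.comp (measurable_postLaw ν₀ n)
  have hint : ∀ n, Integrable (fun ω => (H (postLaw τ ν₀ ξ U X n ω) : ℝ)) P := fun n =>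
    .of_bound ((hm n).mono (hF n) le_rfl).aestronglyMeasurable c
      (.of_forall fun ω => by simpa using hc _)
  have hset : ∀ k (A : Set Ω), ∫ ω in A, (H (postLaw τ ν₀ ξ U X k ω) : ℝ) ∂P =
      (∫⁻ ω in A, (H (postLaw τ ν₀ ξ U X k ω) : ℝ≥0∞) ∂P).toReal := fun k A => by
    rw [integral_eq_lintegral_of_nonneg_ae (.of_forall fun _ => NNReal.coe_nonneg _)
      ((hm k).mono (hF k) le_rfl).aestronglyMeasurable]
    simp only [ENNReal.ofReal_coe_nnreal]
  have hfin : ∀ k (A : Set Ω), ∫⁻ ω in A, (H (postLaw τ ν₀ ξ U X k ω) : ℝ≥0∞) ∂P ≠ ∞ :=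
    fun k A => by
      have := (hint k).integrableOn (s := A)
      have h2 := this.lintegral_lt_top
      simpa only [ENNReal.ofReal_coe_nnreal] using h2.ne
  refine supermartingale_of_setIntegral_succ_le ?_ hint fun n A hA => ?_
  · exact fun n => (hm n).stronglyMeasurable
  · rw [hset, hset]
    refine ENNReal.toReal_mono (hfin n A) ?_
    rw [hM.setLIntegral_succ_eq hX hH n hA]
    exact lintegral_mono fun ω => hJ _ _

end OneStep

/-! ### Existence of quasi-optimal designs -/

section Existence

variable {𝕏 : Type u} [MetricSpace 𝕏] [CompactSpace 𝕏] [Nonempty 𝕏] [MeasurableSpace 𝕏]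
  [BorelSpace 𝕏] {Ω : Type v}

/-- If the infimum of the sampling criterion may be computed on a countable dense set, then
nearly optimal points can be selected measurably. -/
lemma exists_measurable_selection {τ : C(𝕏, ℝ≥0)} {H : GaussianMeasure 𝕏 → ℝ≥0}
    (hJ : ∀ x, Measurable (expectedUncertainty τ H x))
    (hfin : ∀ x ν, expectedUncertainty τ H x ν ≠ ∞)
    (hinf : ∀ ν, ⨅ k, expectedUncertainty τ H (TopologicalSpace.denseSeq 𝕏 k) ν =
      ⨅ x, expectedUncertainty τ H x ν) {ε : ℝ} (hε : 0 < ε) :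
    ∃ sel : GaussianMeasure 𝕏 → 𝕏, Measurable sel ∧ ∀ ν,
      expectedUncertainty τ H (sel ν) ν ≤
        (⨅ x, expectedUncertainty τ H x ν) + ENNReal.ofReal ε := by
  set s := TopologicalSpace.denseSeq 𝕏
  have hex : ∀ ν, ∃ k, expectedUncertainty τ H (s k) ν ≤
      (⨅ k, expectedUncertainty τ H (s k) ν) + ENNReal.ofReal ε := by
    intro ν
    have hlt : (⨅ k, expectedUncertainty τ H (s k) ν) <
        (⨅ k, expectedUncertainty τ H (s k) ν) + ENNReal.ofReal ε :=
      ENNReal.lt_add_right (ne_top_of_le_ne_top (hfin (s 0) ν) (iInf_le _ 0)) (by simpa using hε)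
    obtain ⟨k, hk⟩ := iInf_lt_iff.1 hlt
    exact ⟨k, hk.le⟩
  classical
  refine ⟨fun ν => s (Nat.find (hex ν)), ?_, fun ν => ?_⟩
  · refine measurable_from_nat.comp (measurable_find hex fun k => ?_)
    exact measurableSet_le (hJ _) ((Measurable.iInf fun k => hJ (s k)).add_const _)
  · rw [← hinf ν]
    exact Nat.find_spec (hex ν)

/-- The posterior distribution after `n` observations when each design point is obtained by
applying the selection rule `sel` to the current posterior, in recursive form. -/
noncomputable def designPosterior (τ : C(𝕏, ℝ≥0)) (ν₀ : GaussianMeasure 𝕏) (ξ : Ω → C(𝕏, ℝ))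
    (U : ℕ → Ω → ℝ) (sel : ℕ → GaussianMeasure 𝕏 → 𝕏) (ω : Ω) : ℕ → GaussianMeasure 𝕏
  | 0 => ν₀
  | n + 1 =>
    condLaw τ (sel n (designPosterior τ ν₀ ξ U sel ω n))
      (ξ ω (sel n (designPosterior τ ν₀ ξ U sel ω n)) +
        τ (sel n (designPosterior τ ν₀ ξ U sel ω n)) * U n ω)
      (designPosterior τ ν₀ ξ U sel ω n)

/-- A measurable rule which maps posterior distributions to design points defines a sequential
design. -/
lemma exists_design_of_selection (τ : C(𝕏, ℝ≥0)) (ν₀ : GaussianMeasure 𝕏) (ξ : Ω → C(𝕏, ℝ))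
    (U : ℕ → Ω → ℝ) {sel : ℕ → GaussianMeasure 𝕏 → 𝕏} (hsel : ∀ n, Measurable (sel n)) :
    ∃ X : ℕ → Ω → 𝕏, IsSequentialDesign τ ξ U X ∧
      ∀ n ω, X n ω = sel n (postLaw τ ν₀ ξ U X n ω) := by
  set X : ℕ → Ω → 𝕏 := fun n ω => sel n (designPosterior τ ν₀ ξ U sel ω n) with hX
  have hpost : ∀ n ω, postLaw τ ν₀ ξ U X n ω = designPosterior τ ν₀ ξ U sel ω n := by
    intro n ω
    induction n with
    | zero => rfl
    | succ n ih =>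
      rw [postLaw_succ, ih]
      rfl
  have hXp : ∀ n ω, X n ω = sel n (postLaw τ ν₀ ξ U X n ω) := fun n ω => by rw [hpost]
  refine ⟨X, fun n => ?_, hXp⟩
  rw [show X n = fun ω => sel n (postLaw τ ν₀ ξ U X n ω) from funext (hXp n)]
  exact (hsel n).comp (measurable_postLaw ν₀ n)

end Existence

end SUR

/-! ### Gaussianity tested on countably many functionals -/

namespace SUR

section GaussianCriterion

variable {E : Type*} [NormedAddCommGroup E] [NormedSpace ℝ E]

/-- The dual of a separable space contains a countable set from which every functional is obtained
as the pointwise limit of a bounded sequence: closed balls are compact and metrizable in the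
weak-* topology, hence separable. -/
lemma exists_countable_approx_dual (E : Type*) [NormedAddCommGroup E] [NormedSpace ℝ E]
    [TopologicalSpace.SeparableSpace E] :
    ∃ S : ℕ × ℕ → StrongDual ℝ E, ∀ L : StrongDual ℝ E, ∃ (φ : ℕ → ℕ × ℕ) (R : ℝ),
      (∀ k, ‖S (φ k)‖ ≤ R) ∧ ∀ f, Tendsto (fun k => S (φ k) f) atTop (𝓝 (L f)) := by
  set K : ℕ → Set (WeakDual ℝ E) := fun R =>
    WeakDual.toStrongDual ⁻¹' Metric.closedBall (0 : StrongDual ℝ E) R with hK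
  have hKc : ∀ R, IsCompact (K R) := fun R => WeakDual.isCompact_closedBall 0 R
  have hKm : ∀ R, TopologicalSpace.MetrizableSpace (K R) := fun R =>
    WeakDual.metrizable_of_isCompact ℝ E (K R) (hKc R)
  have hKs : ∀ R, CompactSpace (K R) := fun R => isCompact_iff_compactSpace.1 (hKc R)
  have hne : ∀ R, Nonempty (K R) := fun R => ⟨⟨0, by simp [hK]⟩⟩
  have hsep : ∀ R, TopologicalSpace.SeparableSpace (K R) := fun R => by
    let _ := TopologicalSpace.metrizableSpaceMetric (K R)
    infer_instance
  refine ⟨fun p => WeakDual.toStrongDual (TopologicalSpace.denseSeq (K p.1) p.2 : WeakDual ℝ E),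
    fun L => ?_⟩
  obtain ⟨R, hR⟩ := exists_nat_ge ‖L‖
  have hL : StrongDual.toWeakDual L ∈ K R := by simpa [hK] using hR
  have hmem : (⟨_, hL⟩ : K R) ∈ closure (Set.range (TopologicalSpace.denseSeq (K R))) :=
    (TopologicalSpace.denseRange_denseSeq (K R)).closure_range ▸ Set.mem_univ _
  obtain ⟨y, hy, hlim⟩ := mem_closure_iff_seq_limit.1 hmem
  choose j hj using hy
  refine ⟨fun k => (R, j k), R, fun k => ?_, fun f => ?_⟩
  · have := (TopologicalSpace.denseSeq (K R) (j k)).2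
    exact mem_closedBall_zero_iff.1 this
  · have h1 : Tendsto (fun k => ((y k : K R) : WeakDual ℝ E)) atTop
        (𝓝 (StrongDual.toWeakDual L)) := (continuous_subtype_val.tendsto _).comp hlim
    have h2 := ((WeakDual.eval_continuous f).tendsto _).comp h1
    simp only [← hj] at h2
    exact h2

variable [MeasurableSpace E] [BorelSpace E]

/-- A square integrable probability measure is Gaussian as soon as its characteristic function
is the Gaussian one on a set of functionals which is dense for bounded pointwise convergence. -/
lemma isGaussian_of_charFunDual_eq {κ : Measure E} [IsProbabilityMeasure κ]
    (hκ : MemLp id 2 κ) {ι : Type*} {S : ι → StrongDual ℝ E}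
    (hS : ∀ L : StrongDual ℝ E, ∃ (φ : ℕ → ι) (R : ℝ),
      (∀ k, ‖S (φ k)‖ ≤ R) ∧ ∀ f, Tendsto (fun k => S (φ k) f) atTop (𝓝 (L f)))
    (h : ∀ i, charFunDual κ (S i) = Complex.exp ((∫ f, S i f ∂κ : ℝ) * Complex.I -
      (((∫ f, (S i f) ^ 2 ∂κ) - (∫ f, S i f ∂κ) ^ 2 : ℝ) : ℂ) / 2)) : IsGaussian κ := by
  rw [isGaussian_iff_charFunDual_eq]
  intro L
  obtain ⟨φ, R, hR, hlim⟩ := hS L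
  have hbd : ∀ k f, ‖S (φ k) f‖ ≤ R * ‖f‖ := fun k f =>
    ((S (φ k)).le_opNorm f).trans (mul_le_mul_of_nonneg_right (hR k) (norm_nonneg f))
  have hn1 : Integrable (fun f : E => ‖f‖) κ := (hκ.integrable (by norm_num)).norm
  have hn2 : Integrable (fun f : E => ‖f‖ ^ 2) κ := hκ.integrable_norm_pow (by norm_num)
  have l1 : Tendsto (fun k => ∫ f, S (φ k) f ∂κ) atTop (𝓝 (∫ f, L f ∂κ)) :=
    tendsto_integral_of_dominated_convergence (fun f => R * ‖f‖)
      (fun k => (S (φ k)).measurable.aestronglyMeasurable)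
      (hn1.const_mul R) (fun k => .of_forall (hbd k)) (.of_forall hlim)
  have l2 : Tendsto (fun k => ∫ f, (S (φ k) f) ^ 2 ∂κ) atTop (𝓝 (∫ f, (L f) ^ 2 ∂κ)) := by
    refine tendsto_integral_of_dominated_convergence (fun f => R ^ 2 * ‖f‖ ^ 2)
      (fun k => ((S (φ k)).measurable.pow_const 2).aestronglyMeasurable)
      (hn2.const_mul (R ^ 2)) (fun k => .of_forall fun f => ?_)
      (.of_forall fun f => (hlim f).pow 2)
    rw [norm_pow, ← mul_pow]
    exact pow_le_pow_left₀ (norm_nonneg _) (hbd k f) 2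
  have l3 : Tendsto (fun k => charFunDual κ (S (φ k))) atTop (𝓝 (charFunDual κ L)) := by
    simp only [charFunDual_apply]
    refine tendsto_integral_of_dominated_convergence (fun _ => 1) (fun k => ?_)
      (integrable_const _) (fun k => .of_forall fun f => ?_) (.of_forall fun f => ?_)
    · exact (Complex.measurable_exp.comp ((Complex.measurable_ofReal.comp
        (S (φ k)).measurable).mul_const _)).aestronglyMeasurable
    · rw [Complex.norm_exp_ofReal_mul_I]
    · exact (Complex.continuous_exp.tendsto _).comp
        (((Complex.continuous_ofReal.tendsto _).comp (hlim f)).mul_const _)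
  have hL : MemLp (⇑L) 2 κ := L.comp_memLp' hκ
  have hvar : Var[⇑L; κ] = (∫ f, (L f) ^ 2 ∂κ) - (∫ f, L f ∂κ) ^ 2 := by
    rw [variance_eq_sub hL]
    simp only [Pi.pow_apply]
  simp only [h] at l3
  refine tendsto_nhds_unique l3 ?_
  rw [hvar, integral_complex_ofReal]
  refine (Complex.continuous_exp.tendsto _).comp (Tendsto.sub ?_ (Tendsto.div_const ?_ 2))
  · exact ((Complex.continuous_ofReal.tendsto _).comp l1).mul_const _
  · exact (Complex.continuous_ofReal.tendsto _).comp (l2.sub (l1.pow 2))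

end GaussianCriterion

end SUR

/-! ### Existence of the limiting posterior distribution -/

namespace SUR

section CharFun

variable {E : Type*} [NormedAddCommGroup E] [NormedSpace ℝ E] [MeasurableSpace E] [BorelSpace E]

lemma charFunDual_eq_integral_cos_sin (κ : Measure E) [IsProbabilityMeasure κ]
    (L : StrongDual ℝ E) :
    charFunDual κ L = (∫ f, Real.cos (L f) ∂κ : ℝ) + (∫ f, Real.sin (L f) ∂κ : ℝ) * Complex.I := by
  have hc : Integrable (fun f => ((Real.cos (L f) : ℝ) : ℂ)) κ :=
    (Integrable.of_bound (Real.measurable_cos.comp L.measurable).aestronglyMeasurable 1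
      (.of_forall fun f => Real.abs_cos_le_one _)).ofReal
  have hs : Integrable (fun f => ((Real.sin (L f) : ℝ) : ℂ)) κ :=
    (Integrable.of_bound (Real.measurable_sin.comp L.measurable).aestronglyMeasurable 1
      (.of_forall fun f => Real.abs_sin_le_one _)).ofReal
  rw [charFunDual_apply, ← integral_complex_ofReal, ← integral_complex_ofReal,
    ← integral_mul_const, ← integral_add hc (hs.mul_const _)]
  refine integral_congr_ae (.of_forall fun f => ?_)
  simp [Complex.exp_mul_I]

lemma charFunDual_gaussian_eq (κ : Measure E) [IsGaussian κ] (L : StrongDual ℝ E) :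
    charFunDual κ L = Complex.exp ((∫ f, L f ∂κ : ℝ) * Complex.I -
      (((∫ f, (L f) ^ 2 ∂κ) - (∫ f, L f ∂κ) ^ 2 : ℝ) : ℂ) / 2) := by
  have hL : MemLp (⇑L) 2 κ := IsGaussian.memLp_dual κ L 2 (by simp)
  have hvar : Var[⇑L; κ] = (∫ f, (L f) ^ 2 ∂κ) - (∫ f, L f ∂κ) ^ 2 := by
    rw [variance_eq_sub hL]
    simp only [Pi.pow_apply]
  rw [IsGaussian.charFunDual_eq, hvar, integral_complex_ofReal]

end CharFun

section Limit

variable {𝕏 : Type u} [MetricSpace 𝕏] [CompactSpace 𝕏] {Ω : Type v} [mΩ : MeasurableSpace Ω]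
  {P : Measure Ω} [IsProbabilityMeasure P] {ξ : Ω → C(𝕏, ℝ)} {ℱ : Filtration ℕ mΩ}
  {ν : ℕ → Ω → GaussianMeasure 𝕏}

/-- Lévy's upward theorem for integrals against posterior distributions. -/
lemma tendsto_integral_posterior (hν : ∀ n, IsDisintegration P ξ (ℱ n) (ν n))
    (hξ : Measurable ξ) {g : C(𝕏, ℝ) → ℝ} (hg : Measurable g)
    (hgi : Integrable (fun ω => g (ξ ω)) P) :
    ∀ᵐ ω ∂P, Tendsto (fun n => ∫ f, g f ∂(ν n ω : Measure C(𝕏, ℝ))) atTop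
      (𝓝 ((P[fun ω => g (ξ ω) | ⨆ n, ℱ n]) ω)) := by
  have h1 : ∀ᵐ ω ∂P, ∀ n, ∫ f, g f ∂(ν n ω : Measure C(𝕏, ℝ)) =
      (P[fun ω => g (ξ ω) | ℱ n]) ω :=
    ae_all_iff.2 fun n => (hν n).integral_ae_eq_condExp (ℱ.le n) hξ hg.stronglyMeasurable hgi
  filter_upwards [h1, tendsto_ae_condExp (ℱ := ℱ) (μ := P) fun ω => g (ξ ω)] with ω h1 h2
  simpa only [h1] using h2

/-- The regular conditional distribution given the limit of the filtration is almost surely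
Gaussian: its characteristic function is the limit of those of the posterior distributions. -/
lemma ae_charFunDual_condDistrib (hν : ∀ n, IsDisintegration P ξ (ℱ n) (ν n))
    (hξ : Measurable ξ) (hξ2 : MemLp ξ 2 P) {β : Type*} [mβ : MeasurableSpace β] {X : Ω → β}
    (hX : Measurable X) (hℱ : MeasurableSpace.comap X mβ = ⨆ n, ℱ n)
    (L : StrongDual ℝ C(𝕏, ℝ)) :
    ∀ᵐ ω ∂P, charFunDual (condDistrib ξ X P (X ω)) L =
      Complex.exp ((∫ f, L f ∂(condDistrib ξ X P (X ω)) : ℝ) * Complex.I -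
        (((∫ f, (L f) ^ 2 ∂(condDistrib ξ X P (X ω))) -
          (∫ f, L f ∂(condDistrib ξ X P (X ω))) ^ 2 : ℝ) : ℂ) / 2) := by
  have key : ∀ {g : C(𝕏, ℝ) → ℝ}, Measurable g → Integrable (fun ω => g (ξ ω)) P →
      ∀ᵐ ω ∂P, Tendsto (fun n => ∫ f, g f ∂(ν n ω : Measure C(𝕏, ℝ))) atTop
        (𝓝 (∫ f, g f ∂(condDistrib ξ X P (X ω)))) := by
    intro g hg hgi
    have h2 := condExp_ae_eq_integral_condDistrib hX hξ.aemeasurable hg.stronglyMeasurable hgi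
    rw [hℱ] at h2
    filter_upwards [tendsto_integral_posterior hν hξ hg hgi, h2] with ω h1 h2
    rwa [h2] at h1
  have hLξ : MemLp (fun ω => L (ξ ω)) 2 P := L.comp_memLp' hξ2
  have hcos := Real.measurable_cos.comp L.measurable
  have hsin := Real.measurable_sin.comp L.measurable
  filter_upwards [key L.measurable (hLξ.integrable (by norm_num)),
    key (L.measurable.pow_const 2) hLξ.integrable_sq,
    key hcos (.of_bound (hcos.comp hξ).aestronglyMeasurable 1
      (.of_forall fun ω => Real.abs_cos_le_one _)),
    key hsin (.of_bound (hsin.comp hξ).aestronglyMeasurable 1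
      (.of_forall fun ω => Real.abs_sin_le_one _))] with ω h1 h2 h3 h4
  have l1 := ((Complex.continuous_ofReal.tendsto _).comp h3).add
    (((Complex.continuous_ofReal.tendsto _).comp h4).mul_const Complex.I)
  have l2 := (Complex.continuous_exp.tendsto _).comp
    ((((Complex.continuous_ofReal.tendsto _).comp h1).mul_const Complex.I).sub
      (((Complex.continuous_ofReal.tendsto _).comp (h2.sub (h1.pow 2))).div_const 2))
  rw [charFunDual_eq_integral_cos_sin]
  refine tendsto_nhds_unique l1 (l2.congr fun n => ?_)
  have e1 := charFunDual_eq_integral_cos_sin (ν n ω : Measure C(𝕏, ℝ)) L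
  have e2 := charFunDual_gaussian_eq (ν n ω : Measure C(𝕏, ℝ)) L
  rw [e1] at e2
  exact e2.symm

/-- A Gaussian version of the conditional distribution given the limit of the filtration, as a
function of a variable generating the limit. -/
lemma exists_gaussian_condDistrib (hν : ∀ n, IsDisintegration P ξ (ℱ n) (ν n))
    (hξ : Measurable ξ) (hξ2 : MemLp ξ 2 P) {β : Type*} [mβ : MeasurableSpace β] {X : Ω → β}
    (hX : Measurable X) (hℱ : MeasurableSpace.comap X mβ = ⨆ n, ℱ n) (ν₀ : GaussianMeasure 𝕏) :
    ∃ ρ : β → GaussianMeasure 𝕏, Measurable ρ ∧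
      ∀ᵐ ω ∂P, (ρ (X ω) : Measure C(𝕏, ℝ)) = condDistrib ξ X P (X ω) := by
  obtain ⟨S, hS⟩ := exists_countable_approx_dual C(𝕏, ℝ)
  set κ := condDistrib ξ X P with hκ
  have hint : ∀ {g : C(𝕏, ℝ) → ℝ}, Measurable g → Measurable fun b => ∫ f, g f ∂κ b :=
    fun hg => (StronglyMeasurable.integral_kernel hg.stronglyMeasurable).measurable
  set good : Set β := {b | (∫⁻ f, ‖f‖ₑ ^ 2 ∂κ b < ∞) ∧ ∀ i, charFunDual (κ b) (S i) =
      Complex.exp ((∫ f, S i f ∂κ b : ℝ) * Complex.I -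
        (((∫ f, (S i f) ^ 2 ∂κ b) - (∫ f, S i f ∂κ b) ^ 2 : ℝ) : ℂ) / 2)} with hgood
  have hgm : MeasurableSet good := by
    have hn : Measurable fun f : C(𝕏, ℝ) => ‖f‖ₑ ^ 2 := by fun_prop
    rw [hgood, Set.ofPred_and, Set.ofPred_forall]
    refine (measurableSet_lt hn.lintegral_kernel measurable_const).inter
      (MeasurableSet.iInter fun i => measurableSet_eq_fun ?_ ?_)
    · simp only [charFunDual_eq_integral_cos_sin]
      exact (Complex.measurable_ofReal.comp
        (hint (Real.measurable_cos.comp (S i).measurable))).add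
        ((Complex.measurable_ofReal.comp
          (hint (Real.measurable_sin.comp (S i).measurable))).mul_const _)
    · have h1 := hint (S i).measurable
      have h2 := hint ((S i).measurable.pow_const 2)
      exact Complex.measurable_exp.comp (((Complex.measurable_ofReal.comp h1).mul_const _).sub
        ((Complex.measurable_ofReal.comp (h2.sub (h1.pow_const 2))).div_const 2))
  have hgauss : ∀ b ∈ good, IsGaussian (κ b) := by
    rintro b ⟨hb1, hb2⟩
    refine isGaussian_of_charFunDual_eq ⟨aestronglyMeasurable_id, ?_⟩ hS hb2
    rw [eLpNorm_lt_top_iff_lintegral_rpow_enorm_lt_top (by norm_num) (by norm_num)]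
    simpa using hb1
  have hae : ∀ᵐ ω ∂P, X ω ∈ good := by
    have h1 : ∀ᵐ ω ∂P, ∫⁻ f, ‖f‖ₑ ^ 2 ∂κ (X ω) < ∞ := by
      have hn : Measurable fun f : C(𝕏, ℝ) => ‖f‖ₑ ^ 2 := by fun_prop
      have hfin : ∫⁻ ω, ‖ξ ω‖ₑ ^ 2 ∂P < ∞ := by
        have := hξ2.2
        rw [eLpNorm_lt_top_iff_lintegral_rpow_enorm_lt_top (by norm_num) (by norm_num)] at this
        simpa using this
      have hcomp : ∫⁻ ω, ∫⁻ f, ‖f‖ₑ ^ 2 ∂κ (X ω) ∂P = ∫⁻ ω, ‖ξ ω‖ₑ ^ 2 ∂P := by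
        have e := condDistrib_comp_map (mβ := mβ) hX.aemeasurable hξ.aemeasurable (μ := P)
        have e2 := lintegral_map hn hξ (μ := P)
        rwa [← e, Measure.lintegral_bind κ.measurable.aemeasurable hn.aemeasurable,
          lintegral_map hn.lintegral_kernel hX] at e2
      refine ae_lt_top (hn.lintegral_kernel.comp hX) ?_
      change ∫⁻ ω, ∫⁻ f, ‖f‖ₑ ^ 2 ∂κ (X ω) ∂P ≠ ∞
      rw [hcomp]
      exact hfin.ne
    filter_upwards [h1, ae_all_iff.2 fun i =>
      ae_charFunDual_condDistrib hν hξ hξ2 hX hℱ (S i)] with ω h1 h2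
    exact ⟨h1, h2⟩
  classical
  refine ⟨fun b => ⟨if b ∈ good then κ b else ν₀, ?_⟩, ?_, ?_⟩
  · split_ifs with h
    · exact hgauss b h
    · exact ν₀.2
  · exact (Measurable.ite hgm κ.measurable measurable_const).subtype_mk
  · filter_upwards [hae] with ω h
    exact if_pos h

/-- The limiting posterior distribution. -/
lemma exists_isDisintegration_iSup (hν : ∀ n, IsDisintegration P ξ (ℱ n) (ν n))
    (hξ : Measurable ξ) (hξ2 : MemLp ξ 2 P) (ν₀ : GaussianMeasure 𝕏) :
    ∃ ν' : Ω → GaussianMeasure 𝕏, IsDisintegration P ξ (⨆ n, ℱ n) ν' := by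
  have hle : (⨆ n, ℱ n : MeasurableSpace Ω) ≤ mΩ := iSup_le fun n => ℱ.le n
  have hid : @Measurable Ω Ω mΩ (⨆ n, ℱ n) id := measurable_id.mono le_rfl hle
  obtain ⟨ρ, hρ, hae⟩ := exists_gaussian_condDistrib (mβ := ⨆ n, ℱ n) hν hξ hξ2 hid
    MeasurableSpace.comap_id ν₀
  refine ⟨ρ, hρ, fun A hA B hB => ?_⟩
  have h := setLIntegral_condDistrib_of_measurableSet (mβ := ⨆ n, ℱ n) hid hξ.aemeasurable hB
    (μ := P) (Y := ξ) (t := A) (by rwa [MeasurableSpace.comap_id])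
  rw [← h]
  refine lintegral_congr_ae (ae_restrict_of_ae ?_)
  filter_upwards [hae] with ω hω
  exact congrArg (fun κ : Measure C(𝕏, ℝ) => κ B) hω

end Limit

end SUR

/-! ### Convergence along the posterior distributions -/

namespace SUR

section PointwiseConvergence

variable {𝕏 : Type u} [MetricSpace 𝕏] [CompactSpace 𝕏] [MeasurableSpace 𝕏] [BorelSpace 𝕏]
  {Ω : Type v} [mΩ : MeasurableSpace Ω] {P : Measure Ω} [IsProbabilityMeasure P]
  {ξ : Ω → C(𝕏, ℝ)} {ℱ : Filtration ℕ mΩ} {ν : ℕ → Ω → GaussianMeasure 𝕏}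
  {ν' : Ω → GaussianMeasure 𝕏}

lemma ae_tendsto_integral_limit (hν : ∀ n, IsDisintegration P ξ (ℱ n) (ν n))
    (hν' : IsDisintegration P ξ (⨆ n, ℱ n) ν') (hξ : Measurable ξ) {g : C(𝕏, ℝ) → ℝ}
    (hg : Measurable g) (hgi : Integrable (fun ω => g (ξ ω)) P) :
    ∀ᵐ ω ∂P, Tendsto (fun n => ∫ f, g f ∂(ν n ω : Measure C(𝕏, ℝ))) atTop
      (𝓝 (∫ f, g f ∂(ν' ω : Measure C(𝕏, ℝ)))) := by
  have hle : (⨆ n, ℱ n : MeasurableSpace Ω) ≤ mΩ := iSup_le fun n => ℱ.le n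
  filter_upwards [tendsto_integral_posterior hν hξ hg hgi,
    hν'.integral_ae_eq_condExp hle hξ hg.stronglyMeasurable hgi] with ω h1 h2
  rwa [h2]

lemma memLp_eval_comp (hξ2 : MemLp ξ 2 P) (y : 𝕏) : MemLp (fun ω => ξ ω y) 2 P := by
  have h := (ContinuousMap.evalCLM ℝ y : C(𝕏, ℝ) →L[ℝ] ℝ).comp_memLp' hξ2
  exact h

lemma ae_tendsto_meanFun (hν : ∀ n, IsDisintegration P ξ (ℱ n) (ν n))
    (hν' : IsDisintegration P ξ (⨆ n, ℱ n) ν') (hξ : Measurable ξ) (hξ2 : MemLp ξ 2 P) (y : 𝕏) :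
    ∀ᵐ ω ∂P, Tendsto (fun n => meanFun (ν n ω) y) atTop (𝓝 (meanFun (ν' ω) y)) :=
  ae_tendsto_integral_limit hν hν' hξ (measurable_eval y)
    ((memLp_eval_comp hξ2 y).integrable (by norm_num))

lemma ae_tendsto_covFun (hν : ∀ n, IsDisintegration P ξ (ℱ n) (ν n))
    (hν' : IsDisintegration P ξ (⨆ n, ℱ n) ν') (hξ : Measurable ξ) (hξ2 : MemLp ξ 2 P)
    (y x : 𝕏) :
    ∀ᵐ ω ∂P, Tendsto (fun n => covFun (ν n ω) y x) atTop (𝓝 (covFun (ν' ω) y x)) := by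
  filter_upwards [ae_tendsto_meanFun hν hν' hξ hξ2 y, ae_tendsto_meanFun hν hν' hξ hξ2 x,
    ae_tendsto_integral_limit hν hν' hξ ((measurable_eval y).mul (measurable_eval x))
      ((memLp_eval_comp hξ2 y).integrable_mul (memLp_eval_comp hξ2 x))] with ω h1 h2 h3
  simp_rw [covFun_eq]
  exact h3.sub (h1.mul h2)

lemma ae_tendsto_excVar (hν : ∀ n, IsDisintegration P ξ (ℱ n) (ν n))
    (hν' : IsDisintegration P ξ (⨆ n, ℱ n) ν') (hξ : Measurable ξ) (T : ℝ) (y : 𝕏) :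
    ∀ᵐ ω ∂P, Tendsto (fun n => excVar T (ν n ω) y) atTop (𝓝 (excVar T (ν' ω) y)) := by
  have hm : Measurable fun f : C(𝕏, ℝ) => excInd T f y :=
    (measurable_excInd T).comp (by fun_prop : Measurable fun f : C(𝕏, ℝ) => (f, y))
  filter_upwards [ae_tendsto_integral_limit hν hν' hξ hm
    (.of_bound (hm.comp hξ).aestronglyMeasurable 1 (.of_forall fun ω => by
      rw [Real.norm_of_nonneg (excInd_mem T _ y).1]
      exact (excInd_mem T _ y).2))] with ω h
  simp_rw [integral_excInd] at h
  exact h.mul (tendsto_const_nhds.sub h)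

/-- A random sequence of measures along which the Bernoulli variance converges almost surely at
each fixed point is one along which the functional converges almost surely. -/
lemma ae_tendsto_lossFunctional (μ : Measure 𝕏) [IsFiniteMeasure μ] (T : ℝ)
    (hν : ∀ n, Measurable (ν n)) (hν' : Measurable ν')
    (h : ∀ y, ∀ᵐ ω ∂P, Tendsto (fun n => excVar T (ν n ω) y) atTop (𝓝 (excVar T (ν' ω) y))) :
    ∀ᵐ ω ∂P, Tendsto (fun n => (lossFunctional (excursionLoss μ T) (ν n ω) : ℝ)) atTop
      (𝓝 (lossFunctional (excursionLoss μ T) (ν' ω) : ℝ)) := by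
  have hm : ∀ {ρ : Ω → GaussianMeasure 𝕏}, Measurable ρ →
      Measurable fun p : 𝕏 × Ω => excVar T (ρ p.2) p.1 := fun hρ =>
    (measurable_excVar T).comp ((hρ.comp measurable_snd).prodMk measurable_fst)
  have hset : MeasurableSet {p : 𝕏 × Ω |
      Tendsto (fun n => excVar T (ν n p.2) p.1) atTop (𝓝 (excVar T (ν' p.2) p.1))} :=
    measurableSet_tendsto_fun (fun n => hm (hν n)) (hm hν')
  have h' : ∀ᵐ y ∂μ, ∀ᵐ ω ∂P,
      Tendsto (fun n => excVar T (ν n ω) y) atTop (𝓝 (excVar T (ν' ω) y)) := .of_forall h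
  rw [Measure.ae_ae_comm hset] at h'
  filter_upwards [h'] with ω hω
  simp_rw [lossFunctional_eq]
  exact tendsto_integral_of_dominated_convergence (fun _ => 1)
    (fun n => (integrable_excVar T μ (ν n ω)).1) (integrable_const _)
    (fun n => .of_forall fun y => norm_excVar_le T (ν n ω) y) hω

lemma ae_ae_tendsto_meanFun (μ : Measure 𝕏) [IsFiniteMeasure μ]
    (hν : ∀ n, Measurable (ν n)) (hν' : Measurable ν')
    (h : ∀ y, ∀ᵐ ω ∂P, Tendsto (fun n => meanFun (ν n ω) y) atTop (𝓝 (meanFun (ν' ω) y))) :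
    ∀ᵐ ω ∂P, ∀ᵐ y ∂μ, Tendsto (fun n => meanFun (ν n ω) y) atTop (𝓝 (meanFun (ν' ω) y)) := by
  have hm : ∀ {ρ : Ω → GaussianMeasure 𝕏}, Measurable ρ →
      Measurable fun p : 𝕏 × Ω => meanFun (ρ p.2) p.1 := fun hρ =>
    measurable_meanFun.comp ((hρ.comp measurable_snd).prodMk measurable_fst)
  exact (Measure.ae_ae_comm
    (measurableSet_tendsto_fun (fun n => hm (hν n)) (hm hν'))).1 (.of_forall h)

lemma ae_ae_tendsto_covFun (μ : Measure 𝕏) [IsFiniteMeasure μ]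
    (hν : ∀ n, Measurable (ν n)) (hν' : Measurable ν') {g : 𝕏 → 𝕏} (hg : Measurable g)
    (h : ∀ y, ∀ᵐ ω ∂P,
      Tendsto (fun n => covFun (ν n ω) y (g y)) atTop (𝓝 (covFun (ν' ω) y (g y)))) :
    ∀ᵐ ω ∂P, ∀ᵐ y ∂μ,
      Tendsto (fun n => covFun (ν n ω) y (g y)) atTop (𝓝 (covFun (ν' ω) y (g y))) := by
  have hm : ∀ {ρ : Ω → GaussianMeasure 𝕏}, Measurable ρ →
      Measurable fun p : 𝕏 × Ω => covFun (ρ p.2) p.1 (g p.1) := fun hρ =>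
    measurable_covFun.comp ((hρ.comp measurable_snd).prodMk
      (measurable_fst.prodMk (hg.comp measurable_fst)))
  exact (Measure.ae_ae_comm
    (measurableSet_tendsto_fun (fun n => hm (hν n)) (hm hν'))).1 (.of_forall h)

/-- If the expected gains tend to zero at every point, then the limiting posterior distribution
has no residual uncertainty. -/
lemma ae_lossFunctional_limit_eq_zero [Nonempty 𝕏] (μ : Measure 𝕏) [IsFiniteMeasure μ]
    {τ : C(𝕏, ℝ≥0)} {T : ℝ} (hν : ∀ n, IsDisintegration P ξ (ℱ n) (ν n))
    (hν' : IsDisintegration P ξ (⨆ n, ℱ n) ν') (hξ : Measurable ξ) (hξ2 : MemLp ξ 2 P)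
    (hg : ∀ᵐ ω ∂P, ∀ x, Tendsto (fun n => gain μ τ T (ν n ω) x) atTop (𝓝 0)) :
    ∀ᵐ ω ∂P, lossFunctional (excursionLoss μ T) (ν' ω) = 0 := by
  have hle : (⨆ n, ℱ n : MeasurableSpace Ω) ≤ mΩ := iSup_le fun n => ℱ.le n
  have hm : ∀ n, Measurable (ν n) := fun n => (hν n).measurable.mono (ℱ.le n) le_rfl
  have hm' : Measurable ν' := hν'.measurable.mono hle le_rfl
  set e := TopologicalSpace.denseSeq 𝕏
  filter_upwards [hg,
    ae_ae_tendsto_meanFun μ hm hm' fun y => ae_tendsto_meanFun hν hν' hξ hξ2 y,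
    ae_ae_tendsto_covFun μ hm hm' measurable_id fun y => ae_tendsto_covFun hν hν' hξ hξ2 y y,
    ae_all_iff.2 fun i => ae_ae_tendsto_covFun μ hm hm' (g := fun _ => e i) measurable_const
      fun y => ae_tendsto_covFun hν hν' hξ hξ2 y (e i),
    ae_all_iff.2 fun i => ae_tendsto_covFun hν hν' hξ hξ2 (e i) (e i)] with ω h1 h2 h3 h4 h5
  exact lossFunctional_eq_zero_of_ae_covFun μ (TopologicalSpace.denseRange_denseSeq 𝕏) fun i =>
    ae_covFun_eq_zero_of_tendsto_gain μ (h1 (e i)) h2 h3 (h4 i) (h5 i)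

end PointwiseConvergence

/-! ### Quasi-optimal designs exhaust the uncertainty -/

section QuasiSUR

variable {𝕏 : Type u} [MetricSpace 𝕏] [CompactSpace 𝕏] [MeasurableSpace 𝕏] [BorelSpace 𝕏]
  (μ : Measure 𝕏) [IsFiniteMeasure μ] {Ω : Type v} {τ : C(𝕏, ℝ≥0)} {T : ℝ}
  {ξ : Ω → C(𝕏, ℝ)} {U : ℕ → Ω → ℝ} {X : ℕ → Ω → 𝕏} {ν₀ : GaussianMeasure 𝕏}

lemma expectedUncertainty_eq_sub_gain (ν : GaussianMeasure 𝕏) (x : 𝕏) :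
    expectedUncertainty τ (lossFunctional (excursionLoss μ T)) x ν =
      ENNReal.ofReal (lossFunctional (excursionLoss μ T) ν - gain μ τ T ν x) := by
  rw [expectedUncertainty_eq, integral_condExcVar]

lemma expectedUncertainty_add_gain (ν : GaussianMeasure 𝕏) (x : 𝕏) :
    expectedUncertainty τ (lossFunctional (excursionLoss μ T)) x ν +
      ENNReal.ofReal (gain μ τ T ν x) = lossFunctional (excursionLoss μ T) ν := by
  rw [expectedUncertainty_eq_sub_gain, ← ENNReal.ofReal_add (sub_nonneg.2 (gain_le μ τ T ν x))
    (gain_nonneg μ τ T ν x), sub_add_cancel, ENNReal.ofReal_coe_nnreal]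

/-- The gain at a quasi-optimal point dominates the gain everywhere, up to `ε`. -/
lemma gain_le_add_of_quasiSUR {ε : ℕ → ℝ} (hε : ∀ n, 0 < ε n) {n₀ : ℕ} {ω : Ω}
    (h : QuasiSURFrom τ (lossFunctional (excursionLoss μ T)) ν₀ ξ U X ε n₀ ω) {n : ℕ}
    (hn : n₀ ≤ n) (x : 𝕏) :
    gain μ τ T (postLaw τ ν₀ ξ U X n ω) x ≤
      gain μ τ T (postLaw τ ν₀ ξ U X n ω) (X n ω) + ε n := by
  have h1 := (h n hn).trans (add_le_add_left (iInf_le _ x) _)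
  have h0 := sub_nonneg.2 (gain_le μ τ T (postLaw τ ν₀ ξ U X n ω) x)
  rw [expectedUncertainty_eq_sub_gain, expectedUncertainty_eq_sub_gain,
    ← ENNReal.ofReal_add h0 (hε n).le,
    ENNReal.ofReal_le_ofReal_iff (add_nonneg h0 (hε n).le)] at h1
  linarith

variable [mΩ : MeasurableSpace Ω] {P : Measure Ω} [IsProbabilityMeasure P]

lemma measurable_gain_design (hM : IsModel P ν₀ ξ U) (hX : IsSequentialDesign τ ξ U X) (n : ℕ) :
    Measurable fun ω => ENNReal.ofReal (gain μ τ T (postLaw τ ν₀ ξ U X n ω) (X n ω)) := by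
  have hF := obsSigma_le τ hM.measurable_xi hM.measurable_noise hX n
  have hpost : Measurable (postLaw τ ν₀ ξ U X n) := (measurable_postLaw ν₀ n).mono hF le_rfl
  have hXn : Measurable (X n) := (hX n).mono hF le_rfl
  have h1 : Measurable fun ω => expectedUncertainty τ (lossFunctional (excursionLoss μ T)) (X n ω)
      (postLaw τ ν₀ ξ U X n ω) := by
    have h := (measurable_expectedUncertainty μ τ T).comp (hpost.prodMk hXn)
    exact h
  have h2 : ∀ ω, gain μ τ T (postLaw τ ν₀ ξ U X n ω) (X n ω) =
      lossFunctional (excursionLoss μ T) (postLaw τ ν₀ ξ U X n ω) -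
      (expectedUncertainty τ (lossFunctional (excursionLoss μ T)) (X n ω)
        (postLaw τ ν₀ ξ U X n ω)).toReal := fun ω => by
    rw [expectedUncertainty_eq_sub_gain, ENNReal.toReal_ofReal (sub_nonneg.2 (gain_le _ _ _ _ _))]
    ring
  simp_rw [h2]
  exact (((measurable_lossFunctional μ T).comp hpost).coe_nnreal_real.sub
    h1.ennreal_toReal).ennreal_ofReal

/-- The expected uncertainty decreases at each step by the expected gain of that step. -/
lemma sum_lintegral_gain_add (hM : IsModel P ν₀ ξ U) (hX : IsSequentialDesign τ ξ U X) (n : ℕ) :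
    ∑ i ∈ Finset.range n, ∫⁻ ω, ENNReal.ofReal (gain μ τ T (postLaw τ ν₀ ξ U X i ω) (X i ω)) ∂P +
      ∫⁻ ω, (lossFunctional (excursionLoss μ T) (postLaw τ ν₀ ξ U X n ω) : ℝ≥0∞) ∂P =
    lossFunctional (excursionLoss μ T) ν₀ := by
  induction n with
  | zero =>
    have h0 : ∀ ω, postLaw τ ν₀ ξ U X 0 ω = ν₀ := fun _ => rfl
    simp [h0]
  | succ n ih =>
    have h1 := hM.setLIntegral_succ_eq hX (measurable_lossFunctional μ T) n
      (MeasurableSet.univ (α := Ω))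
    rw [Measure.restrict_univ] at h1
    rw [Finset.sum_range_succ, h1, add_assoc,
      ← lintegral_add_left (measurable_gain_design μ hM hX n), ← ih]
    congr 1
    refine lintegral_congr fun ω => ?_
    rw [add_comm]
    exact expectedUncertainty_add_gain μ _ _

/-- The gains of the successive observations are summable, hence tend to zero. -/
lemma ae_tendsto_gain_design (hM : IsModel P ν₀ ξ U) (hX : IsSequentialDesign τ ξ U X) :
    ∀ᵐ ω ∂P, Tendsto (fun n => gain μ τ T (postLaw τ ν₀ ξ U X n ω) (X n ω)) atTop (𝓝 0) := by
  have hsum : ∫⁻ ω, ∑' n, ENNReal.ofReal (gain μ τ T (postLaw τ ν₀ ξ U X n ω) (X n ω)) ∂P ≠ ∞ := by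
    rw [lintegral_tsum fun n => (measurable_gain_design μ hM hX n).aemeasurable]
    refine ne_top_of_le_ne_top (ENNReal.coe_ne_top (r := lossFunctional (excursionLoss μ T) ν₀)) ?_
    refine ENNReal.tsum_le_of_sum_range_le fun n => ?_
    rw [← sum_lintegral_gain_add μ hM hX n]
    exact le_self_add
  filter_upwards [ae_lt_top (Measurable.tsum fun n => measurable_gain_design μ hM hX n) hsum]
    with ω hω
  have h := ENNReal.tendsto_atTop_zero_of_tsum_ne_top hω.ne
  have h2 := (ENNReal.tendsto_toReal ENNReal.zero_ne_top).comp h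
  refine h2.congr fun n => ?_
  exact ENNReal.toReal_ofReal (gain_nonneg _ _ _ _ _)

/-- Along a quasi-optimal design the expected gains tend to zero uniformly. -/
lemma ae_tendsto_gain_bound (hM : IsModel P ν₀ ξ U)
    (hX : IsQuasiSUR τ (lossFunctional (excursionLoss μ T)) P ν₀ ξ U X) :
    ∀ᵐ ω ∂P, ∃ b : ℕ → ℝ, Tendsto b atTop (𝓝 0) ∧
      ∀ᶠ n in atTop, ∀ x, gain μ τ T (postLaw τ ν₀ ξ U X n ω) x ≤ b n := by
  obtain ⟨ε, hε, hε0, hseq, n₀, hn₀⟩ := hX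
  filter_upwards [ae_tendsto_gain_design μ (T := T) hM hseq, hn₀] with ω h1 h2
  refine ⟨fun n => gain μ τ T (postLaw τ ν₀ ξ U X n ω) (X n ω) + ε n, ?_, ?_⟩
  · simpa using h1.add hε0
  · filter_upwards [eventually_ge_atTop n₀] with n hn x
    exact gain_le_add_of_quasiSUR μ hε h2 hn x

lemma ae_tendsto_maxGain [Nonempty 𝕏] (hM : IsModel P ν₀ ξ U)
    (hX : IsQuasiSUR τ (lossFunctional (excursionLoss μ T)) P ν₀ ξ U X) :
    ∀ᵐ ω ∂P, Tendsto (fun n => maxGain τ (lossFunctional (excursionLoss μ T))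
      (postLaw τ ν₀ ξ U X n ω)) atTop (𝓝 0) := by
  filter_upwards [ae_tendsto_gain_bound μ hM hX] with ω ⟨b, hb, hle⟩
  have hb' : Tendsto (fun n => ((b n : ℝ) : EReal)) atTop (𝓝 0) :=
    (continuous_coe_real_ereal.tendsto 0).comp hb
  refine tendsto_of_tendsto_of_tendsto_of_le_of_le' tendsto_const_nhds hb'
    (.of_forall fun n => maxGain_nonneg μ τ T _) ?_
  filter_upwards [hle] with n hn
  rw [maxGain_eq]
  exact iSup_le fun x => EReal.coe_le_coe_iff.2 (hn x)

lemma ae_tendsto_gain [Nonempty 𝕏] (hM : IsModel P ν₀ ξ U)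
    (hX : IsQuasiSUR τ (lossFunctional (excursionLoss μ T)) P ν₀ ξ U X) :
    ∀ᵐ ω ∂P, ∀ x, Tendsto (fun n => gain μ τ T (postLaw τ ν₀ ξ U X n ω) x) atTop (𝓝 0) := by
  filter_upwards [ae_tendsto_gain_bound μ hM hX] with ω ⟨b, hb, hle⟩ x
  refine tendsto_of_tendsto_of_tendsto_of_le_of_le' tendsto_const_nhds hb
    (.of_forall fun n => gain_nonneg μ τ T _ x) ?_
  filter_upwards [hle] with n hn using hn x

lemma IsModel.memLp_xi (hM : IsModel P ν₀ ξ U) : MemLp ξ 2 P := by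
  have h : MemLp id 2 (P.map ξ) := by
    rw [hM.map_xi]
    exact IsGaussian.memLp_two_id
  exact (memLp_map_measure_iff aestronglyMeasurable_id hM.measurable_xi.aemeasurable).1 h

/-- The limiting posterior distribution of a quasi-optimal design exists, the functional converges
to its value there, and this value is zero. -/
lemma exists_limit_posterior [Nonempty 𝕏] (hM : IsModel P ν₀ ξ U)
    (hX : IsQuasiSUR τ (lossFunctional (excursionLoss μ T)) P ν₀ ξ U X) :
    ∃ ν' : Ω → GaussianMeasure 𝕏, Measurable[⨆ n, obsSigma τ ξ U X n] ν' ∧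
      IsCondDistrib P ξ (⨆ n, obsSigma τ ξ U X n) ν' ∧
      (∀ᵐ ω ∂P, lossFunctional (excursionLoss μ T) (ν' ω) = 0) ∧
      ∀ᵐ ω ∂P, Tendsto (fun n => lossFunctional (excursionLoss μ T)
        (postLaw τ ν₀ ξ U X n ω)) atTop (𝓝 (lossFunctional (excursionLoss μ T) (ν' ω))) := by
  have hξ := hM.measurable_xi
  have hseq : IsSequentialDesign τ ξ U X := by
    obtain ⟨ε, _, _, h, _⟩ := hX
    exact h
  set ℱ := obsFiltration τ hM hseq with hℱ
  have hν : ∀ n, IsDisintegration P ξ (ℱ n) (postLaw τ ν₀ ξ U X n) := fun n =>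
    hM.isDisintegration_postLaw hseq n
  obtain ⟨ν', hν'⟩ := exists_isDisintegration_iSup hν hξ hM.memLp_xi ν₀
  have hle : (⨆ n, ℱ n : MeasurableSpace Ω) ≤ mΩ := iSup_le fun n => ℱ.le n
  refine ⟨ν', hν'.measurable, hν'.isCondDistrib hle hξ,
    ae_lossFunctional_limit_eq_zero μ hν hν' hξ hM.memLp_xi (ae_tendsto_gain μ hM hX), ?_⟩
  filter_upwards [ae_tendsto_lossFunctional μ T
    (fun n => (hν n).measurable.mono (ℱ.le n) le_rfl) (hν'.measurable.mono hle le_rfl)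
    fun y => ae_tendsto_excVar hν hν' hξ T y] with ω hω
  exact NNReal.tendsto_coe.1 hω

end QuasiSUR

end SUR

/-! ### Regularity of the loss -/

namespace SUR

section Continuity

variable {𝕏 : Type u} [MetricSpace 𝕏] [CompactSpace 𝕏] [MeasurableSpace 𝕏] [BorelSpace 𝕏]
  {Ω : Type v} [mΩ : MeasurableSpace Ω]
  {P : Measure Ω} [IsProbabilityMeasure P] {ξ : Ω → C(𝕏, ℝ)} {ν : Ω → GaussianMeasure 𝕏}

/-- Events of probability zero have conditional probability zero almost surely. -/
lemma ae_measure_eq_zero_of_mem_gaussianCondDistribs (hν : ν ∈ gaussianCondDistribs P ξ)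
    {B : Set C(𝕏, ℝ)} (hB : MeasurableSet B) (h0 : ∀ᵐ ω ∂P, ξ ω ∉ B) :
    ∀ᵐ ω ∂P, (ν ω : Measure C(𝕏, ℝ)) B = 0 := by
  obtain ⟨-, 𝓖, -, h⟩ := hν
  have h1 : (ξ ⁻¹' B).indicator (fun _ => (1 : ℝ)) =ᵐ[P] (0 : Ω → ℝ) := by
    filter_upwards [h0] with ω hω
    exact Set.indicator_of_notMem (s := ξ ⁻¹' B) hω fun _ => (1 : ℝ)
  filter_upwards [h B hB, condExp_congr_ae (m := 𝓖) h1] with ω h2 h3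
  rw [h3, condExp_zero] at h2
  exact (measureReal_eq_zero_iff).1 h2

lemma covFun_self_eq_zero_of_ae_eq {ν : GaussianMeasure 𝕏} {y : 𝕏} {c : ℝ}
    (h : (ν : Measure C(𝕏, ℝ)) {f | f y ≠ c} = 0) : covFun ν y y = 0 := by
  have h1 : ∀ᵐ f ∂(ν : Measure C(𝕏, ℝ)), f y = c := by
    rw [ae_iff]
    exact h
  have e1 : meanFun ν y = c := by
    rw [meanFun, integral_congr_ae (g := fun _ => c) h1]
    simp
  have e2 : ∫ f : C(𝕏, ℝ), f y * f y ∂(ν : Measure C(𝕏, ℝ)) = c * c := by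
    rw [integral_congr_ae (g := fun _ => c * c) (h1.mono fun f hf => by simp only [hf])]
    simp
  rw [covFun_eq, e1, e2, sub_self]

lemma measure_eval_eq {ν : GaussianMeasure 𝕏} {y : 𝕏} {s : Set ℝ} (hs : MeasurableSet s) :
    (ν : Measure C(𝕏, ℝ)) {f | f y ∈ s} =
      gaussianReal (meanFun ν y) (covFun ν y y).toNNReal s := by
  rw [← map_eval_eq_gaussianReal, Measure.map_apply (measurable_eval y) hs]
  rfl

/-- Almost sure continuity of the Bernoulli variance at a fixed point. If the prior is degenerate
there, every conditional variance vanishes. Otherwise the prior does not charge `{f y = T}`, hence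
almost surely the limiting measure does not either, and the excursion probability is continuous at
such a measure. -/
lemma ae_tendsto_excVar_of_gaussianTendsto (T : ℝ) (hξ : Measurable ξ) (hg : HasGaussianLaw ξ P)
    {ν : ℕ → Ω → GaussianMeasure 𝕏} {ν' : Ω → GaussianMeasure 𝕏}
    (hν : ∀ n, ν n ∈ gaussianCondDistribs P ξ) (hν' : ν' ∈ gaussianCondDistribs P ξ)
    (hlim : ∀ᵐ ω ∂P, GaussianTendsto (fun n => ν n ω) (ν' ω)) (y : 𝕏) :
    ∀ᵐ ω ∂P, Tendsto (fun n => excVar T (ν n ω) y) atTop (𝓝 (excVar T (ν' ω) y)) := by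
  set ν₀ : GaussianMeasure 𝕏 := ⟨P.map ξ, hg.isGaussian_map⟩ with hν₀
  have hprior : ∀ {s : Set ℝ}, MeasurableSet s →
      P {ω | ξ ω y ∈ s} = gaussianReal (meanFun ν₀ y) (covFun ν₀ y y).toNNReal s := by
    intro s hs
    rw [← measure_eval_eq hs]
    exact (Measure.map_apply hξ (measurable_eval y hs)).symm
  by_cases h0 : covFun ν₀ y y = 0
  · have hB : MeasurableSet {f : C(𝕏, ℝ) | f y ≠ meanFun ν₀ y} :=
      measurable_eval y (measurableSet_singleton _).compl
    have hnull : ∀ᵐ ω ∂P, ξ ω ∉ {f : C(𝕏, ℝ) | f y ≠ meanFun ν₀ y} := by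
      rw [ae_iff]
      simp only [not_not]
      have := hprior (measurableSet_singleton (meanFun ν₀ y)).compl
      rw [h0, Real.toNNReal_zero, gaussianReal_zero_var] at this
      simpa using this
    filter_upwards [ae_all_iff.2 fun n =>
      ae_measure_eq_zero_of_mem_gaussianCondDistribs (hν n) hB hnull,
      ae_measure_eq_zero_of_mem_gaussianCondDistribs hν' hB hnull] with ω h1 h2
    have e1 : ∀ n, excVar T (ν n ω) y = 0 := fun n =>
      excVar_eq_zero (covFun_self_eq_zero_of_ae_eq (h1 n))
    simp_rw [e1, excVar_eq_zero (covFun_self_eq_zero_of_ae_eq h2)]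
    exact tendsto_const_nhds
  · have hB : MeasurableSet {f : C(𝕏, ℝ) | f y ∈ ({T} : Set ℝ)} :=
      measurable_eval y (measurableSet_singleton _)
    have hnull : ∀ᵐ ω ∂P, ξ ω ∉ {f : C(𝕏, ℝ) | f y ∈ ({T} : Set ℝ)} := by
      have hv : (covFun ν₀ y y).toNNReal ≠ 0 := by
        rw [ne_eq, Real.toNNReal_eq_zero, not_le]
        exact lt_of_le_of_ne (covFun_self_nonneg ν₀ y) (Ne.symm h0)
      have hatom := nullSingletonClass_gaussianReal (μ := meanFun ν₀ y) hv
      rw [ae_iff]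
      simp only [not_not]
      have := hprior (measurableSet_singleton T)
      rw [measure_singleton] at this
      exact this
    filter_upwards [ae_measure_eq_zero_of_mem_gaussianCondDistribs hν' hB hnull, hlim]
      with ω h1 h2
    have hm := h2.1.tendsto_at y
    have hk := h2.2.tendsto_at (y, y)
    have hne : √(covFun (ν' ω) y y) ≠ 0 ∨ meanFun (ν' ω) y ≠ T := by
      by_contra! hcon
      rw [measure_eval_eq (measurableSet_singleton T), hcon.2,
        (Real.sqrt_eq_zero (covFun_self_nonneg _ _)).1 hcon.1, Real.toNNReal_zero,
        gaussianReal_zero_var] at h1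
      simp at h1
    simp_rw [excVar_eq]
    have h3 := tendsto_normalTail (T := T) hne hm hk.sqrt
    exact h3.mul (tendsto_const_nhds.sub h3)

end Continuity

section Regular

variable {𝕏 : Type u} [MetricSpace 𝕏] [CompactSpace 𝕏] [MeasurableSpace 𝕏] [BorelSpace 𝕏]
  (μ : Measure 𝕏) [IsFiniteMeasure μ] (T : ℝ)

lemma isPContinuous_lossFunctional : IsPContinuous.{u, v} fun ν : GaussianMeasure 𝕏 =>
    (lossFunctional (excursionLoss μ T) ν : ℝ) := by
  refine ⟨(measurable_lossFunctional μ T).coe_nnreal_real, ?_⟩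
  intro Ω _ P _ ξ hξ hg ν ν' hν hν' hlim
  exact ae_tendsto_lossFunctional μ T (fun n => (hν n).1) hν'.1
    (ae_tendsto_excVar_of_gaussianTendsto T hξ hg hν hν' hlim)

lemma isPUniformlyIntegrable_lossFunctional :
    IsPUniformlyIntegrable.{u, v} fun ν : GaussianMeasure 𝕏 =>
      (lossFunctional (excursionLoss μ T) ν : ℝ) := by
  refine ⟨(measurable_lossFunctional μ T).coe_nnreal_real, ?_⟩
  intro Ω _ P _ ξ _ _
  refine uniformIntegrable_of le_rfl ENNReal.one_ne_top (fun ν =>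
    ((measurable_lossFunctional μ T).coe_nnreal_real.comp ν.2.1).aestronglyMeasurable)
    fun ε _ => ⟨(μ.real Set.univ).toNNReal + 1, fun ν => ?_⟩
  -- The functional is bounded by `μ(𝕏)`, so nothing is left above the level `μ(𝕏) + 1`.
  have hempty : {ω | (μ.real Set.univ).toNNReal + 1 ≤
      ‖(lossFunctional (excursionLoss μ T) (ν.1 ω) : ℝ)‖₊} = ∅ := by
    refine Set.eq_empty_of_forall_notMem fun ω hω => ?_
    rw [Set.mem_ofPred_eq, ← NNReal.coe_le_coe] at hω
    have h1 := lossFunctional_le μ T (ν.1 ω)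
    simp only [NNReal.coe_add, NNReal.coe_one, Real.coe_toNNReal _ measureReal_nonneg,
      coe_nnnorm, NNReal.norm_eq] at hω
    linarith
  rw [hempty]
  simp

lemma isDecomposition_lossFunctional :
    IsDecomposition (lossFunctional (excursionLoss μ T)) 0 fun ν : GaussianMeasure 𝕏 =>
      (lossFunctional (excursionLoss μ T) ν : ℝ) :=
  ⟨measurable_const, fun _ => integrable_zero _ _ _, fun ν => by simp⟩

lemma isRegularLoss_excursionLoss [Nonempty 𝕏] (τ : C(𝕏, ℝ≥0)) :
    IsRegularLoss.{u, v, u} τ (excursionLoss μ T) where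
  separable := separableSpace_softClassifier μ
  measurable_loss := measurable_excursionLoss μ T
  finite ν d := by
    rw [expectedLoss_eq]
    exact ENNReal.ofReal_ne_top
  continuous := continuous_expectedLoss μ T
  decomposition := ⟨_, _, isDecomposition_lossFunctional μ T,
    isPUniformlyIntegrable_lossFunctional μ T, isPContinuous_lossFunctional μ T⟩
  zeros := Set.ext fun ν => (maxGain_eq_zero_iff μ τ T ν).symm

lemma hasSupermartingaleProperty_lossFunctional (τ : C(𝕏, ℝ≥0)) :
    HasSupermartingaleProperty.{u, v} τ fun ν : GaussianMeasure 𝕏 =>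
      (lossFunctional (excursionLoss μ T) ν : ℝ) :=
  hasSupermartingaleProperty_of_expectedUncertainty_le (measurable_lossFunctional μ T)
    (lossFunctional_le μ T) fun x ν => expectedUncertainty_le μ τ T ν x

/-- Quasi-optimal designs exist, for any prescribed tolerances. -/
lemma exists_quasiSUR_design [Nonempty 𝕏] (τ : C(𝕏, ℝ≥0)) {Ω : Type v} (ν₀ : GaussianMeasure 𝕏)
    (ξ : Ω → C(𝕏, ℝ)) (U : ℕ → Ω → ℝ) {ε : ℕ → ℝ} (hε : ∀ n, 0 < ε n) :
    ∃ X : ℕ → Ω → 𝕏, IsSequentialDesign τ ξ U X ∧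
      ∀ ω, QuasiSURFrom τ (lossFunctional (excursionLoss μ T)) ν₀ ξ U X ε 0 ω := by
  have hJ : ∀ x, Measurable (expectedUncertainty τ (lossFunctional (excursionLoss μ T)) x) :=
    fun x => by
      have h := (measurable_expectedUncertainty μ τ T).comp
        (by fun_prop : Measurable fun ν : GaussianMeasure 𝕏 => (ν, x))
      exact h
  choose sel hsel hopt using fun n => exists_measurable_selection hJ
    (fun x ν => expectedUncertainty_ne_top μ τ T ν x)
    (fun ν => iInf_expectedUncertainty_denseSeq μ τ T ν) (hε n)
  obtain ⟨X, hX, hXs⟩ := exists_design_of_selection τ ν₀ ξ U hsel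
  refine ⟨X, hX, fun ω n _ => ?_⟩
  rw [hXs]
  exact hopt n _

end Regular

end SUR

theorem mainTheorem5 {𝕏 : Type u} [MetricSpace 𝕏] [CompactSpace 𝕏] [Nonempty 𝕏]
    [MeasurableSpace 𝕏] [BorelSpace 𝕏] (τ : C(𝕏, ℝ≥0)) (μ : Measure 𝕏) [IsFiniteMeasure μ]
    (T : ℝ) :
    -- the loss is regular
    IsRegularLoss.{u, v, u} τ (excursionLoss μ T) ∧
    -- it induces the integrated Bernoulli variance
    (∀ ν : GaussianMeasure 𝕏,
      Integrable (fun x => excursionProb T ν x * (1 - excursionProb T ν x)) μ ∧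
      (lossFunctional (excursionLoss μ T) ν : ℝ) =
        ∫ x, excursionProb T ν x * (1 - excursionProb T ν x) ∂μ) ∧
    -- the induced functional is measurable, has the supermartingale property, and decomposes
    Measurable (lossFunctional (excursionLoss μ T)) ∧
    HasSupermartingaleProperty.{u, v} τ (fun ν => (lossFunctional (excursionLoss μ T) ν : ℝ)) ∧
    (∃ L₀ H₁, IsDecomposition (lossFunctional (excursionLoss μ T)) L₀ H₁ ∧
      IsPUniformlyIntegrable.{u, v} H₁ ∧ IsPContinuous.{u, v} H₁ ∧
      HasSupermartingaleProperty.{u, v} τ H₁) ∧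
    -- for every Gaussian random element and every noise sequence
    ∀ (Ω : Type v) [MeasurableSpace Ω] (P : Measure Ω) [IsProbabilityMeasure P]
      (ν₀ : GaussianMeasure 𝕏) (ξ : Ω → C(𝕏, ℝ)) (U : ℕ → Ω → ℝ), IsModel P ν₀ ξ U →
      -- quasi-SUR designs exist
      (∀ ε : ℕ → ℝ, (∀ n, 0 < ε n) → ∃ X : ℕ → Ω → 𝕏,
        IsEpsQuasiSUR τ (lossFunctional (excursionLoss μ T)) P ν₀ ξ U X ε ∧
        ∀ ω, QuasiSURFrom τ (lossFunctional (excursionLoss μ T)) ν₀ ξ U X ε 0 ω) ∧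
      -- for every quasi-SUR design, the functionals converge along the posterior distributions
      -- and the residual uncertainty tends to zero
      (∀ X : ℕ → Ω → 𝕏, IsQuasiSUR τ (lossFunctional (excursionLoss μ T)) P ν₀ ξ U X →
        (∃ ν' : Ω → GaussianMeasure 𝕏, Measurable[⨆ n, obsSigma τ ξ U X n] ν' ∧
          IsCondDistrib P ξ (⨆ n, obsSigma τ ξ U X n) ν' ∧
          (∀ᵐ ω ∂P, Tendsto (fun n => lossFunctional (excursionLoss μ T)
            (postLaw τ ν₀ ξ U X n ω)) atTop (𝓝 (lossFunctional (excursionLoss μ T) (ν' ω)))) ∧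
          (∀ᵐ ω ∂P, Tendsto (fun n => maxGain τ (lossFunctional (excursionLoss μ T))
            (postLaw τ ν₀ ξ U X n ω)) atTop
              (𝓝 (maxGain τ (lossFunctional (excursionLoss μ T)) (ν' ω))))) ∧
        ∀ᵐ ω ∂P, Tendsto (fun n => lossFunctional (excursionLoss μ T)
          (postLaw τ ν₀ ξ U X n ω)) atTop (𝓝 0)) := by
  refine ⟨isRegularLoss_excursionLoss μ T τ,
    fun ν => ⟨integrable_excVar T μ ν, lossFunctional_eq μ T ν⟩, measurable_lossFunctional μ T,
    hasSupermartingaleProperty_lossFunctional μ T τ,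
    ⟨_, _, isDecomposition_lossFunctional μ T, isPUniformlyIntegrable_lossFunctional μ T,
      isPContinuous_lossFunctional μ T, hasSupermartingaleProperty_lossFunctional μ T τ⟩, ?_⟩
  intro Ω _ P _ ν₀ ξ U hM
  refine ⟨fun ε hε => ?_, fun X hX => ?_⟩
  · obtain ⟨X, hX, hq⟩ := exists_quasiSUR_design μ T τ ν₀ ξ U hε
    exact ⟨X, ⟨hX, 0, .of_forall hq⟩, hq⟩
  · obtain ⟨ν', hm, hcond, hzero, hlim⟩ := exists_limit_posterior μ hM hX
    refine ⟨⟨ν', hm, hcond, hlim, ?_⟩, ?_⟩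
    · filter_upwards [ae_tendsto_maxGain μ hM hX, hzero] with ω h1 h2
      rwa [(maxGain_eq_zero_iff μ τ T (ν' ω)).2 h2]
    · filter_upwards [hlim, hzero] with ω h1 h2
      rwa [h2] at h1
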